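/- All Turing machines below are nondeterministic multi-tape machines with $t$ external memory tapes (the first of which initially holds the input) and $u$ internal memory tapes, all tapes being one-sided infinite. In every step a successor configuration is chosen uniformly at random among all possible ones; the probability of a run is the product of the probabilities of its steps, and the probability that $T$ accepts $w$ is the sum of the probabilities of its accepting runs on $w$. For $r,s:\mathbb N\to\mathbb N$ and $t\in\mathbb N$, such a machine is $(r,s,t)$-bounded if every run on every input of length $N$ (for every $N\in\mathbb N$) is finite, satisfies $1+\sum_{i}\mathrm{rev}(i)\le r(N)$, where $\mathrm{rev}(i)$ is the number of direction changes of the head on the $i$-th external tape, and uses in total at most $s(N)$ cells on the internal memory tapes. A decision problem $L$ belongs to $\mathrm{RST}(r,s,t)$ if there is an $(r,s,t)$-bounded machine $T$ (with any number $u$ of internal tapes) such that for every input instance $w$: if $w$ is a yes-instance then $\Pr(T\text{ accepts }w)\ge\frac12$, and otherwise $\Pr(T\text{ accepts }w)=0$. Let $\mathrm{RST}(r,s,O(1))=\bigcup_{t\in\mathbb N}\mathrm{RST}(r,s,t)$. The input instances of the following three problems are the words $v_1\#\cdots v_m\#v'_1\#\cdots v'_m\#$ with $m\ge 0$ and $v_i,v'_i\in\{0,1\}^*$.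 Set-Equality: is $\{v_1,\dots,v_m\}=\{v'_1,\dots,v'_m\}$? Multiset-Equality: are the multisets $\{v_1,\dots,v_m\}$ and $\{v'_1,\dots,v'_m\}$ equal? CheckSort: is $v'_1,\dots,v'_m$ the lexicographically sorted (in ascending order) version of $v_1,\dots,v_m$? Theorem. Let $r,s:\mathbb N\to\mathbb N$ be such that $r(N)\in o(\log N)$ and $s(N)\in o\big(\sqrt[4]{N}/r(N)\big)$. Then none of the problems CheckSort, Set-Equality, Multiset-Equality belongs to $\mathrm{RST}(r,s,O(1))$. -/

import Mathlib

open Filter Asymptotics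
open scoped ENNReal

namespace ExtMem

/-- The input alphabet `{0, 1, #}`: `some false` is `0`, `some true` is `1`, `none` is `#`. -/
abbrev Letter : Type := Option Bool

/-- The tapes of a machine with `t` external and `u` internal memory tapes. -/
abbrev Tape (t u : ℕ) : Type := Fin t ⊕ Fin u

/-- A nondeterministic multi-tape Turing machine with `t` external and `u` internal memory tapes.
Head movements are `-1` (left), `0` (no move), `1` (right). -/
structure NTM (t u : ℕ) where
  /-- the states -/
  State : Type
  /-- the tape alphabet -/
  Sym : Type
  finite_state : Finite State
  finite_sym : Finite Sym
  /-- the blank symbol -/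
  blank : Sym
  /-- the input letters as tape symbols -/
  letter : Letter → Sym
  letter_injective : Function.Injective letter
  letter_ne_blank : ∀ a, letter a ≠ blank
  /-- the start state -/
  start : State
  /-- the final states -/
  final : Set State
  /-- the accepting states -/
  accept : Set State
  accept_subset : accept ⊆ final
  /-- the transition relation: state, symbols read, new state, symbols written, movements -/
  trans : Set (State × (Tape t u → Sym) × State × (Tape t u → Sym) × (Tape t u → SignType))
  trans_source : ∀ τ ∈ trans, τ.1 ∉ final

namespace NTM

variable {t u : ℕ}

/-- Configurations; the cells of the one-sided infinite tapes are numbered `0, 1, 2, …`. -/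
structure Config (M : NTM t u) where
  /-- the current state -/
  state : M.State
  /-- the head positions -/
  pos : Tape t u → ℕ
  /-- the tape inscriptions -/
  tape : Tape t u → ℕ → M.Sym

/-- The inscription of a tape holding the word `w`, followed by blanks. -/
def inscription (M : NTM t u) (w : List Letter) (n : ℕ) : M.Sym :=
  (w[n]?).elim M.blank M.letter

/-- The initial configuration on input `w`: the first external tape holds `w`, all other tapes are
blank, and all heads are on the leftmost cell. -/
def init (M : NTM t u) (w : List Letter) : M.Config where
  state := M.start
  pos := fun _ => 0
  tape := Sum.elim (fun i => M.inscription (if i.val = 0 then w else []))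
    (fun _ => M.inscription [])

/-- The set of configurations reachable from `γ` in a single step. A transition that would move a
head off the left end of its tape is not applicable. -/
def next (M : NTM t u) (γ : M.Config) : Set M.Config :=
  {γ' | ∃ τ ∈ M.trans, τ.1 = γ.state ∧ (∀ i, τ.2.1 i = γ.tape i (γ.pos i)) ∧
    γ'.state = τ.2.2.1 ∧
    (∀ i, γ'.tape i = Function.update (γ.tape i) (γ.pos i) (τ.2.2.2.1 i)) ∧
    (∀ i, (γ'.pos i : ℤ) = (γ.pos i : ℤ) + (τ.2.2.2.2 i : ℤ))}

/-- `ρ` is a (finite, complete) run of `M` on input `w`. Its last configuration has no successor;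
so it is final, or `M` is stuck there, which counts as halting without acceptance. -/
def IsRun (M : NTM t u) (w : List Letter) (ρ : List M.Config) : Prop :=
  ρ.head? = some (M.init w) ∧ ρ.IsChain (fun γ γ' => γ' ∈ M.next γ) ∧
    ∀ γ ∈ ρ.getLast?, M.next γ = ∅

/-- `ρ` is an infinite run of `M` on input `w`. -/
def IsInfiniteRun (M : NTM t u) (w : List Letter) (ρ : ℕ → M.Config) : Prop :=
  ρ 0 = M.init w ∧ ∀ n, ρ (n + 1) ∈ M.next (ρ n)

/-- `ρ` is an accepting run of `M` on input `w`. -/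
def IsAcceptingRun (M : NTM t u) (w : List Letter) (ρ : List M.Config) : Prop :=
  M.IsRun w ρ ∧ ∃ γ ∈ ρ.getLast?, γ.state ∈ M.accept

/-- The directions of the proper moves of a head that is successively at the given positions
(steps in which the head does not move are dropped). -/
def directions (p : List ℕ) : List SignType :=
  ((p.zip p.tail).map fun x =>
    if x.1 < x.2 then 1 else if x.2 < x.1 then -1 else 0).filter (· ≠ 0)

/-- How often a head that is successively at the given positions changes its direction. -/
def turns (p : List ℕ) : ℕ :=
  ((directions p).zip (directions p).tail).countP fun x => x.1 ≠ x.2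

/-- The number of direction changes of the head on tape `i` in `ρ`. -/
def rev (M : NTM t u) (ρ : List M.Config) (i : Tape t u) : ℕ :=
  turns (ρ.map fun γ => γ.pos i)

/-- The number of cells of tape `i` that are visited in `ρ`. -/
def space (M : NTM t u) (ρ : List M.Config) (i : Tape t u) : ℕ :=
  (ρ.map fun γ => γ.pos i).toFinset.card

/-- `M` is `(r, s, t)`-bounded. -/
def IsBounded (M : NTM t u) (r s : ℕ → ℕ) : Prop :=
  ∀ w : List Letter,
    (¬ ∃ ρ, M.IsInfiniteRun w ρ) ∧
    ∀ ρ, M.IsRun w ρ →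
      1 + ∑ i : Fin t, M.rev ρ (Sum.inl i) ≤ r w.length ∧
      ∑ j : Fin u, M.space ρ (Sum.inr j) ≤ s w.length

/-- The probability of the run `ρ`, where every step goes to a uniformly chosen successor. -/
noncomputable def runProb (M : NTM t u) (ρ : List M.Config) : ℝ≥0∞ :=
  (ρ.dropLast.map fun γ => ((M.next γ).ncard : ℝ≥0∞)⁻¹).prod

/-- The probability that `M` accepts `w`. -/
noncomputable def acceptProb (M : NTM t u) (w : List Letter) : ℝ≥0∞ :=
  ∑' ρ : {ρ : List M.Config // M.IsAcceptingRun w ρ}, M.runProb ρ.1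

end NTM

/-- A decision problem: a set of words that are its input instances, and the set of those
instances for which the answer is yes. -/
structure DecisionProblem where
  /-- the input instances -/
  inst : Set (List Letter)
  /-- the yes-instances -/
  yes : Set (List Letter)
  yes_subset : yes ⊆ inst

/-- `M` solves `L` with one-sided error: yes-instances are accepted with probability at least
`1/2`, and no-instances with probability `0`. -/
def SolvesOneSided {t u : ℕ} (M : NTM t u) (L : DecisionProblem) : Prop :=
  ∀ w ∈ L.inst, (w ∈ L.yes → 2⁻¹ ≤ M.acceptProb w) ∧ (w ∉ L.yes → M.acceptProb w = 0)

/-- The class `RST(r, s, t)`. -/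
def RST (r s : ℕ → ℕ) (t : ℕ) : Set DecisionProblem :=
  {L | ∃ (u : ℕ) (M : NTM t u), M.IsBounded r s ∧ SolvesOneSided M L}

/-- The class `RST(r, s, O(1))`. -/
def RSTConst (r s : ℕ → ℕ) : Set DecisionProblem :=
  ⋃ t : ℕ, RST r s t

/-- The word `v₁#v₂#⋯vₖ#`. -/
def encode (v : List (List Bool)) : List Letter :=
  v.flatMap fun x => x.map some ++ [none]

/-- The problem with instances `v₁#⋯vₘ#v'₁#⋯v'ₘ#`, where `m ≥ 0` and the `vᵢ`, `v'ᵢ` are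
0-1-strings, whose yes-instances are those with `P (v₁, …, vₘ) (v'₁, …, v'ₘ)`. -/
def pairProblem (P : List (List Bool) → List (List Bool) → Prop) : DecisionProblem where
  inst := {w | ∃ v v' : List (List Bool), v.length = v'.length ∧ w = encode (v ++ v')}
  yes := {w | ∃ v v' : List (List Bool), v.length = v'.length ∧ w = encode (v ++ v') ∧ P v v'}
  yes_subset := fun _ ⟨v, v', h, hw, _⟩ => ⟨v, v', h, hw⟩

/-- Do both lists have the same set of entries? -/
def setEquality : DecisionProblem :=
  pairProblem fun v v' => {x | x ∈ v} = {x | x ∈ v'}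

/-- Do both lists have the same multiset of entries? -/
def multisetEquality : DecisionProblem :=
  pairProblem fun v v' => (v : Multiset (List Bool)) = (v' : Multiset (List Bool))

/-- Is the second list the lexicographically sorted (in ascending order) version of the first? -/
def checkSort : DecisionProblem :=
  pairProblem fun v v' => v'.Perm v ∧ v'.Pairwise (· ≤ ·)

end ExtMem

/-! Cut every run into phases, in which no external head turns, and cut the phases into blocks. Each
external cell carries a label, the set of input strings on which its content may depend. A block
ends when a head turns or enters a cell whose label at the start of the phase differs from that of
the cell it leaves. The cells swept in the block are then relabelled by `deps`, the union of the
labels under the heads.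

Two combinatorial facts carry the proof. Relabelling an interval creates at most two label changes,
so the number of blocks is linear in the number of input strings and exponential only in the number
of phases (`length_le_of_legitLog`). Within a phase the heads move monotonically, so the labels are
covered by few monotone relations between cells and strings. If `y` has no large set on which it is
monotone or antitone, then `x` and `y x` meet in a block for few `x` only
(`exists_card_le_of_legitLog`). For `y` the transposition of a `k × k` grid and `r = o(log N)`, some
`x` never meets its partner.

A hard input lists `k²` strings with free suffixes of `k ^ 6` bits, and then the same strings in
sorted order; prefixes fix the sorted position, and the partner of string `x` has transposed index.
By averaging, one choice function accepts at least half of the hard inputs (`exists_choices`). Its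
values are indexed by the block and by the step within the block, so that runs stay comparable even
if their earlier blocks had different lengths. The log of a run records state, head positions,
internal memory and scanned symbols at the end of each block. There are so few logs that two
accepted inputs share a log and differ in one string only, namely in an `x` that never meets its
partner.

Now change only the occurrence of that string in the first half. In each block `x` or its partner is
not involved, so the mixed run can follow one of the two given runs, and the common log glues the
blocks together (`Cross.block`, `acc_of_cross`). A no-instance is thus accepted with positive
probability. The count works because finite runs that are bounded in this way have at most `2 ^
O(k²)` steps (`length_le_runBound`): a log consists of `O(k³)` records of `O(k²)` bits each, which
is less than `k ^ 6`. -/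

namespace ExtMem

/-! ### Head directions and the bookkeeping of phases, blocks and labels -/

/-- `a ≤ b` in direction `true`, `b ≤ a` in direction `false`. -/
def DirLE (d : Bool) (a b : ℕ) : Prop := if d then a ≤ b else b ≤ a

theorem DirLE.refl (d : Bool) (a : ℕ) : DirLE d a a := by cases d <;> simp [DirLE]

theorem DirLE.trans {d : Bool} {a b c : ℕ} (h : DirLE d a b) (h' : DirLE d b c) :
    DirLE d a c := by
  cases d <;> simp only [DirLE, Bool.false_eq_true, if_false, if_true] at * <;> omega

theorem DirLE.antisymm {d : Bool} {a b : ℕ} (h : DirLE d a b) (h' : DirLE d b a) : a = b := by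
  cases d <;> simp [DirLE] at * <;> omega

/-- The direction of a head after a move from `a` to `b`, if it was `d` before. -/
def newDir (d : Bool) (a b : ℕ) : Bool := if a < b then true else if b < a then false else d

theorem newDir_eq_iff {d : Bool} {a b : ℕ} : newDir d a b = d ↔ DirLE d a b := by
  cases d <;> simp [newDir, DirLE] <;> omega

/-- Bookkeeping about the external tapes during a run that is divided into phases (without changes
of direction), which are divided into blocks of steps. Every cell is labelled with a finite set of
input strings on which its contents may depend. -/
structure Book (t : ℕ) where
  /-- the current directions of the heads -/
  dir : Fin t → Bool
  /-- the labels at the start of the current phase -/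
  lab : Fin t → ℕ → Finset ℕ
  /-- the labels at the start of the current block -/
  cur : Fin t → ℕ → Finset ℕ
  /-- the head positions at the start of the current block -/
  start : Fin t → ℕ
  /-- the number of the current phase -/
  phase : ℕ

namespace Book

variable {t : ℕ}

/-- The union of the labels of the cells at the given positions. -/
def union (L : Fin t → ℕ → Finset ℕ) (s : Fin t → ℕ) : Finset ℕ :=
  Finset.univ.biUnion fun i => L i (s i)

/-- The input strings that may be involved in the current block. -/
def deps (b : Book t) : Finset ℕ := union b.lab b.start

/-- Some head changes its direction. -/
def Turned (b : Book t) (en q : Fin t → ℕ) : Prop := ∃ i, newDir (b.dir i) (en i) (q i) ≠ b.dir i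

/-- The step in which the heads move from `en` to `q` ends the current block. -/
def Event (b : Book t) (en q : Fin t → ℕ) : Prop :=
  b.Turned en q ∨ ∃ i, b.lab i (q i) ≠ b.lab i (en i)

/-- The labels after the current block, in which the heads have moved to `en`. -/
def relabel (b : Book t) (en : Fin t → ℕ) (i : Fin t) (p : ℕ) : Finset ℕ :=
  if p ∈ Finset.uIcc (b.start i) (en i) then b.deps else b.cur i p

open scoped Classical in
/-- The bookkeeping after the current block, which is ended by a step from `en` to `q`. -/
noncomputable def adv (b : Book t) (en q : Fin t → ℕ) : Book t where
  dir := fun i => newDir (b.dir i) (en i) (q i)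
  lab := if b.Turned en q then b.relabel en else b.lab
  cur := b.relabel en
  start := q
  phase := if b.Turned en q then b.phase + 1 else b.phase

/-- The current block can end with a step from `en` to `q`. -/
structure Legit (b : Book t) (en q : Fin t → ℕ) : Prop where
  le : ∀ i, DirLE (b.dir i) (b.start i) (en i)
  le_succ : ∀ i, q i ≤ en i + 1
  succ_le : ∀ i, en i ≤ q i + 1
  event : b.Event en q

theorem dir_adv_of_not_turned {b : Book t} {en q : Fin t → ℕ} (h : ¬ b.Turned en q) (i : Fin t) :
    newDir (b.dir i) (en i) (q i) = b.dir i := by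
  by_contra h'
  exact h ⟨i, h'⟩

theorem dirLE_of_not_turned {b : Book t} {en q : Fin t → ℕ} (h : ¬ b.Turned en q) (i : Fin t) :
    DirLE (b.dir i) (en i) (q i) := newDir_eq_iff.1 (dir_adv_of_not_turned h i)

theorem mem_uIcc_iff {d : Bool} {a b p : ℕ} (h : DirLE d a b) :
    p ∈ Finset.uIcc a b ↔ DirLE d a p ∧ DirLE d p b := by
  cases d <;> simp [DirLE, Finset.mem_uIcc] at * <;> omega

/-! ### Counting blocks -/

/-- A bound for the number of label changes in the given phase. -/
def borderBound (t β : ℕ) : ℕ → ℕ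
  | 0 => β
  | h + 1 => (2 * t + 1) * borderBound t β h + 2 * t

/-- A bound for the number of blocks up to the given phase. -/
def blockBound (t β : ℕ) : ℕ → ℕ
  | 0 => β
  | h + 1 => blockBound t β h + 1 + borderBound t β (h + 1)

/-- Adding 1 turns the recursion into a geometric one with ratio `2 * t + 1`. -/
theorem borderBound_add_one (t β h : ℕ) : borderBound t β h + 1 = (2 * t + 1) ^ h * (β + 1) := by
  induction h with
  | zero => simp [borderBound]
  | succ h ih =>
    have : (2 * t + 1) * (borderBound t β h + 1) = (2 * t + 1) ^ (h + 1) * (β + 1) := by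
      rw [ih]; ring
    rw [← this, borderBound]; ring

theorem blockBound_add_one_le (t β h : ℕ) :
    blockBound t β h + 1 ≤ (h + 1) * ((2 * t + 1) ^ h * (β + 1)) := by
  induction h with
  | zero => simp [blockBound]
  | succ h ih =>
    have h1 := borderBound_add_one t β (h + 1)
    have h2 : (2 * t + 1) ^ h * (β + 1) ≤ (2 * t + 1) ^ (h + 1) * (β + 1) :=
      Nat.mul_le_mul_right _ (Nat.pow_le_pow_right (by omega) (by omega))
    have h3 := Nat.mul_le_mul_left (h + 1) h2
    rw [blockBound]
    calc _ = (blockBound t β h + 1) + (borderBound t β (h + 1) + 1) := by ring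
      _ ≤ (h + 1) * ((2 * t + 1) ^ (h + 1) * (β + 1)) + (2 * t + 1) ^ (h + 1) * (β + 1) := by
        omega
      _ = _ := by ring

/-- Every label change is listed in `S`. -/
def Borders (S : Finset (Fin t × ℕ)) (L : Fin t → ℕ → Finset ℕ) : Prop :=
  ∀ i p, (i, p) ∉ S → L i p = L i (p + 1)

/-- The borders that are still ahead of the heads. -/
def ahead (b : Book t) (S : Finset (Fin t × ℕ)) : Finset (Fin t × ℕ) :=
  S.filter fun x => if b.dir x.1 then b.start x.1 ≤ x.2 else x.2 < b.start x.1

/-- The invariant for counting blocks. -/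
def BorderInv (β : ℕ) (b : Book t) (κ : ℕ) : Prop :=
  ∃ S S' : Finset (Fin t × ℕ), Borders S b.lab ∧ Borders S' b.cur ∧
    S.card ≤ borderBound t β b.phase ∧
    S'.card + 2 * t * (b.ahead S).card ≤ (2 * t + 1) * borderBound t β b.phase ∧
    κ + (b.ahead S).card ≤ blockBound t β b.phase

/-- Overwriting one interval per tape by a constant label can create changes only at its two ends.
-/
theorem exists_borders_relabel (b : Book t) (en : Fin t → ℕ) {S : Finset (Fin t × ℕ)}
    (hS : Borders S b.cur) :
    ∃ S', Borders S' (b.relabel en) ∧ S'.card ≤ S.card + 2 * t := by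
  -- For an interval that starts at cell 0 the truncated subtraction gives 0, a superfluous but
  -- harmless border.
  refine ⟨S ∪ (Finset.univ.image (fun i => (i, min (b.start i) (en i) - 1)) ∪
    Finset.univ.image fun i => (i, max (b.start i) (en i))), ?_, ?_⟩
  · intro i p hp
    simp only [Finset.mem_union, Finset.mem_image, Finset.mem_univ, true_and, not_or, not_exists,
      Prod.mk.injEq, not_and] at hp
    obtain ⟨h1, h2, h3⟩ := hp
    have h2 := h2 i rfl
    have h3 := h3 i rfl
    have h4 : p ∈ Finset.uIcc (b.start i) (en i) ↔ p + 1 ∈ Finset.uIcc (b.start i) (en i) := by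
      simp only [Finset.mem_uIcc]
      omega
    simp only [relabel, h4, hS i p h1]
  · refine (Finset.card_union_le _ _).trans (Nat.add_le_add_left ?_ _)
    refine (Finset.card_union_le _ _).trans ?_
    have h1 := Finset.card_image_le (s := (Finset.univ : Finset (Fin t)))
      (f := fun i => (i, min (b.start i) (en i) - 1))
    have h2 := Finset.card_image_le (s := (Finset.univ : Finset (Fin t)))
      (f := fun i => (i, max (b.start i) (en i)))
    simp only [Finset.card_univ, Fintype.card_fin] at h1 h2
    omega

/-- A block that ends without a turn ends because a head crosses a border of `lab`. That border is
no longer ahead, and heads that do not turn never get a border back in front of them. -/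
theorem card_ahead_adv_lt {b : Book t} {en q : Fin t → ℕ} (hl : b.Legit en q)
    (ht : ¬ b.Turned en q) {S : Finset (Fin t × ℕ)} (hS : Borders S b.lab) :
    ((b.adv en q).ahead S).card < (b.ahead S).card := by
  have hdir : ∀ i, (b.adv en q).dir i = b.dir i := fun i => dir_adv_of_not_turned ht i
  have hst : ∀ i, (b.adv en q).start i = q i := fun i => rfl
  apply Finset.card_lt_card
  rw [Finset.ssubset_iff_of_subset]
  · obtain ⟨i, hi⟩ := hl.event.resolve_left ht
    have h1 := hl.le i
    have h2 := dirLE_of_not_turned ht i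
    have h3 := hl.le_succ i
    have h4 := hl.succ_le i
    have h5 : q i ≠ en i := fun h => hi (by rw [h])
    cases hd : b.dir i
    · simp only [hd, DirLE, Bool.false_eq_true, if_false] at h1 h2
      have h6 : en i = q i + 1 := by omega
      refine ⟨(i, q i), ?_, ?_⟩
      · simp only [ahead, Finset.mem_filter, hd, Bool.false_eq_true, if_false]
        refine ⟨?_, by omega⟩
        by_contra h
        exact hi (by rw [h6, hS i _ h])
      · simp [ahead, hd, hdir, hst]
    · simp only [hd, DirLE, if_true] at h1 h2
      have h6 : q i = en i + 1 := by omega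
      refine ⟨(i, en i), ?_, ?_⟩
      · simp only [ahead, Finset.mem_filter, hd, if_true]
        refine ⟨?_, by omega⟩
        by_contra h
        exact hi (by rw [h6, hS i _ h])
      · simp [ahead, hd, hdir, hst, h6]
  · rintro ⟨i, p⟩ hp
    simp only [ahead, Finset.mem_filter, hdir, hst] at hp ⊢
    refine ⟨hp.1, ?_⟩
    have h1 := hl.le i
    have h2 := dirLE_of_not_turned ht i
    have h3 := hp.2
    cases hd : b.dir i <;> simp only [hd, DirLE, Bool.false_eq_true, if_false, if_true] at * <;>
      omega

/-- An amortized count: every border ahead is a credit for one more block in this phase, and hence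
for `2 * t` new borders in `cur`. When a head turns, all credits may have been spent, and the final
block of the phase adds another `2 * t` borders. -/
theorem BorderInv.adv {β κ : ℕ} {b : Book t} {en q : Fin t → ℕ} (h : BorderInv β b κ)
    (hl : b.Legit en q) : BorderInv β (b.adv en q) (κ + 1) := by
  obtain ⟨S, S', h1, h2, h3, h4, h5⟩ := h
  obtain ⟨S'', h6, h7⟩ := exists_borders_relabel b en h2
  by_cases ht : b.Turned en q
  · have hlab : (b.adv en q).lab = b.relabel en := by simp [Book.adv, ht]
    have hph : (b.adv en q).phase = b.phase + 1 := by simp [Book.adv, ht]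
    have h8 : ((b.adv en q).ahead S'').card ≤ S''.card := Finset.card_filter_le _ _
    have h9 : S''.card ≤ borderBound t β (b.phase + 1) := by
      rw [borderBound]
      have : S'.card ≤ (2 * t + 1) * borderBound t β b.phase := by
        have : 0 ≤ 2 * t * (b.ahead S).card := Nat.zero_le _
        omega
      omega
    -- After a turn `lab` and `cur` coincide, so one list of borders serves for both.
    refine ⟨S'', S'', hlab ▸ h6, h6, ?_, ?_, ?_⟩
    · rw [hph]; exact h9
    · rw [hph]
      have : 2 * t * ((b.adv en q).ahead S'').card ≤ 2 * t * borderBound t β (b.phase + 1) :=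
        Nat.mul_le_mul_left _ (h8.trans h9)
      rw [Nat.add_mul, one_mul]
      omega
    · rw [hph, blockBound]
      omega
  · have hlab : (b.adv en q).lab = b.lab := by simp [Book.adv, ht]
    have hph : (b.adv en q).phase = b.phase := by simp [Book.adv, ht]
    have h8 := card_ahead_adv_lt hl ht h1
    refine ⟨S, S'', hlab ▸ h1, h6, hph ▸ h3, ?_, ?_⟩
    · rw [hph]
      have : 2 * t * (((b.adv en q).ahead S).card + 1) ≤ 2 * t * (b.ahead S).card :=
        Nat.mul_le_mul_left _ h8
      rw [Nat.mul_add, mul_one] at this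
      omega
    · rw [hph]; omega

/-! ### Counting pairs of input strings that occur in the same block -/

/-- `G` is a partial function that is monotone (for `d = true`) or antitone (for `d = false`). -/
def MonoRel (d : Bool) (G : ℕ → ℕ → Prop) : Prop :=
  ∀ p p' x x', G p x → G p' x' → p ≤ p' → DirLE d x x'

/-- Directions behave like signs, with `true` as `+`; then `==` is their multiplication. -/
theorem MonoRel.dirLE {d e : Bool} {G : ℕ → ℕ → Prop} (h : MonoRel d G) {p p' x x' : ℕ}
    (hx : G p x) (hx' : G p' x') (hp : DirLE e p p') : DirLE (e == d) x x' := by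
  cases e
  · have := h p' p x' x hx' hx hp
    cases d <;> simpa [DirLE] using this
  · have := h p p' x x' hx hx' hp
    cases d <;> simpa [DirLE] using this

theorem MonoRel.comp {i d e : Bool} {G : ℕ → ℕ → Prop} (h : MonoRel d G) {f : ℕ → Option ℕ}
    (hf : ∀ p p' s s', f p = some s → f p' = some s' → DirLE i p p' → DirLE e s s') :
    MonoRel (i == (e == d)) fun p x => ∃ s, f p = some s ∧ G s x := by
  rintro p p' x x' ⟨s, hs, hx⟩ ⟨s', hs', hx'⟩ hp
  cases i
  · have := h.dirLE hx' hx (hf p' p s' s hs' hs hp)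
    cases d <;> cases e <;> simpa [DirLE] using this
  · have := h.dirLE hx hx' (hf p p' s s' hs hs' hp)
    cases d <;> cases e <;> simpa [DirLE] using this

/-- The relations `G i k` cover the labels `L i`. -/
structure Cover {ι : Type} (L : Fin t → ℕ → Finset ℕ) (G : Fin t → ι → ℕ → ℕ → Prop)
    (g : Fin t → ι → Bool) : Prop where
  mono : ∀ i k, MonoRel (g i k) (G i k)
  covers : ∀ i p, ∀ x ∈ L i p, ∃ k, G i k p x

/-- The starting positions `P` of the blocks of a phase form a chain. Fix the tapes and relations
through which `x` and `y x` are seen. As the block advances, both `x` and `y x` move monotonically,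
so `y` is monotone or antitone on the strings concerned. The square counts the pairs of such tapes
and relations. -/
theorem Cover.exists_card_le {ι : Type} [Fintype ι] {L : Fin t → ℕ → Finset ℕ}
    {G : Fin t → ι → ℕ → ℕ → Prop} {g : Fin t → ι → Bool} (hc : Cover L G g) {dir : Fin t → Bool}
    {P : Set (Fin t → ℕ)} (hP : ∀ s ∈ P, ∀ s' ∈ P,
      (∀ i, DirLE (dir i) (s i) (s' i)) ∨ ∀ i, DirLE (dir i) (s' i) (s i))
    {m Y : ℕ} {y : ℕ → ℕ}
    (hy : ∀ T ⊆ Finset.range m, MonotoneOn y (T : Set ℕ) ∨ AntitoneOn y (T : Set ℕ) → T.card ≤ Y) :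
    ∃ B : Finset ℕ, B.card ≤ (t * Fintype.card ι) ^ 2 * Y ∧
      ∀ s ∈ P, ∀ x < m, x ∈ union L s → y x ∈ union L s → x ∈ B := by
  classical
  let T : (Fin t × ι) × (Fin t × ι) → Finset ℕ := fun a => (Finset.range m).filter fun x =>
    ∃ s ∈ P, G a.1.1 a.1.2 (s a.1.1) x ∧ G a.2.1 a.2.2 (s a.2.1) (y x)
  refine ⟨Finset.univ.biUnion T, ?_, ?_⟩
  · refine (Finset.card_biUnion_le_card_mul _ _ Y fun a _ => ?_).trans ?_
    · refine hy _ (Finset.filter_subset _ _) ?_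
      have key : ∀ x ∈ T a, ∀ x' ∈ T a, x ≤ x' →
          DirLE ((dir a.1.1 == g a.1.1 a.1.2) == (dir a.2.1 == g a.2.1 a.2.2)) (y x) (y x') := by
        intro x hx x' hx' hxx
        obtain ⟨-, s, hs, h1, h2⟩ := Finset.mem_filter.1 hx
        obtain ⟨-, s', hs', h1', h2'⟩ := Finset.mem_filter.1 hx'
        rcases hP s hs s' hs' with h | h
        · have e1 := (hc.mono _ _).dirLE h1 h1' (h a.1.1)
          have e2 := (hc.mono _ _).dirLE h2 h2' (h a.2.1)
          generalize (dir a.1.1 == g a.1.1 a.1.2) = b1 at *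
          generalize (dir a.2.1 == g a.2.1 a.2.2) = b2 at *
          cases b1
          -- If the strings `x` are seen in decreasing order, `x ≤ x'` leaves only equality.
          · obtain rfl : x = x' := le_antisymm hxx e1
            exact DirLE.refl _ _
          · simpa using e2
        · have e1 := (hc.mono _ _).dirLE h1' h1 (h a.1.1)
          have e2 := (hc.mono _ _).dirLE h2' h2 (h a.2.1)
          generalize (dir a.1.1 == g a.1.1 a.1.2) = b1 at *
          generalize (dir a.2.1 == g a.2.1 a.2.2) = b2 at *
          cases b1
          · cases b2 <;> simpa [DirLE] using e2
          · obtain rfl : x = x' := le_antisymm hxx e1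
            exact DirLE.refl _ _
      generalize ((dir a.1.1 == g a.1.1 a.1.2) == (dir a.2.1 == g a.2.1 a.2.2)) = e at key
      cases e
      · exact Or.inr fun x hx x' hx' h => key x hx x' hx' h
      · exact Or.inl fun x hx x' hx' h => key x hx x' hx' h
    · simp only [Finset.card_univ, Fintype.card_prod, Fintype.card_fin]
      rw [sq]
  · intro s hs x hx h1 h2
    simp only [union, Finset.mem_biUnion, Finset.mem_univ, true_and] at h1 h2 ⊢
    obtain ⟨i, hi⟩ := h1
    obtain ⟨j, hj⟩ := h2
    obtain ⟨k, hk⟩ := hc.covers i _ _ hi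
    obtain ⟨l, hl⟩ := hc.covers j _ _ hj
    exact ⟨((i, k), (j, l)), Finset.mem_filter.2 ⟨Finset.mem_range.2 hx, s, hs, hk, hl⟩⟩

/-- `vis i p` tells at which head positions the last block of the phase began that visited the
cell `p` of tape `i`. -/
structure Visits (dir : Fin t → Bool) (lab cur : Fin t → ℕ → Finset ℕ) (P : Set (Fin t → ℕ))
    (vis : Fin t → ℕ → Option (Fin t → ℕ)) : Prop where
  chain : ∀ s ∈ P, ∀ s' ∈ P, (∀ i, DirLE (dir i) (s i) (s' i)) ∨ ∀ i, DirLE (dir i) (s' i) (s i)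
  none : ∀ i p, vis i p = none → cur i p = lab i p
  some : ∀ i p s, vis i p = some s → s ∈ P ∧ cur i p = union lab s
  mono : ∀ i p p' s s', vis i p = Option.some s → vis i p' = Option.some s' →
    DirLE (dir i) p p' → ∀ j, DirLE (dir j) (s j) (s' j)

/-- The number of relevant pairs of input strings in one phase. -/
def pairBound (t Y h : ℕ) : ℕ := (t * (t + 1) ^ h) ^ 2 * Y

theorem pairBound_mono (t Y : ℕ) : Monotone (pairBound t Y) := fun h h' hh =>
  Nat.mul_le_mul_right _ (Nat.pow_le_pow_left
    (Nat.mul_le_mul_left _ (Nat.pow_le_pow_right (by omega) hh)) _)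

/-- The invariant for counting the `x < m` such that `x` and `y x` are involved in one block; `Ds`
are the sets of input strings involved in the blocks so far. -/
def MergeInv (m Y : ℕ) (y : ℕ → ℕ) (b : Book t) (Ds : Set (Finset ℕ)) : Prop :=
  ∃ (ι : Type) (_ : Fintype ι) (G : Fin t → ι → ℕ → ℕ → Prop) (g : Fin t → ι → Bool)
    (P : Set (Fin t → ℕ)) (vis : Fin t → ℕ → Option (Fin t → ℕ)) (B : Finset ℕ),
    Fintype.card ι ≤ (t + 1) ^ b.phase ∧ Cover b.lab G g ∧ Visits b.dir b.lab b.cur P vis ∧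
    b.start ∈ P ∧ (∀ s ∈ P, ∀ i, DirLE (b.dir i) (s i) (b.start i)) ∧
    (∀ i p s, vis i p = some s → DirLE (b.dir i) p (b.start i)) ∧
    B.card ≤ b.phase * pairBound t Y b.phase ∧
    ∀ D ∈ Ds, (∀ x < m, x ∈ D → y x ∈ D → x ∈ B) ∨ ∃ s ∈ P, D = union b.lab s

/-- The completed block is the latest of the phase, and cells visited earlier lie at or behind its
start. So replacing the record on the swept interval keeps the last visiting block monotone in the
cell. -/
theorem Visits.relabel {b : Book t} {en : Fin t → ℕ} {P : Set (Fin t → ℕ)}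
    {vis : Fin t → ℕ → Option (Fin t → ℕ)} (hv : Visits b.dir b.lab b.cur P vis)
    (hle : ∀ i, DirLE (b.dir i) (b.start i) (en i)) (hst : b.start ∈ P)
    (hP : ∀ s ∈ P, ∀ i, DirLE (b.dir i) (s i) (b.start i))
    (hvis : ∀ i p s, vis i p = Option.some s → DirLE (b.dir i) p (b.start i)) :
    Visits b.dir b.lab (b.relabel en) P fun i p =>
      if p ∈ Finset.uIcc (b.start i) (en i) then Option.some b.start else vis i p where
  chain := hv.chain
  none i p h := by
    split_ifs at h with hp
    rw [Book.relabel, if_neg hp]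
    exact hv.none i p h
  some i p s h := by
    split_ifs at h with hp
    · cases h
      rw [Book.relabel, if_pos hp]
      exact ⟨hst, rfl⟩
    · rw [Book.relabel, if_neg hp]
      exact hv.some i p s h
  mono i p p' s s' h h' hpp j := by
    split_ifs at h h' with hp hp' hp'
    · cases h; cases h'
      exact DirLE.refl _ _
    -- A cell with an older record cannot lie strictly beyond the start; so it is the start itself,
    -- which has just been overwritten.
    · refine absurd ?_ hp'
      have h1 := hvis i p' s' h'
      have h2 := ((mem_uIcc_iff (hle i)).1 hp).1
      have h3 : p' = b.start i := DirLE.antisymm h1 (h2.trans hpp)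
      rw [h3]
      exact Finset.left_mem_uIcc
    · cases h'
      exact hP s (hv.some i p s h).1 j
    · exact hv.mono i p p' s s' h h' hpp j

/-- `B` collects the `x` from the finished phases; the chain `P` contributes those of the current
one. -/
theorem MergeInv.exists_card_le {m Y : ℕ} {y : ℕ → ℕ} {b : Book t} {Ds : Set (Finset ℕ)}
    (hy : ∀ T ⊆ Finset.range m, MonotoneOn y (T : Set ℕ) ∨ AntitoneOn y (T : Set ℕ) → T.card ≤ Y)
    (h : MergeInv m Y y b Ds) :
    ∃ B : Finset ℕ, B.card ≤ (b.phase + 1) * pairBound t Y b.phase ∧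
      ∀ D ∈ Ds, ∀ x < m, x ∈ D → y x ∈ D → x ∈ B := by
  obtain ⟨ι, _, G, g, P, vis, B, h1, h2, h3, h4, h5, h6, h7, h8⟩ := h
  obtain ⟨B', h9, h10⟩ := h2.exists_card_le h3.chain hy
  classical
  refine ⟨B ∪ B', ?_, ?_⟩
  · refine (Finset.card_union_le _ _).trans ?_
    rw [Nat.add_mul, one_mul]
    refine Nat.add_le_add h7 (h9.trans ?_)
    exact Nat.mul_le_mul_right _ (Nat.pow_le_pow_left (Nat.mul_le_mul_left _ h1) _)
  · intro D hD x hx hxD hyD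
    rcases h8 D hD with h | ⟨s, hs, rfl⟩
    · exact Finset.mem_union_left _ (h x hx hxD hyD)
    · exact Finset.mem_union_right _ (h10 s hs x hx hxD hyD)

/-- Without a turn the cover stays and the chain is extended by `q`. At a turn the chain of the old
phase is evaluated, and a new cover has to be built for the new labels. -/
theorem MergeInv.adv {m Y : ℕ} {y : ℕ → ℕ} {b : Book t} {Ds : Set (Finset ℕ)} {en q : Fin t → ℕ}
    (hy : ∀ T ⊆ Finset.range m, MonotoneOn y (T : Set ℕ) ∨ AntitoneOn y (T : Set ℕ) → T.card ≤ Y)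
    (h : MergeInv m Y y b Ds) (hl : b.Legit en q) :
    MergeInv m Y y (b.adv en q) (insert (b.adv en q).deps Ds) := by
  have hbad := h.exists_card_le hy
  obtain ⟨ι, _, G, g, P, vis, B, h1, h2, h3, h4, h5, h6, h7, h8⟩ := h
  have hv := h3.relabel hl.le h4 h5 h6
  by_cases ht : b.Turned en q
  · obtain ⟨B', h9, h10⟩ := hbad
    have hlab : (b.adv en q).lab = b.relabel en := by simp [Book.adv, ht]
    have hph : (b.adv en q).phase = b.phase + 1 := by simp [Book.adv, ht]
    have hcur : (b.adv en q).cur = b.relabel en := rfl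
    have hst : (b.adv en q).start = q := rfl
    set vis' : Fin t → ℕ → Option (Fin t → ℕ) := fun i p =>
      if p ∈ Finset.uIcc (b.start i) (en i) then some b.start else vis i p
    -- An unvisited cell keeps its label and its old relations. A visited cell carries the union of
    -- the old labels at the start `s` of its last block; as `s j` is monotone in the cell,
    -- composing with the relations of each tape `j` gives monotone relations again. Hence the
    -- factor `t + 1` per phase.
    refine ⟨ι ⊕ (Fin t × ι), inferInstance,
      fun i => Sum.elim (fun k p x => vis' i p = none ∧ G i k p x)
        (fun k p x => ∃ s, (vis' i p).map (fun s => s k.1) = some s ∧ G k.1 k.2 s x),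
      fun i => Sum.elim (g i) fun k => b.dir i == (b.dir k.1 == g k.1 k.2),
      {q}, fun _ _ => none, B', ?_, ⟨?_, ?_⟩, ⟨?_, ?_, ?_, ?_⟩, rfl, ?_, ?_, ?_, ?_⟩
    · rw [hph]
      simp only [Fintype.card_sum, Fintype.card_prod, Fintype.card_fin]
      calc _ = (t + 1) * Fintype.card ι := by ring
        _ ≤ (t + 1) * (t + 1) ^ b.phase := Nat.mul_le_mul_left _ h1
        _ = _ := by ring
    · rintro i (k | ⟨j, k⟩)
      · rintro p p' x x' ⟨-, hx⟩ ⟨-, hx'⟩ hp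
        exact h2.mono i k p p' x x' hx hx' hp
      · refine (h2.mono j k).comp fun p p' s s' hs hs' hp => ?_
        simp only [Option.map_eq_some_iff] at hs hs'
        obtain ⟨a, ha, rfl⟩ := hs
        obtain ⟨a', ha', rfl⟩ := hs'
        exact hv.mono i p p' a a' ha ha' hp j
    · intro i p x hx
      rw [hlab] at hx
      cases hvp : vis' i p with
      | none =>
        rw [hv.none i p hvp] at hx
        obtain ⟨k, hk⟩ := h2.covers i p x hx
        exact ⟨Sum.inl k, hvp, hk⟩
      | some s =>
        rw [(hv.some i p s hvp).2] at hx
        simp only [union, Finset.mem_biUnion, Finset.mem_univ, true_and] at hx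
        obtain ⟨j, hj⟩ := hx
        obtain ⟨k, hk⟩ := h2.covers j _ x hj
        exact ⟨Sum.inr (j, k), s j, by simp [hvp], hk⟩
    · rintro s rfl s' rfl
      exact Or.inl fun i => DirLE.refl _ _
    · intro i p _
      rw [hlab, hcur]
    · intro i p s h; cases h
    · intro i p p' s s' h; cases h
    · rintro s rfl i
      exact DirLE.refl _ _
    · intro i p s h; cases h
    · rw [hph]
      exact h9.trans (Nat.mul_le_mul_left _ (pairBound_mono t Y (Nat.le_succ _)))
    · intro D hD
      rcases hD with rfl | hD
      · exact Or.inr ⟨q, rfl, rfl⟩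
      · exact Or.inl (h10 D hD)
  · have hlab : (b.adv en q).lab = b.lab := by simp [Book.adv, ht]
    have hph : (b.adv en q).phase = b.phase := by simp [Book.adv, ht]
    have hdir : (b.adv en q).dir = b.dir := funext fun i => dir_adv_of_not_turned ht i
    have hcur : (b.adv en q).cur = b.relabel en := rfl
    have hst : (b.adv en q).start = q := rfl
    have hq : ∀ i, DirLE (b.dir i) (b.start i) (q i) := fun i =>
      (hl.le i).trans (dirLE_of_not_turned ht i)
    refine ⟨ι, inferInstance, G, g, insert q P, fun i p =>
      if p ∈ Finset.uIcc (b.start i) (en i) then some b.start else vis i p, B, hph ▸ h1, hlab ▸ h2, ?_,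
      Set.mem_insert _ _, ?_, ?_, hph ▸ h7, ?_⟩
    · rw [hdir, hlab, hcur]
      refine ⟨?_, hv.none, fun i p s h => ?_, hv.mono⟩
      · rintro s (rfl | hs) s' (rfl | hs')
        · exact Or.inl fun i => DirLE.refl _ _
        · exact Or.inr fun i => (h5 s' hs' i).trans (hq i)
        · exact Or.inl fun i => (h5 s hs i).trans (hq i)
        · exact h3.chain s hs s' hs'
      · exact ⟨Set.mem_insert_of_mem _ (hv.some i p s h).1, (hv.some i p s h).2⟩
    · rw [hdir, hst]
      rintro s (rfl | hs) i
      · exact DirLE.refl _ _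
      · exact (h5 s hs i).trans (hq i)
    · rw [hdir, hst]
      intro i p s h
      dsimp only at h
      split_ifs at h with hp
      · exact ((mem_uIcc_iff (hl.le i)).1 hp).2.trans (dirLE_of_not_turned ht i)
      · exact (h6 i p s h).trans (hq i)
    · rw [hlab]
      intro D hD
      rcases hD with rfl | hD
      · exact Or.inr ⟨q, Set.mem_insert _ _, by rw [deps, hlab, hst]⟩
      · exact (h8 D hD).imp_right fun ⟨s, hs, h⟩ => ⟨s, Set.mem_insert_of_mem _ hs, h⟩

/-! ### Sequences of blocks -/

/-- The initial bookkeeping for an input that consists of `c` strings with `l` letters each. -/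
def initial (t l c : ℕ) : Book t where
  dir := fun _ => true
  lab := fun _ p => {min (p / l) c}
  cur := fun _ p => {min (p / l) c}
  start := fun _ => 0
  phase := 0

/-- The bookkeeping after the blocks that are described by a list (with the most recent block
first) of the head positions before and after their last steps. -/
noncomputable def ofLog (b : Book t) : List ((Fin t → ℕ) × (Fin t → ℕ)) → Book t
  | [] => b
  | e :: l => (b.ofLog l).adv e.1 e.2

/-- The list describes a possible sequence of blocks. -/
def LegitLog (b : Book t) : List ((Fin t → ℕ) × (Fin t → ℕ)) → Prop
  | [] => True
  | e :: l => (b.ofLog l).Legit e.1 e.2 ∧ b.LegitLog l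

/-- Labels change only behind the last cell of a string; all cells behind the input share the label
`c`. Treating every tape like the input tape gives `t * c` borders. -/
theorem borderInv_initial (t l c : ℕ) : BorderInv (t * c) (initial t l c) 0 := by
  have hS : Borders ((Finset.univ : Finset (Fin t)) ×ˢ
      (Finset.range c).image fun j => (j + 1) * l - 1) fun _ p => {min (p / l) c} := by
    intro i p hp
    simp only [Finset.singleton_inj]
    by_contra hne
    apply hp
    simp only [Finset.mem_product, Finset.mem_univ, Finset.mem_image, Finset.mem_range, true_and]
    have h1 : (p + 1) / l = p / l + if l ∣ p + 1 then 1 else 0 := Nat.succ_div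
    split_ifs at h1 with h2
    · refine ⟨p / l, ?_, ?_⟩
      · rw [h1] at hne; omega
      · rw [← h1, Nat.div_mul_cancel h2]; rfl
    · rw [h1] at hne; exact absurd rfl hne
  have hcard : ((Finset.univ : Finset (Fin t)) ×ˢ
      (Finset.range c).image fun j => (j + 1) * l - 1).card ≤ t * c := by
    rw [Finset.card_product, Finset.card_univ, Fintype.card_fin]
    exact Nat.mul_le_mul_left _ (Finset.card_image_le.trans (Finset.card_range c).le)
  have h2 : ((initial t l c).ahead (Finset.univ ×ˢ
      (Finset.range c).image fun j => (j + 1) * l - 1)).card ≤ t * c :=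
    (Finset.card_filter_le _ _).trans hcard
  refine ⟨_, _, hS, hS, hcard, ?_, ?_⟩
  · have h3 := Nat.mul_le_mul_left (2 * t) h2
    rw [show borderBound t (t * c) (initial t l c).phase = t * c from rfl, Nat.add_mul, one_mul]
    omega
  · rw [zero_add]
    exact h2

/-- Initially a single increasing relation per tape covers the labels, namely the cell's string
number. -/
theorem mergeInv_initial (t l c m Y : ℕ) (y : ℕ → ℕ) :
    MergeInv m Y y (initial t l c) {(initial t l c).deps} := by
  refine ⟨Unit, inferInstance, fun _ _ p x => x = min (p / l) c, fun _ _ => true,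
    {fun _ => 0}, fun _ _ => none, ∅, by simp [initial], ⟨?_, ?_⟩, ⟨?_, ?_, ?_, ?_⟩, rfl, ?_, ?_, by simp, ?_⟩
  · rintro i k p p' x x' rfl rfl h
    have := Nat.div_le_div_right (c := l) h
    simp only [DirLE, if_true]
    omega
  · intro i p x hx
    exact ⟨(), Finset.mem_singleton.1 hx⟩
  · rintro s rfl s' rfl
    exact Or.inl fun i => DirLE.refl _ _
  · intro i p _; rfl
  · intro i p s h; cases h
  · intro i p p' s s' h; cases h
  · rintro s rfl i
    exact DirLE.refl _ _
  · intro i p s h; cases h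
  · rintro D rfl
    exact Or.inr ⟨_, rfl, rfl⟩

theorem borderInv_ofLog {β : ℕ} {b : Book t} (hb : BorderInv β b 0) :
    ∀ {l : List ((Fin t → ℕ) × (Fin t → ℕ))}, b.LegitLog l → BorderInv β (b.ofLog l) l.length
  | [], _ => hb
  | _ :: _, h => (borderInv_ofLog hb h.2).adv h.1

theorem mergeInv_ofLog {m Y : ℕ} {y : ℕ → ℕ} {b : Book t}
    (hy : ∀ T ⊆ Finset.range m, MonotoneOn y (T : Set ℕ) ∨ AntitoneOn y (T : Set ℕ) → T.card ≤ Y)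
    (hb : MergeInv m Y y b {b.deps}) :
    ∀ {l : List ((Fin t → ℕ) × (Fin t → ℕ))}, b.LegitLog l →
      MergeInv m Y y (b.ofLog l) {D | ∃ l', l' <:+ l ∧ D = (b.ofLog l').deps}
  | [], _ => by simpa [ofLog] using hb
  | e :: l, h => by
    have h1 := (mergeInv_ofLog hy hb h.2).adv hy h.1
    have h2 : {D | ∃ l', l' <:+ e :: l ∧ D = (b.ofLog l').deps} =
        insert ((b.ofLog l).adv e.1 e.2).deps {D | ∃ l', l' <:+ l ∧ D = (b.ofLog l').deps} := by
      ext D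
      simp only [List.suffix_cons_iff, Set.mem_ofPred_eq, Set.mem_insert_iff]
      constructor
      · rintro ⟨l', rfl | h, rfl⟩
        · exact Or.inl rfl
        · exact Or.inr ⟨l', h, rfl⟩
      · rintro (rfl | ⟨l', h, rfl⟩)
        · exact ⟨_, Or.inl rfl, rfl⟩
        · exact ⟨l', Or.inr h, rfl⟩
    rw [h2]
    exact h1

theorem length_le_of_legitLog {l c : ℕ} {log : List ((Fin t → ℕ) × (Fin t → ℕ))}
    (h : (initial t l c).LegitLog log) {h' : ℕ} (hh : ((initial t l c).ofLog log).phase = h') :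
    log.length + 1 ≤ (h' + 1) * ((2 * t + 1) ^ h' * (t * c + 1)) := by
  obtain ⟨S, S', -, -, -, -, h5⟩ := borderInv_ofLog (borderInv_initial t l c) h
  rw [hh] at h5
  have := blockBound_add_one_le t (t * c) h'
  omega

theorem exists_card_le_of_legitLog {l c m Y : ℕ} {y : ℕ → ℕ}
    (hy : ∀ T ⊆ Finset.range m, MonotoneOn y (T : Set ℕ) ∨ AntitoneOn y (T : Set ℕ) → T.card ≤ Y)
    {log : List ((Fin t → ℕ) × (Fin t → ℕ))} (h : (initial t l c).LegitLog log) :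
    ∃ B : Finset ℕ, B.card ≤ (((initial t l c).ofLog log).phase + 1) *
        pairBound t Y ((initial t l c).ofLog log).phase ∧
      ∀ log', log' <:+ log → ∀ x < m, x ∈ ((initial t l c).ofLog log').deps →
        y x ∈ ((initial t l c).ofLog log').deps → x ∈ B := by
  obtain ⟨B, h1, h2⟩ :=
    (mergeInv_ofLog hy (mergeInv_initial t l c m Y y) h).exists_card_le hy
  exact ⟨B, h1, fun log' hl => h2 _ ⟨log', hl, rfl⟩⟩

end Book

end ExtMem

/-! ### Transitions as uniform random choices, and runs that keep a log of their blocks -/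

namespace ExtMem

namespace NTM

variable {t u : ℕ} (M : NTM t u)

/-- The type of transitions. -/
abbrev Trans : Type :=
  M.State × (Tape t u → M.Sym) × M.State × (Tape t u → M.Sym) × (Tape t u → SignType)

instance : Finite M.Trans := by
  have := M.finite_state
  have := M.finite_sym
  infer_instance

instance : Nonempty M.Trans :=
  ⟨(M.start, fun _ => M.blank, M.start, fun _ => M.blank, fun _ => 0)⟩

variable {M}

/-- The transitions that are applicable in a configuration. -/
def app (γ : M.Config) : Set M.Trans :=
  {τ ∈ M.trans | τ.1 = γ.state ∧ (∀ i, τ.2.1 i = γ.tape i (γ.pos i)) ∧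
    ∀ i, 0 ≤ (γ.pos i : ℤ) + (τ.2.2.2.2 i : ℤ)}

/-- The result of a transition. -/
def move (τ : M.Trans) (γ : M.Config) : M.Config where
  state := τ.2.2.1
  pos := fun i => ((γ.pos i : ℤ) + (τ.2.2.2.2 i : ℤ)).toNat
  tape := fun i => Function.update (γ.tape i) (γ.pos i) (τ.2.2.2.1 i)

theorem next_eq (γ : M.Config) : M.next γ = (fun τ => move τ γ) '' app γ := by
  ext γ'
  constructor
  · rintro ⟨τ, hτ, h1, h2, h3, h4, h5⟩
    refine ⟨τ, ⟨hτ, h1, h2, fun i => ?_⟩, ?_⟩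
    · rw [← h5 i]; exact Int.natCast_nonneg _
    · obtain ⟨st, ps, tp⟩ := γ'
      obtain rfl : st = τ.2.2.1 := h3
      obtain rfl : tp = _ := funext h4
      have : ps = fun i => ((γ.pos i : ℤ) + (τ.2.2.2.2 i : ℤ)).toNat := by
        funext i
        rw [← h5 i]
        rfl
      subst this
      rfl
  · rintro ⟨τ, ⟨hτ, h1, h2, h3⟩, rfl⟩
    exact ⟨τ, hτ, h1, h2, rfl, fun i => rfl, fun i => Int.toNat_of_nonneg (h3 i)⟩

/-- State and symbols read are determined by `γ`, symbols written and movements by the result. So a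
uniform choice among successors is a uniform choice among applicable transitions. -/
theorem move_injOn (γ : M.Config) : Set.InjOn (fun τ => move τ γ) (app γ) := by
  rintro ⟨q, a, q', b, d⟩ h ⟨q₂, a₂, q₂', b₂, d₂⟩ h₂ heq
  simp only [move, Config.mk.injEq] at heq
  obtain ⟨e1, e2, e3⟩ := heq
  obtain ⟨-, f1, f2, f3⟩ := h
  obtain ⟨-, g1, g2, g3⟩ := h₂
  dsimp only at *
  have h1 : q = q₂ := f1.trans g1.symm
  have h2 : a = a₂ := funext fun i => (f2 i).trans (g2 i).symm
  have h3 : b = b₂ := funext fun i => by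
    have := congrFun (congrFun e3 i) (γ.pos i)
    simpa using this
  have h4 : d = d₂ := funext fun i => by
    have h5 := congrFun e2 i
    have h6 := f3 i
    have h7 := g3 i
    have h8 : (d i : ℤ) = d₂ i := by omega
    revert h8
    generalize d i = x
    generalize d₂ i = y
    cases x <;> cases y <;> simp
  rw [h1, h2, h3, h4, e1]

theorem ncard_next (γ : M.Config) : (M.next γ).ncard = (app γ).ncard := by
  rw [next_eq, (move_injOn γ).ncard_image]

theorem finite_app (γ : M.Config) : (app γ).Finite := Set.toFinite _

theorem finite_next (γ : M.Config) : (M.next γ).Finite := by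
  rw [next_eq]
  exact (finite_app γ).image _

theorem next_eq_empty_iff (γ : M.Config) : M.next γ = ∅ ↔ app γ = ∅ := by
  rw [next_eq, Set.image_eq_empty]

theorem pos_le_of_mem_next {γ γ' : M.Config} (h : γ' ∈ M.next γ) (i : Tape t u) :
    γ'.pos i ≤ γ.pos i + 1 ∧ γ.pos i ≤ γ'.pos i + 1 := by
  obtain ⟨τ, -, -, -, -, -, h5⟩ := h
  have := h5 i
  have h6 : (τ.2.2.2.2 i : ℤ) ≤ 1 ∧ -1 ≤ (τ.2.2.2.2 i : ℤ) := by
    generalize τ.2.2.2.2 i = x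
    cases x <;> simp
  omega

theorem tape_eq_of_mem_next {γ γ' : M.Config} (h : γ' ∈ M.next γ) (i : Tape t u) {p : ℕ}
    (hp : p ≠ γ.pos i) : γ'.tape i p = γ.tape i p := by
  obtain ⟨τ, -, -, -, -, h4, -⟩ := h
  rw [h4 i, Function.update_of_ne hp]

variable (M)

/-- The number of values of a random choice. It is a multiple of every possible number of
successors of a configuration. -/
noncomputable def choices : ℕ := (Nat.card M.Trans).factorial

theorem choices_pos : 0 < M.choices := Nat.factorial_pos _

instance : NeZero M.choices := ⟨M.choices_pos.ne'⟩

variable {M}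

/-- The size of `A` divides the factorial `choices`, so `Fin M.choices` can be mapped onto `A` with
fibres of equal size. One range of random values therefore serves all configurations. -/
theorem exists_pick {A : Set M.Trans} (hA : A.Nonempty) :
    ∃ f : Fin M.choices → M.Trans, (∀ c, f c ∈ A) ∧
      ∀ g : M.Trans → ℝ≥0∞, (A.ncard : ℝ≥0∞) * ∑ c, g (f c) = M.choices * ∑ᶠ τ ∈ A, g τ := by
  classical
  have hpos : 0 < A.ncard := (Set.ncard_pos (Set.toFinite A)).2 hA
  have hdvd : A.ncard ∣ M.choices := by
    refine Nat.dvd_factorial hpos ?_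
    rw [← Set.ncard_univ]
    exact Set.ncard_le_ncard (Set.subset_univ _) (Set.toFinite _)
  obtain ⟨d, hd⟩ := hdvd
  have : Fintype A := Fintype.ofFinite A
  have hc : Fintype.card (Fin M.choices) = Fintype.card (A × Fin d) := by
    rw [Fintype.card_prod, Fintype.card_fin, Fintype.card_fin, hd, ← Nat.card_eq_fintype_card,
      Nat.card_coe_set_eq]
  let e := Fintype.equivOfCardEq hc
  refine ⟨fun c => (e c).1, fun c => (e c).1.2, fun g => ?_⟩
  have h1 : ∑ c, g ((e c).1 : M.Trans) = ∑ x : A × Fin d, g (x.1 : M.Trans) :=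
    Equiv.sum_comp e fun x => g (x.1 : M.Trans)
  have h2 : ∑ᶠ τ ∈ A, g τ = ∑ a : A, g a := by
    rw [← finsum_set_coe_eq_finsum_mem, finsum_eq_sum_of_fintype]
  rw [h1, h2, Fintype.sum_prod_type, hd]
  simp only [Finset.sum_const, Finset.card_univ, Fintype.card_fin, nsmul_eq_mul]
  rw [← Finset.mul_sum]
  push_cast
  ring

open scoped Classical in
/-- A uniform selection of an element of a nonempty set of transitions. -/
noncomputable def pick (A : Set M.Trans) : Fin M.choices → M.Trans :=
  if h : A.Nonempty then (exists_pick h).choose else fun _ => Classical.arbitrary _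

theorem pick_mem {A : Set M.Trans} (hA : A.Nonempty) (c : Fin M.choices) : pick A c ∈ A := by
  rw [pick, dif_pos hA]
  exact (exists_pick hA).choose_spec.1 c

theorem sum_pick {A : Set M.Trans} (hA : A.Nonempty) (g : M.Trans → ℝ≥0∞) :
    (A.ncard : ℝ≥0∞) * ∑ c, g (pick A c) = M.choices * ∑ᶠ τ ∈ A, g τ := by
  rw [pick, dif_pos hA]
  exact (exists_pick hA).choose_spec.2 g

/-- The positions of the heads on the external tapes. -/
def extPos (γ : M.Config) (i : Fin t) : ℕ := γ.pos (Sum.inl i)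

variable (M) in
/-- What is recorded when a block of steps ends. -/
structure Snap where
  /-- the positions of the external heads before the last step -/
  en : Fin t → ℕ
  /-- the state -/
  state : M.State
  /-- the head positions -/
  pos : Tape t u → ℕ
  /-- the contents of the internal tapes -/
  mem : Fin u → ℕ → M.Sym
  /-- the symbols read on the external tapes -/
  sym : Fin t → M.Sym

/-- The record for a block that ends with a step to `γ`, with the external heads coming from
`en`. -/
def snap (en : Fin t → ℕ) (γ : M.Config) : M.Snap where
  en := en
  state := γ.state
  pos := γ.pos
  mem := fun j => γ.tape (Sum.inr j)
  sym := fun i => γ.tape (Sum.inl i) (γ.pos (Sum.inl i))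

/-- The head positions recorded in a log. -/
def moves (log : List M.Snap) : List ((Fin t → ℕ) × (Fin t → ℕ)) :=
  log.map fun e => (e.en, fun i => e.pos (Sum.inl i))

variable (M) in
/-- A configuration together with the records about the completed blocks (the most recent one
first) and the number of steps in the current block. -/
structure Aug where
  /-- the configuration -/
  conf : M.Config
  /-- the number of steps in the current block -/
  clock : ℕ
  /-- the records about the completed blocks -/
  log : List M.Snap

namespace Aug

variable (b : Book t)

/-- The current bookkeeping. -/
noncomputable def book (S : M.Aug) : Book t := b.ofLog (moves S.log)

open scoped Classical in
/-- The step to the configuration `γ`. -/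
noncomputable def step (S : M.Aug) (γ : M.Config) : M.Aug :=
  if (S.book b).Event (extPos S.conf) (extPos γ) then
    ⟨γ, 0, snap (extPos S.conf) γ :: S.log⟩
  else ⟨γ, S.clock + 1, S.log⟩

/-- `S'` is a possible successor of `S`. -/
def Step (S S' : M.Aug) : Prop := ∃ γ ∈ M.next S.conf, S' = S.step b γ

/-- `S'` is the successor of `S` if the random choices are given by `f`, depending on the number
of the block and the number of the step in the block. -/
def DStep (f : ℕ → ℕ → Fin M.choices) (S S' : M.Aug) : Prop :=
  (app S.conf).Nonempty ∧
    S' = S.step b (move (pick (app S.conf) (f S.log.length S.clock)) S.conf)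

variable {b}

theorem DStep.step {f : ℕ → ℕ → Fin M.choices} {S S' : M.Aug} (h : S.DStep b f S') :
    S.Step b S' := by
  refine ⟨_, ?_, h.2⟩
  rw [next_eq]
  exact Set.mem_image_of_mem _ (pick_mem h.1 _)

theorem DStep.unique {f : ℕ → ℕ → Fin M.choices} {S S₁ S₂ : M.Aug} (h₁ : S.DStep b f S₁)
    (h₂ : S.DStep b f S₂) : S₁ = S₂ := h₁.2.trans h₂.2.symm

theorem step_of_event {S : M.Aug} {γ : M.Config}
    (h : (S.book b).Event (extPos S.conf) (extPos γ)) :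
    S.step b γ = ⟨γ, 0, snap (extPos S.conf) γ :: S.log⟩ := if_pos h

theorem step_of_not_event {S : M.Aug} {γ : M.Config}
    (h : ¬ (S.book b).Event (extPos S.conf) (extPos γ)) :
    S.step b γ = ⟨γ, S.clock + 1, S.log⟩ := if_neg h

@[simp]
theorem conf_step (S : M.Aug) (γ : M.Config) : (S.step b γ).conf = γ := by
  unfold step
  split_ifs <;> rfl

theorem book_mk_cons (γ γ' : M.Config) (c : ℕ) (en : Fin t → ℕ) (l : List M.Snap) :
    book b ⟨γ, c, snap en γ' :: l⟩ = (b.ofLog (moves l)).adv en (extPos γ') := rfl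

/-- The invariant of augmented configurations. -/
structure WF (b : Book t) (S : M.Aug) : Prop where
  le : ∀ i, DirLE ((S.book b).dir i) ((S.book b).start i) (extPos S.conf i)
  lab : ∀ i, ∀ p ∈ Finset.uIcc ((S.book b).start i) (extPos S.conf i),
    (S.book b).lab i p = (S.book b).lab i ((S.book b).start i)
  ahead : ∀ i p, DirLE ((S.book b).dir i) ((S.book b).start i) p → p ≠ (S.book b).start i →
    (S.book b).cur i p = (S.book b).lab i p
  legit : b.LegitLog (moves S.log)
  start : S.clock = 0 → ∀ i, extPos S.conf i = (S.book b).start i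

/-- The point of `lab` and `ahead`: all cells swept in a block carry the same phase label as its
first cell, and cells strictly ahead have not been touched in this phase. So every cell entered anew
has a label contained in `deps`. -/
theorem WF.step {S S' : M.Aug} (h : WF b S) (hS : S.Step b S') : WF b S' := by
  obtain ⟨γ, hγ, rfl⟩ := hS
  have hpos : ∀ i, extPos γ i ≤ extPos S.conf i + 1 ∧ extPos S.conf i ≤ extPos γ i + 1 :=
    fun i => pos_le_of_mem_next hγ (Sum.inl i)
  by_cases he : (S.book b).Event (extPos S.conf) (extPos γ)
  · rw [step_of_event he]
    have hb : book b (⟨γ, 0, snap (extPos S.conf) γ :: S.log⟩ : M.Aug) =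
      (S.book b).adv (extPos S.conf) (extPos γ) := rfl
    have hst : ((S.book b).adv (extPos S.conf) (extPos γ)).start = extPos γ := rfl
    refine ⟨?_, ?_, ?_, ?_, ?_⟩
    · rw [hb, hst]
      exact fun i => DirLE.refl _ _
    · rw [hb, hst]
      intro i p hp
      rw [Finset.uIcc_self, Finset.mem_singleton] at hp
      rw [hp]
    · rw [hb, hst]
      intro i p hp hne
      -- A turn makes `lab` equal to `cur`. Otherwise a cell strictly beyond the new start lies
      -- outside the interval just relabelled.
      by_cases ht : (S.book b).Turned (extPos S.conf) (extPos γ)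
      · simp [Book.adv, ht]
      · have hd : ((S.book b).adv (extPos S.conf) (extPos γ)).dir i = (S.book b).dir i :=
          Book.dir_adv_of_not_turned ht i
        have hl : ((S.book b).adv (extPos S.conf) (extPos γ)).lab = (S.book b).lab := by
          simp [Book.adv, ht]
        rw [hd] at hp
        rw [hl]
        have h1 := h.le i
        have h2 := Book.dirLE_of_not_turned ht i
        have h3 : p ∉ Finset.uIcc ((S.book b).start i) (extPos S.conf i) := fun hmem =>
          hne ((((Book.mem_uIcc_iff h1).1 hmem).2.trans h2).antisymm hp)
        have h4 : ((S.book b).adv (extPos S.conf) (extPos γ)).cur i p = (S.book b).cur i p := by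
          change Book.relabel _ _ _ _ = _
          rw [Book.relabel, if_neg h3]
        rw [h4]
        refine h.ahead i p ((h1.trans h2).trans hp) fun heq => ?_
        rw [heq] at h3
        exact h3 Finset.left_mem_uIcc
    · exact ⟨⟨h.le, fun i => (hpos i).1, fun i => (hpos i).2, he⟩, h.legit⟩
    · intro _ i
      rfl
  · rw [step_of_not_event he]
    have hb : book b (⟨γ, S.clock + 1, S.log⟩ : M.Aug) = S.book b := rfl
    simp only [Book.Event, not_or, not_exists, not_not] at he
    have h2 := Book.dirLE_of_not_turned he.1
    refine ⟨?_, ?_, ?_, h.legit, ?_⟩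
    · rw [hb]
      exact fun i => (h.le i).trans (h2 i)
    · rw [hb]
      intro i p hp
      by_cases hp' : p ∈ Finset.uIcc ((S.book b).start i) (extPos S.conf i)
      · exact h.lab i p hp'
      -- The head moves by at most one cell, so only its new cell can be new to the interval; no
      -- event means that its label is that of the preceding cell.
      · have h3 : p = extPos γ i := by
          have h4 := (Book.mem_uIcc_iff ((h.le i).trans (h2 i))).1 hp
          rw [Book.mem_uIcc_iff (h.le i)] at hp'
          have h5 := hpos i
          have h6 := h2 i
          have h7 := h.le i
          cases hd : (S.book b).dir i <;>
            simp only [hd, DirLE, Bool.false_eq_true, if_false, if_true] at * <;> omega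
        rw [h3, he.2 i]
        exact h.lab i _ Finset.right_mem_uIcc
    · rw [hb]
      exact h.ahead
    · intro h; cases h

variable (M) in
/-- The initial augmented configuration. -/
def init (w : List Letter) : M.Aug := ⟨M.init w, 0, []⟩

theorem wf_init (w : List Letter) (l c : ℕ) : WF (Book.initial t l c) (init M w) where
  le _ := DirLE.refl _ _
  lab i p hp := by
    have : extPos (init M w).conf i = (book (Book.initial t l c) (init M w)).start i := rfl
    rw [this, Finset.uIcc_self, Finset.mem_singleton] at hp
    rw [hp]
  ahead _ _ _ _ := rfl
  legit := trivial
  start _ _ := rfl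

theorem WF.reflTransGen {S S' : M.Aug} (h : WF b S)
    (hS : Relation.ReflTransGen (Step b) S S') : WF b S' := by
  induction hS with
  | refl => exact h
  | tail _ h2 ih => exact ih.step h2

end Aug

end NTM

end ExtMem

/-! ### Combining two runs with the same log -/

namespace ExtMem

namespace NTM

namespace Aug

variable {t u : ℕ} {M : NTM t u} {b : Book t} {f : ℕ → ℕ → Fin M.choices}

theorem book_congr {S S' : M.Aug} (h : S'.log = S.log) : S'.book b = S.book b := by
  rw [book, h, book]

theorem Step.log {S S' : M.Aug} (h : S.Step b S') :
    (S'.log = S.log ∧ S'.clock = S.clock + 1) ∨ (∃ e, S'.log = e :: S.log) ∧ S'.clock = 0 := by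
  obtain ⟨γ, -, rfl⟩ := h
  by_cases he : (S.book b).Event (extPos S.conf) (extPos γ)
  · rw [step_of_event he]
    exact Or.inr ⟨⟨_, rfl⟩, rfl⟩
  · rw [step_of_not_event he]
    exact Or.inl ⟨rfl, rfl⟩

theorem reflTransGen_step {S S' : M.Aug} (h : Relation.ReflTransGen (DStep b f) S S') :
    Relation.ReflTransGen (Step b) S S' := by
  induction h with
  | refl => exact Relation.ReflTransGen.refl
  | tail _ h ih => exact ih.tail h.step

theorem log_suffix {S S' : M.Aug} (h : Relation.ReflTransGen (Step b) S S') :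
    S.log <:+ S'.log := by
  induction h with
  | refl => exact List.suffix_refl _
  | tail _ h ih =>
    rcases h.log with h | ⟨⟨e, h⟩, -⟩
    · rwa [h.1]
    · rw [h]
      exact ih.trans (List.suffix_cons _ _)

/-- `S` is earlier than the step with number `c` of block `k`. -/
def Before (S : M.Aug) (k c : ℕ) : Prop := S.log.length < k ∨ S.log.length = k ∧ S.clock < c

/-- Block number and clock increase lexicographically. Hence a run uses each random choice at most
once, and the two numbers identify a point of a deterministic run. -/
theorem before_of_transGen {S S' : M.Aug} (h : Relation.TransGen (Step b) S S') :
    S.Before S'.log.length S'.clock := by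
  have key : ∀ {S S' : M.Aug}, S.Step b S' → S.Before S'.log.length S'.clock := by
    intro S S' h
    rcases h.log with h | ⟨⟨e, h⟩, -⟩
    · exact Or.inr ⟨by rw [h.1], by omega⟩
    · exact Or.inl (by rw [h]; simp)
  induction h with
  | single h => exact key h
  | tail _ h ih =>
    have h2 := key h
    simp only [Before] at *
    omega

theorem eq_of_reflTransGen {S S' : M.Aug} (h : Relation.ReflTransGen (Step b) S S')
    (hl : S.log.length = S'.log.length) (hc : S.clock = S'.clock) : S = S' := by
  rcases Relation.reflTransGen_iff_eq_or_transGen.1 h with h | h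
  · exact h.symm
  · have := before_of_transGen h
    simp only [Before] at this
    omega

theorem unique_of_reflTransGen {S S₁ S₂ : M.Aug} (h₁ : Relation.ReflTransGen (DStep b f) S S₁)
    (h₂ : Relation.ReflTransGen (DStep b f) S S₂) (hl : S₁.log.length = S₂.log.length)
    (hc : S₁.clock = S₂.clock) : S₁ = S₂ := by
  have hu : Relator.RightUnique (DStep b f) := fun _ _ _ h h' => DStep.unique h h'
  rcases Relation.ReflTransGen.total_of_right_unique hu h₁ h₂ with h | h
  · exact eq_of_reflTransGen (reflTransGen_step h) hl hc
  · exact (eq_of_reflTransGen (reflTransGen_step h) hl.symm hc.symm).symm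

theorem exists_block {S F : M.Aug} (h : Relation.ReflTransGen (DStep b f) S F)
    (hl : S.log.length < F.log.length) :
    ∃ S', Relation.ReflTransGen (DStep b f) S S' ∧ Relation.ReflTransGen (DStep b f) S' F ∧
      (∃ e, S'.log = e :: S.log) ∧ S'.clock = 0 := by
  induction h using Relation.ReflTransGen.head_induction_on with
  | refl => omega
  | head h1 h2 ih =>
    rcases h1.step.log with h | h
    · obtain ⟨S', h3, h4, h5, h6⟩ := ih (by rw [h.1]; exact hl)
      exact ⟨S', Relation.ReflTransGen.head h1 h3, h4, h.1 ▸ h5, h6⟩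
    · exact ⟨_, Relation.ReflTransGen.single h1, h2, h.1, h.2⟩

/-- The run through `C` is in the same block as the run through `A`, in step with it, and the
cells that do not depend on the input string `x` have the same contents. -/
structure Lock (b : Book t) (x : ℕ) (A C : M.Aug) : Prop where
  book : C.book b = A.book b
  len : C.log.length = A.log.length
  clock : C.clock = A.clock
  state : C.conf.state = A.conf.state
  pos : C.conf.pos = A.conf.pos
  mem : ∀ j, C.conf.tape (Sum.inr j) = A.conf.tape (Sum.inr j)
  tape : ∀ i p, p ∈ Finset.uIcc ((A.book b).start i) (extPos A.conf i) ∨ x ∉ (A.book b).cur i p →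
    C.conf.tape (Sum.inl i) p = A.conf.tape (Sum.inl i) p

/-- The run through `C` has just completed the same block as the run through `A`, with the
external heads coming from `en`. -/
structure Post (b : Book t) (x : ℕ) (en : Fin t → ℕ) (A C : M.Aug) : Prop where
  book : C.book b = A.book b
  len : C.log.length = A.log.length
  clock : C.clock = A.clock
  logA : ∃ l, A.log = snap en A.conf :: l
  logC : ∃ l, C.log = snap en C.conf :: l
  state : C.conf.state = A.conf.state
  pos : C.conf.pos = A.conf.pos
  mem : ∀ j, C.conf.tape (Sum.inr j) = A.conf.tape (Sum.inr j)
  tape : ∀ i p, x ∉ (A.book b).cur i p → C.conf.tape (Sum.inl i) p = A.conf.tape (Sum.inl i) p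
  stay : ∀ i, extPos A.conf i = en i → C.conf.tape (Sum.inl i) (extPos A.conf i) =
    A.conf.tape (Sum.inl i) (extPos A.conf i)

theorem Lock.app_eq {x : ℕ} {A C : M.Aug} (h : Lock b x A C) : app C.conf = app A.conf := by
  have : ∀ i, C.conf.tape i (A.conf.pos i) = A.conf.tape i (A.conf.pos i) := by
    rintro (i | j)
    · exact h.tape i _ (Or.inl Finset.right_mem_uIcc)
    · rw [h.mem j]
  simp only [app, h.state, h.pos, this]

/-- Both runs have the same applicable transitions and the same block number and clock, so they
select the same transition. It remains to see that the heads only enter cells that do not depend on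
`x`. -/
theorem Lock.step {x : ℕ} {A A' C : M.Aug} (h : Lock b x A C) (hA : WF b A)
    (hx : x ∉ (A.book b).deps) (hs : A.DStep b f A') :
    ∃ C', C.DStep b f C' ∧ (A'.log = A.log ∧ Lock b x A' C' ∨
      A'.log.length = A.log.length + 1 ∧ A'.clock = 0 ∧ Post b x (extPos A.conf) A' C') := by
  have hA' := hA.step hs.step
  obtain ⟨h1, rfl⟩ := hs
  refine ⟨_, ⟨h.app_eq ▸ h1, rfl⟩, ?_⟩
  rw [h.app_eq, h.len, h.clock]
  set τ := pick (app A.conf) (f A.log.length A.clock) with hτ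
  have hpos : (move τ C.conf).pos = (move τ A.conf).pos := by simp only [move, h.pos]
  have hext : extPos (move τ C.conf) = extPos (move τ A.conf) := by
    funext i; exact congrFun hpos _
  have hextc : extPos C.conf = extPos A.conf := by funext i; exact congrFun h.pos _
  have hmem : ∀ j, (move τ C.conf).tape (Sum.inr j) = (move τ A.conf).tape (Sum.inr j) := by
    intro j; simp only [move, h.pos, h.mem]
  have htape : ∀ i p, p ∈ Finset.uIcc ((A.book b).start i) (extPos A.conf i) ∨
      x ∉ (A.book b).cur i p →
      (move τ C.conf).tape (Sum.inl i) p = (move τ A.conf).tape (Sum.inl i) p := by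
    intro i p hp
    have := h.tape i p hp
    simp only [move, h.pos, Function.update_apply, this]
  by_cases he : (A.book b).Event (extPos A.conf) (extPos (move τ A.conf))
  · have he' : (C.book b).Event (extPos C.conf) (extPos (move τ C.conf)) := by
      rwa [h.book, hextc, hext]
    rw [step_of_event he, step_of_event he']
    refine Or.inr ⟨rfl, rfl, ?_, ?_, rfl, ⟨_, rfl⟩, ⟨C.log, by rw [hextc]⟩, rfl, hpos, hmem, ?_, ?_⟩
    · rw [book_mk_cons, book_mk_cons, hextc, hext]
      exact congrArg (fun B => Book.adv B _ _) h.book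
    · simp [h.len]
    · intro i p hp
      rw [book_mk_cons] at hp
      change x ∉ (A.book b).relabel _ i p at hp
      unfold Book.relabel at hp
      split_ifs at hp with hu
      · exact htape i p (Or.inl hu)
      · exact htape i p (Or.inr hp)
    · intro i hi
      refine htape i _ (Or.inl ?_)
      rw [hi]
      exact Finset.right_mem_uIcc
  · have he' : ¬ (C.book b).Event (extPos C.conf) (extPos (move τ C.conf)) := by
      rwa [h.book, hextc, hext]
    rw [step_of_not_event he] at hA' ⊢
    rw [step_of_not_event he']
    refine Or.inl ⟨rfl, h.book, h.len, by simp [h.clock], rfl, hpos, hmem, ?_⟩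
    rintro i p (hp | hp)
    -- Beyond the start, `cur` is still `lab`, which is the label of the start cell and so part of
    -- `deps`; thus it does not contain `x`. The start cell itself is covered by the hypothesis on
    -- the interval.
    · by_cases hps : p = (A.book b).start i
      · refine htape i p (Or.inl ?_)
        rw [hps]
        exact Finset.left_mem_uIcc
      · refine htape i p (Or.inr ?_)
        have h2 := ((Book.mem_uIcc_iff (hA'.le i)).1 hp).1
        have h3 := hA'.ahead i p h2 hps
        have h4 := hA'.lab i p hp
        change (A.book b).cur i p = (A.book b).lab i p at h3
        change (A.book b).lab i p = (A.book b).lab i _ at h4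
        rw [h3, h4]
        intro hmem
        exact hx (Finset.mem_biUnion.2 ⟨i, Finset.mem_univ _, hmem⟩)
    · exact htape i p (Or.inr hp)

theorem Lock.block {x : ℕ} {A A' C : M.Aug} (h : Lock b x A C) (hA : WF b A)
    (hx : x ∉ (A.book b).deps) (hs : Relation.ReflTransGen (DStep b f) A A')
    (hl : A'.log.length = A.log.length + 1) (hc : A'.clock = 0) :
    ∃ C' en, Relation.ReflTransGen (DStep b f) C C' ∧ Post b x en A' C' := by
  induction hs using Relation.ReflTransGen.head_induction_on generalizing C with
  | refl => omega
  | @head A A₁ h1 h2 ih =>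
    obtain ⟨C₁, h3, ⟨h4, h5⟩ | ⟨h4, h5, h6⟩⟩ := h.step hA hx h1
    · have hb : A₁.book b = A.book b := book_congr h4
      obtain ⟨C', en, h6, h7⟩ := ih h5 (hA.step h1.step) (by rwa [hb]) (by rw [h4, hl])
      exact ⟨C', en, Relation.ReflTransGen.head h3 h6, h7⟩
    · obtain rfl := eq_of_reflTransGen (reflTransGen_step h2) (by omega) (by omega)
      exact ⟨C₁, _, Relation.ReflTransGen.single h3, h6⟩

/-- The last block ends by halting instead of an event, so no record is written for it. -/
theorem Lock.halt {x : ℕ} {A F C : M.Aug} (h : Lock b x A C) (hA : WF b A)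
    (hx : x ∉ (A.book b).deps) (hs : Relation.ReflTransGen (DStep b f) A F)
    (hl : F.log.length = A.log.length) (hF : app F.conf = ∅) :
    ∃ F', Relation.ReflTransGen (DStep b f) C F' ∧ app F'.conf = ∅ ∧
      F'.conf.state = F.conf.state := by
  induction hs using Relation.ReflTransGen.head_induction_on generalizing C with
  | refl => exact ⟨C, Relation.ReflTransGen.refl, h.app_eq.trans hF, h.state⟩
  | @head A A₁ h1 h2 ih =>
    obtain ⟨C₁, h3, ⟨h4, h5⟩ | ⟨h4, h5, h6⟩⟩ := h.step hA hx h1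
    · have hb : A₁.book b = A.book b := book_congr h4
      obtain ⟨C', h6, h7⟩ := ih h5 (hA.step h1.step) (by rwa [hb]) (by rw [h4, hl])
      exact ⟨C', Relation.ReflTransGen.head h3 h6, h7⟩
    · have := (log_suffix (reflTransGen_step h2)).length_le
      omega

/-- Cells outside the swept interval are unchanged. This is needed to compare the mixed run with the
one it does not follow in the block. -/
theorem WF.frame {A A' : M.Aug} (hA : WF b A)
    (hs : Relation.ReflTransGen (DStep b f) A A')
    (hl : A'.log.length = A.log.length + 1) (hc : A'.clock = 0) :
    ∃ en, A'.log = snap en A'.conf :: A.log ∧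
      (∀ i, DirLE ((A.book b).dir i) (extPos A.conf i) (en i)) ∧
      ∀ i, ∀ p ∉ Finset.uIcc ((A.book b).start i) (en i),
        A'.conf.tape (Sum.inl i) p = A.conf.tape (Sum.inl i) p := by
  induction hs using Relation.ReflTransGen.head_induction_on with
  | refl => omega
  | @head A A₁ h1 h2 ih =>
    have hst := h1.step
    obtain ⟨γ, hγ, h3⟩ := hst
    have key : ∀ i, ∀ en, DirLE ((A.book b).dir i) (extPos A.conf i) en →
        ∀ p ∉ Finset.uIcc ((A.book b).start i) en,
        γ.tape (Sum.inl i) p = A.conf.tape (Sum.inl i) p := by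
      intro i en hen p hp
      refine tape_eq_of_mem_next hγ _ fun h => hp ?_
      rw [Book.mem_uIcc_iff ((hA.le i).trans hen), h]
      exact ⟨hA.le i, hen⟩
    by_cases he : (A.book b).Event (extPos A.conf) (extPos γ)
    · rw [step_of_event he] at h3
      obtain rfl := eq_of_reflTransGen (reflTransGen_step h2) (by rw [h3, hl]; rfl) (by rw [h3, hc])
      rw [h3]
      exact ⟨_, rfl, fun i => DirLE.refl _ _, fun i => key i _ (DirLE.refl _ _)⟩
    · rw [step_of_not_event he] at h3
      have h4 : A₁.log = A.log := by rw [h3]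
      have hb : A₁.book b = A.book b := book_congr h4
      have hc : A₁.conf = γ := by rw [h3]
      obtain ⟨en, h5, h6, h7⟩ := ih (hA.step h1.step) (by rw [h4, hl])
      rw [hb] at h6 h7
      rw [hc] at h6 h7
      simp only [Book.Event, not_or, not_exists, not_not] at he
      have h8 : ∀ i, DirLE ((A.book b).dir i) (extPos A.conf i) (en i) := fun i =>
        (Book.dirLE_of_not_turned he.1 i).trans (h6 i)
      exact ⟨en, h4 ▸ h5, h8, fun i p hp => (h7 i p hp).trans (key i _ (h8 i) p hp)⟩

/-- The runs through `A`, `B` and `C` have just completed the same blocks; the contents of a cell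
in `C` may differ from those in `A` only if the cell depends on `x`, and from those in `B` only if
it depends on `x'`. -/
structure Cross (b : Book t) (x x' : ℕ) (A B C : M.Aug) : Prop where
  wfA : WF b A
  wfB : WF b B
  wfC : WF b C
  log : B.log = A.log
  book : C.book b = A.book b
  len : C.log.length = A.log.length
  clockA : A.clock = 0
  clockB : B.clock = 0
  clockC : C.clock = 0
  stateB : B.conf.state = A.conf.state
  posB : B.conf.pos = A.conf.pos
  memB : ∀ j, B.conf.tape (Sum.inr j) = A.conf.tape (Sum.inr j)
  symB : ∀ i, B.conf.tape (Sum.inl i) (extPos A.conf i) = A.conf.tape (Sum.inl i) (extPos A.conf i)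
  state : C.conf.state = A.conf.state
  pos : C.conf.pos = A.conf.pos
  mem : ∀ j, C.conf.tape (Sum.inr j) = A.conf.tape (Sum.inr j)
  sym : ∀ i, C.conf.tape (Sum.inl i) (extPos A.conf i) = A.conf.tape (Sum.inl i) (extPos A.conf i)
  tapeA : ∀ i p, x ∉ (A.book b).cur i p → C.conf.tape (Sum.inl i) p = A.conf.tape (Sum.inl i) p
  tapeB : ∀ i p, x' ∉ (A.book b).cur i p → C.conf.tape (Sum.inl i) p = B.conf.tape (Sum.inl i) p

theorem Cross.bookB {x x' : ℕ} {A B C : M.Aug} (h : Cross b x x' A B C) :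
    B.book b = A.book b := book_congr h.log

/-- At the start of a block the interval is a single cell per tape. Its `cur` label may contain `x`,
if it was just rewritten, but its symbol agrees by `sym`. -/
theorem Cross.lockA {x x' : ℕ} {A B C : M.Aug} (h : Cross b x x' A B C) : Lock b x A C where
  book := h.book
  len := h.len
  clock := h.clockC.trans h.clockA.symm
  state := h.state
  pos := h.pos
  mem := h.mem
  tape i p := by
    rintro (hp | hp)
    · rw [h.wfA.start h.clockA, Finset.uIcc_self, Finset.mem_singleton] at hp
      rw [hp, ← h.wfA.start h.clockA]
      exact h.sym i
    · exact h.tapeA i p hp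

theorem Cross.lockB {x x' : ℕ} {A B C : M.Aug} (h : Cross b x x' A B C) : Lock b x' B C where
  book := h.book.trans h.bookB.symm
  len := h.len.trans (congrArg List.length h.log).symm
  clock := h.clockC.trans h.clockB.symm
  state := h.state.trans h.stateB.symm
  pos := h.pos.trans h.posB.symm
  mem j := (h.mem j).trans (h.memB j).symm
  tape i p := by
    have he : extPos B.conf i = extPos A.conf i := congrFun h.posB _
    rw [h.bookB, he]
    rintro (hp | hp)
    · rw [h.wfA.start h.clockA, Finset.uIcc_self, Finset.mem_singleton] at hp
      rw [hp, ← h.wfA.start h.clockA]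
      exact (h.sym i).trans (h.symB i).symm
    · exact h.tapeB i p hp

/-- After the relabelling, the cells that the heads have just left the block for are labelled with
sets that are involved in the next block. -/
theorem cur_subset_deps {A A' : M.Aug} (hA' : WF b A') {en : Fin t → ℕ}
    (hl : A'.log = snap en A'.conf :: A.log) (hA : WF b A)
    (hen : ∀ i, DirLE ((A.book b).dir i) (extPos A.conf i) (en i)) (hc : A'.clock = 0) {i : Fin t}
    (hi : extPos A'.conf i ≠ en i) :
    (A'.book b).cur i (extPos A'.conf i) ⊆ (A'.book b).deps := by
  have hb : A'.book b = (A.book b).adv en (extPos A'.conf) := by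
    rw [book, hl]; rfl
  have h1 : (A'.book b).lab i (extPos A'.conf i) ⊆ (A'.book b).deps := by
    rw [hA'.start hc i]
    exact Finset.subset_biUnion_of_mem (fun i => (A'.book b).lab i ((A'.book b).start i))
      (Finset.mem_univ i)
  refine subset_trans (le_of_eq ?_) h1
  rw [hb]
  by_cases ht : (A.book b).Turned en (extPos A'.conf)
  · simp [Book.adv, ht]
  · have h2 := Book.dirLE_of_not_turned ht i
    have h3 : ((A.book b).adv en (extPos A'.conf)).lab = (A.book b).lab := by simp [Book.adv, ht]
    rw [h3]
    have h4 := (hA.le i).trans (hen i)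
    have h5 : extPos A'.conf i ∉ Finset.uIcc ((A.book b).start i) (en i) := fun h =>
      hi (((Book.mem_uIcc_iff h4).1 h).2.antisymm h2)
    change (A.book b).relabel en i _ = _
    rw [Book.relabel, if_neg h5]
    refine hA.ahead i _ (h4.trans h2) fun h => h5 ?_
    rw [h]
    exact Finset.left_mem_uIcc

/-- If `x` is not involved in the block, `C` can follow `A`; if `x'` is not involved, it can follow
`B`. Since `A` and `B` write the same record, `C` ends the block in the recorded state in either
case, and may follow the other run in the next block. -/
theorem Cross.block {x x' : ℕ} {A B C A' B' : M.Aug} (h : Cross b x x' A B C)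
    (hA : Relation.ReflTransGen (DStep b f) A A') (hB : Relation.ReflTransGen (DStep b f) B B')
    (hl : ∃ e, A'.log = e :: A.log) (hcA : A'.clock = 0) (hlog : B'.log = A'.log)
    (hcB : B'.clock = 0) (hd : x ∉ (A.book b).deps ∨ x' ∉ (A.book b).deps)
    (hd' : x ∉ (A'.book b).deps ∨ x' ∉ (A'.book b).deps) :
    ∃ C', Relation.ReflTransGen (DStep b f) C C' ∧ Cross b x x' A' B' C' := by
  have hlA : A'.log.length = A.log.length + 1 := by
    obtain ⟨e, he⟩ := hl
    rw [he]; rfl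
  have hlB : B'.log.length = B.log.length + 1 := by rw [hlog, h.log, hlA]
  have postA := fun hx => h.lockA.block h.wfA hx hA hlA hcA
  have postB := fun hx => h.lockB.block h.wfB hx hB hlB hcB
  have hwA := h.wfA.reflTransGen (reflTransGen_step hA)
  have hwB := h.wfB.reflTransGen (reflTransGen_step hB)
  obtain ⟨en, hA1, hA2, hA3⟩ := h.wfA.frame hA hlA hcA
  obtain ⟨enB, hB1, hB2, hB3⟩ := h.wfB.frame hB hlB hcB
  have hBA : snap enB B'.conf = snap en A'.conf := by
    have := hlog
    rw [hB1, hA1, List.cons.injEq] at this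
    exact this.1
  obtain rfl : enB = en := congrArg Snap.en hBA
  have hstB : B'.conf.state = A'.conf.state := congrArg Snap.state hBA
  have hposB : B'.conf.pos = A'.conf.pos := congrArg Snap.pos hBA
  have hmemB : ∀ j, B'.conf.tape (Sum.inr j) = A'.conf.tape (Sum.inr j) :=
    congrFun (congrArg Snap.mem hBA)
  have hextB : extPos B'.conf = extPos A'.conf := funext fun i => congrFun hposB _
  have hsymB : ∀ i, B'.conf.tape (Sum.inl i) (extPos A'.conf i) =
      A'.conf.tape (Sum.inl i) (extPos A'.conf i) := fun i => by
    have := congrFun (congrArg Snap.sym hBA) i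
    change B'.conf.tape (Sum.inl i) (extPos B'.conf i) = _ at this
    rwa [hextB] at this
  have hbookB : B'.book b = A'.book b := book_congr hlog
  -- When neither string is involved, `C` follows both runs; by determinism both comparisons concern
  -- the same `C'`.
  obtain ⟨C', hC, hpA, hpB⟩ : ∃ C', Relation.ReflTransGen (DStep b f) C C' ∧
      (x ∉ (A.book b).deps → ∃ e, Post b x e A' C') ∧
      (x' ∉ (A.book b).deps → ∃ e, Post b x' e B' C') := by
    by_cases hx : x ∉ (A.book b).deps
    · obtain ⟨C', e, h1, h2⟩ := postA hx
      refine ⟨C', h1, fun _ => ⟨e, h2⟩, fun hx' => ?_⟩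
      obtain ⟨C'', e', h3, h4⟩ := postB (h.bookB ▸ hx')
      obtain rfl := unique_of_reflTransGen h1 h3
        (by rw [h2.len, h4.len, hlog]) (by rw [h2.clock, h4.clock, hcA, hcB])
      exact ⟨e', h4⟩
    · obtain ⟨C', e, h1, h2⟩ := postB (h.bookB ▸ hd.resolve_left hx)
      exact ⟨C', h1, fun h => absurd h hx, fun _ => ⟨e, h2⟩⟩
  have hwC := h.wfC.reflTransGen (reflTransGen_step hC)
  have en_eq : ∀ {y e} {D D' : M.Aug}, Post b y e D C' → D.log = A'.log → e = enB := by
    intro y e D _ h1 h2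
    obtain ⟨l, h3⟩ := h1.logA
    rw [h2, hA1, List.cons.injEq] at h3
    exact (congrArg Snap.en h3.1).symm
  have hpA' : x ∉ (A.book b).deps → Post b x enB A' C' := fun hx => by
    obtain ⟨e, he⟩ := hpA hx
    exact en_eq (D' := A) he rfl ▸ he
  have hpB' : x' ∉ (A.book b).deps → Post b x' enB B' C' := fun hx => by
    obtain ⟨e, he⟩ := hpB hx
    exact en_eq (D' := A) he hlog ▸ he
  obtain ⟨hCb, hCl, hCc, hCs, hCp, hCm, hCL⟩ : C'.book b = A'.book b ∧
      C'.log.length = A'.log.length ∧ C'.clock = 0 ∧ C'.conf.state = A'.conf.state ∧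
      C'.conf.pos = A'.conf.pos ∧
      (∀ j, C'.conf.tape (Sum.inr j) = A'.conf.tape (Sum.inr j)) ∧
      ∃ l, C'.log = snap enB C'.conf :: l := by
    rcases hd with hx | hx
    · have := hpA' hx
      exact ⟨this.book, this.len, this.clock.trans hcA, this.state, this.pos, this.mem, this.logC⟩
    · have := hpB' hx
      exact ⟨this.book.trans hbookB, this.len.trans (congrArg _ hlog), this.clock.trans hcB,
        this.state.trans hstB, this.pos.trans hposB, fun j => (this.mem j).trans (hmemB j),
        this.logC⟩
  have hCfr : ∀ i, ∀ p ∉ Finset.uIcc ((A.book b).start i) (enB i),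
        C'.conf.tape (Sum.inl i) p = C.conf.tape (Sum.inl i) p := by
    obtain ⟨e, h1, -, h3⟩ := h.wfC.frame hC (by rw [hCl, hlA, h.len]) hCc
    obtain ⟨l, h4⟩ := hCL
    rw [h1, List.cons.injEq] at h4
    obtain rfl : e = enB := congrArg Snap.en h4.1
    rw [h.book] at h3
    exact h3
  have hcur : ∀ i p, (A'.book b).cur i p = (A.book b).relabel enB i p := by
    intro i p
    rw [Aug.book, hA1]; rfl
  have htA : ∀ i p, x ∉ (A'.book b).cur i p →
      C'.conf.tape (Sum.inl i) p = A'.conf.tape (Sum.inl i) p := by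
    intro i p hp
    by_cases hx : x ∉ (A.book b).deps
    · exact (hpA' hx).tape i p hp
    -- If `x` is involved, the swept cells are now labelled with `x` and nothing is claimed about
    -- them; the other cells have not changed in either run.
    · rw [hcur] at hp
      unfold Book.relabel at hp
      split_ifs at hp with hu
      · exact absurd hp hx
      · rw [hCfr i p hu, h.tapeA i p hp, hA3 i p hu]
  have htB : ∀ i p, x' ∉ (A'.book b).cur i p →
      C'.conf.tape (Sum.inl i) p = B'.conf.tape (Sum.inl i) p := by
    intro i p hp
    by_cases hx : x' ∉ (A.book b).deps
    · exact (hpB' hx).tape i p (by rwa [hbookB])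
    · rw [hcur] at hp
      unfold Book.relabel at hp
      split_ifs at hp with hu
      · exact absurd hp hx
      · rw [hCfr i p hu, h.tapeB i p hp, hB3 i p (by rwa [h.bookB])]
  refine ⟨C', hC, hwA, hwB, hwC, hlog, hCb, hCl, hcA, hcB, hCc, hstB, hposB, hmemB, hsymB, hCs, hCp,
    hCm, fun i => ?_, htA, htB⟩
  -- A head that stays reads what was written in the finished block. A head that moves enters a cell
  -- whose label is contained in the next `deps`, so `hd'` provides a run with which `C'` agrees
  -- there. In both cases the recorded symbol transfers agreement between `A'` and `B'`.
  by_cases hi : extPos A'.conf i = enB i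
  · rcases hd with hx | hx
    · exact (hpA' hx).stay i hi
    · have := (hpB' hx).stay i (by rw [hextB, hi])
      rw [hextB] at this
      exact this.trans (hsymB i)
  · have hsub := cur_subset_deps hwA hA1 h.wfA hA2 hcA hi
    rcases hd' with hx | hx
    · exact htA i _ fun hmem => hx (hsub hmem)
    · exact (htB i _ fun hmem => hx (hsub hmem)).trans (hsymB i)

/-- Induction on the number `n` of blocks that are still to be completed. -/
theorem Cross.accept {x x' : ℕ} {A B C FA FB : M.Aug} (h : Cross b x x' A B C)
    (hA : Relation.ReflTransGen (DStep b f) A FA) (hB : Relation.ReflTransGen (DStep b f) B FB)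
    (hFA : app FA.conf = ∅) (hFB : app FB.conf = ∅) (hlog : FB.log = FA.log)
    (haA : FA.conf.state ∈ M.accept) (haB : FB.conf.state ∈ M.accept)
    (hd : ∀ l, l <:+ FA.log → x ∉ (b.ofLog (moves l)).deps ∨ x' ∉ (b.ofLog (moves l)).deps) :
    ∃ FC, Relation.ReflTransGen (DStep b f) C FC ∧ app FC.conf = ∅ ∧ FC.conf.state ∈ M.accept := by
  obtain ⟨n, hn⟩ := Nat.exists_eq_add_of_le (log_suffix (reflTransGen_step hA)).length_le
  have hdA := hd _ (log_suffix (reflTransGen_step hA))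
  induction n generalizing A B C with
  | zero =>
    rcases hdA with hx | hx
    · obtain ⟨FC, h1, h2, h3⟩ := h.lockA.halt h.wfA hx hA hn hFA
      exact ⟨FC, h1, h2, h3 ▸ haA⟩
    · obtain ⟨FC, h1, h2, h3⟩ := h.lockB.halt h.wfB (h.bookB ▸ hx) hB
        (by rw [hlog, h.log]; exact hn) hFB
      exact ⟨FC, h1, h2, h3 ▸ haB⟩
  | succ n ih =>
    obtain ⟨A', a1, a2, ⟨e, a3⟩, a4⟩ := exists_block hA (by omega)
    obtain ⟨B', b1, b2, ⟨e', b3⟩, b4⟩ := exists_block hB (by rw [hlog, h.log]; omega)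
    have s1 := log_suffix (reflTransGen_step a2)
    have s2 := log_suffix (reflTransGen_step b2)
    rw [hlog] at s2
    have hlen : B'.log.length = A'.log.length := by rw [b3, a3, h.log]; rfl
    -- Intermediate logs are suffixes of the common final log, so their lengths determine them.
    have hAB : B'.log = A'.log := (List.suffix_of_suffix_length_le s2 s1 hlen.le).eq_of_length hlen
    have hdA' := hd _ s1
    obtain ⟨C', c1, c2⟩ := h.block a1 b1 ⟨e, a3⟩ a4 hAB b4 hdA hdA'
    obtain ⟨FC, h1, h2⟩ := ih c2 a2 b2 (by rw [a3]; simp; omega) hdA'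
    exact ⟨FC, c1.trans h1, h2⟩

variable (b f) in
/-- The run from `S` with random choices `f` is accepting. -/
def Acc (S : M.Aug) : Prop :=
  ∃ F, Relation.ReflTransGen (DStep b f) S F ∧ app F.conf = ∅ ∧ F.conf.state ∈ M.accept

/-- Inputs may be combined if the parts taken from them are never involved in the same block. -/
theorem acc_of_cross {l c : ℕ} {x x' : ℕ} {wA wB wC : List Letter} {FA FB : M.Aug}
    (hAB : ∀ a ∈ wA.head?, wB.head? = some a) (hAC : ∀ a ∈ wA.head?, wC.head? = some a)
    (hne : wA ≠ [])
    (hA : ∀ p, min (p / l) c ≠ x → wC[p]? = wA[p]?)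
    (hB : ∀ p, min (p / l) c ≠ x' → wC[p]? = wB[p]?)
    (hrA : Relation.ReflTransGen (DStep (Book.initial t l c) f) (init M wA) FA)
    (hrB : Relation.ReflTransGen (DStep (Book.initial t l c) f) (init M wB) FB)
    (hFA : app FA.conf = ∅) (hFB : app FB.conf = ∅) (hlog : FB.log = FA.log)
    (haA : FA.conf.state ∈ M.accept) (haB : FB.conf.state ∈ M.accept)
    (hd : ∀ l', l' <:+ FA.log → x ∉ ((Book.initial t l c).ofLog (moves l')).deps ∨
      x' ∉ ((Book.initial t l c).ofLog (moves l')).deps) :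
    Acc (Book.initial t l c) f (init M wC) := by
  have key : ∀ (w w' : List Letter) (i : Fin t) (p : ℕ), w[p]? = w'[p]? →
      (M.init w).tape (Sum.inl i) p = (M.init w').tape (Sum.inl i) p := by
    intro w w' i p h
    simp only [NTM.init, Sum.elim_inl, inscription]
    split_ifs
    · rw [h]
    · rfl
  obtain ⟨a, wA', rfl⟩ := List.exists_cons_of_ne_nil hne
  -- All heads start on cell 0, where the symbols must agree even if the first string is the
  -- exchanged one.
  have h0B : wB[0]? = (a :: wA')[0]? := by
    rw [← List.head?_eq_getElem?, hAB a rfl]; rfl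
  have h0C : wC[0]? = (a :: wA')[0]? := by
    rw [← List.head?_eq_getElem?, hAC a rfl]; rfl
  have hcross : Cross (Book.initial t l c) x x' (init M (a :: wA')) (init M wB) (init M wC) := by
    refine ⟨wf_init _ _ _, wf_init _ _ _, wf_init _ _ _, rfl, rfl, rfl, rfl, rfl, rfl, rfl, rfl,
      fun _ => rfl, fun i => key _ _ i _ h0B, rfl, rfl, fun _ => rfl, fun i => key _ _ i _ h0C,
      fun i p hp => key _ _ i _ (hA p fun h => hp ?_), fun i p hp => key _ _ i _ (hB p fun h =>
        hp ?_)⟩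
    · exact Finset.mem_singleton.2 h.symm
    · exact Finset.mem_singleton.2 h.symm
  exact hcross.accept hrA hrB hFA hFB hlog haA haB hd

end Aug

end NTM

end ExtMem

namespace ExtMem

namespace NTM

/-! ### Runs and direction changes -/

/-- The number of direction changes of a head that is successively at the given positions, if its
direction was `d` before. -/
def flips : Bool → List ℕ → ℕ
  | d, a :: b :: l => (if newDir d a b ≠ d then 1 else 0) + flips (newDir d a b) (b :: l)
  | _, [_] => 0
  | _, [] => 0

/-- The number of changes in a list. -/
def changes (l : List SignType) : ℕ := (l.zip l.tail).countP fun x => x.1 ≠ x.2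

theorem changes_cons_cons (x y : SignType) (l : List SignType) :
    changes (x :: y :: l) = (if x ≠ y then 1 else 0) + changes (y :: l) := by
  simp only [changes, List.tail_cons, List.zip_cons_cons, List.countP_cons]
  rw [add_comm]
  simp

theorem directions_cons_cons (a b : ℕ) (l : List ℕ) : directions (a :: b :: l) =
    (if a < b then [1] else if b < a then [-1] else []) ++ directions (b :: l) := by
  simp only [directions, List.tail_cons, List.zip_cons_cons, List.map_cons, List.filter_cons]
  split_ifs <;> simp_all

theorem flips_eq (d : Bool) (p : List ℕ) :
    flips d p = changes ((if d then 1 else -1) :: directions p) := by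
  induction p generalizing d with
  | nil => simp [flips, directions, changes]
  | cons a p ih =>
    cases p with
    | nil => simp [flips, directions, changes]
    | cons b p =>
      rw [flips, ih, directions_cons_cons]
      rcases lt_trichotomy a b with h | rfl | h
      · cases d <;> simp [newDir, h, changes_cons_cons]
      · cases d <;> simp [newDir]
      · cases d <;> simp [newDir, h, h.not_gt, changes_cons_cons]

/-- From cell 0 the first proper move goes to the right, so the direction `true` assumed at the
start costs no flip. -/
theorem flips_eq_turns (p : List ℕ) : flips true (0 :: p) = turns (0 :: p) := by
  rw [flips_eq]
  change _ = changes (directions (0 :: p))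
  have key : ∀ p : List ℕ, directions (0 :: p) = [] ∨ ∃ l, directions (0 :: p) = 1 :: l := by
    intro p
    induction p with
    | nil => left; simp [directions]
    | cons b p ih =>
      rw [directions_cons_cons]
      rcases Nat.eq_zero_or_pos b with rfl | h
      · simpa using ih
      · right
        exact ⟨_, by rw [if_pos h]; rfl⟩
  rcases key p with h | ⟨l, h⟩
  · rw [h]; simp [changes]
  · rw [h, if_pos rfl, changes_cons_cons]; simp

variable {t u : ℕ} {M : NTM t u}

/-- `γ` occurs in a run on input `w`. -/
def Reach (w : List Letter) (γ : M.Config) : Prop :=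
  Relation.ReflTransGen (fun γ γ' => γ' ∈ M.next γ) (M.init w) γ

theorem exists_infiniteRun {w : List Letter} {γ₀ : M.Config} (h₀ : Reach w γ₀)
    (Q : M.Config → Prop) (hQ₀ : Q γ₀) (hQ : ∀ γ, Q γ → ∃ γ' ∈ M.next γ, Q γ') :
    ∃ ρ, M.IsInfiniteRun w ρ := by
  -- Enlarging `Q` to the configurations that lead to it also covers the path from the initial
  -- configuration to `γ₀`.
  let Q' : M.Config → Prop := fun γ =>
    ∃ γ₁, Relation.ReflTransGen (fun γ γ' => γ' ∈ M.next γ) γ γ₁ ∧ Q γ₁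
  have hQ' : ∀ γ : {γ // Q' γ}, ∃ γ' : {γ // Q' γ}, γ'.1 ∈ M.next γ.1 := by
    rintro ⟨γ, γ₁, h1, h2⟩
    rcases Relation.ReflTransGen.cases_head h1 with rfl | ⟨γ', h3, h4⟩
    · obtain ⟨γ', h3, h4⟩ := hQ γ h2
      exact ⟨⟨γ', γ', Relation.ReflTransGen.refl, h4⟩, h3⟩
    · exact ⟨⟨γ', γ₁, h4, h2⟩, h3⟩
  choose F hF using hQ'
  let ρ : ℕ → {γ // Q' γ} := fun n => Nat.rec ⟨M.init w, γ₀, h₀, hQ₀⟩ (fun _ γ => F γ) n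
  exact ⟨fun n => (ρ n).1, rfl, fun n => hF (ρ n)⟩

theorem isChain_of_reflTransGen {γ γ' : M.Config}
    (h : Relation.ReflTransGen (fun γ γ' => γ' ∈ M.next γ) γ γ') :
    ∃ ρ : List M.Config, (γ :: ρ).IsChain (fun γ γ' => γ' ∈ M.next γ) ∧
      (γ :: ρ).getLast? = some γ' := by
  induction h using Relation.ReflTransGen.head_induction_on with
  | refl => exact ⟨[], by simp, rfl⟩
  | @head γ γ₁ h1 _ ih =>
    obtain ⟨ρ, h2, h3⟩ := ih
    exact ⟨γ₁ :: ρ, List.isChain_cons_cons.2 ⟨h1, h2⟩, by rw [List.getLast?_cons_cons, h3]⟩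

/-- In a complete run of `M`, between two configurations, all intermediate head positions occur. -/
theorem uIcc_subset_of_isChain {γ : M.Config} {ρ : List M.Config}
    (h : (γ :: ρ).IsChain (fun γ γ' => γ' ∈ M.next γ)) (i : Tape t u) {γ' : M.Config}
    (h' : γ' ∈ γ :: ρ) :
    Finset.uIcc (γ.pos i) (γ'.pos i) ⊆ ((γ :: ρ).map fun γ => γ.pos i).toFinset := by
  induction ρ generalizing γ with
  | nil =>
    obtain rfl := List.mem_singleton.1 h'
    simp
  | cons γ₁ ρ ih =>
    obtain ⟨h1, h2⟩ := List.isChain_cons_cons.1 h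
    rcases List.mem_cons.1 h' with rfl | h'
    · simp
    · have h3 := ih h2 h'
      have h4 := pos_le_of_mem_next h1 i
      intro p hp
      rw [List.map_cons, List.toFinset_cons, Finset.mem_insert]
      by_cases hpe : p = γ.pos i
      · exact Or.inl hpe
      · refine Or.inr (h3 ?_)
        simp only [Finset.mem_uIcc] at hp ⊢
        omega

variable (M) in
/-- All runs on input `w` are finite and use at most the given resources. -/
structure Resources (R S : ℕ) (w : List Letter) : Prop where
  finite : ¬ ∃ ρ, M.IsInfiniteRun w ρ
  rev_le : ∀ ρ, M.IsRun w ρ → 1 + ∑ i : Fin t, M.rev ρ (Sum.inl i) ≤ R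
  space_le : ∀ ρ, M.IsRun w ρ → ∑ j : Fin u, M.space ρ (Sum.inr j) ≤ S

variable {R S : ℕ} {w : List Letter}

/-- If no halting configuration could be reached from `γ`, there would be an infinite run. So bounds
on complete runs apply to every reachable configuration. -/
theorem Resources.exists_run (h : Resources M R S w) {γ : M.Config} (hγ : Reach w γ) :
    ∃ ρ, M.IsRun w ρ ∧ γ ∈ ρ := by
  obtain ⟨γ', h1, h2⟩ : ∃ γ', Relation.ReflTransGen (fun γ γ' => γ' ∈ M.next γ) γ γ' ∧
      M.next γ' = ∅ := by
    by_contra! hne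
    refine h.finite (exists_infiniteRun hγ
      (fun γ' => Relation.ReflTransGen (fun γ γ' => γ' ∈ M.next γ) γ γ')
      Relation.ReflTransGen.refl fun γ' hγ' => ?_)
    obtain ⟨γ'', h3⟩ := hne γ' hγ'
    exact ⟨γ'', h3, hγ'.tail h3⟩
  obtain ⟨ρ₂, h3, h4⟩ := isChain_of_reflTransGen h1
  suffices key : ∀ γ₀ : M.Config, Relation.ReflTransGen (fun γ γ' => γ' ∈ M.next γ) γ₀ γ →
      ∃ ρ : List M.Config, (γ₀ :: ρ).IsChain (fun γ γ' => γ' ∈ M.next γ) ∧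
        (γ₀ :: ρ).getLast? = some γ' ∧ γ ∈ γ₀ :: ρ by
    obtain ⟨ρ, h5, h6, h7⟩ := key _ hγ
    refine ⟨_, ⟨rfl, h5, ?_⟩, h7⟩
    rw [h6]
    rintro _ ⟨⟩
    exact h2
  intro γ₀ hγ₀
  induction hγ₀ using Relation.ReflTransGen.head_induction_on with
  | refl => exact ⟨ρ₂, h3, h4, List.mem_cons_self⟩
  | @head γ₀ γ₁ h5 _ ih =>
    obtain ⟨ρ, h6, h7, h8⟩ := ih
    exact ⟨γ₁ :: ρ, List.isChain_cons_cons.2 ⟨h5, h6⟩, by rw [List.getLast?_cons_cons, h7],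
      List.mem_cons_of_mem _ h8⟩

theorem Resources.pos_lt (h : Resources M R S w) {γ : M.Config} (hγ : Reach w γ) (j : Fin u) :
    γ.pos (Sum.inr j) < S := by
  obtain ⟨ρ, h1, h2⟩ := h.exists_run hγ
  have h3 := h.space_le ρ h1
  have h4 : M.space ρ (Sum.inr j) ≤ S := (Finset.single_le_sum
    (f := fun j => M.space ρ (Sum.inr j)) (fun _ _ => Nat.zero_le _) (Finset.mem_univ j)).trans h3
  obtain ⟨h5, h6, -⟩ := h1
  cases ρ with
  | nil => cases h5
  | cons γ₀ ρ =>
    obtain rfl : γ₀ = M.init w := by simpa using h5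
    have h7 := Finset.card_le_card (uIcc_subset_of_isChain h6 (Sum.inr j) h2)
    rw [Nat.card_uIcc] at h7
    change _ ≤ M.space _ _ at h7
    have h8 : (M.init w).pos (Sum.inr j) = 0 := rfl
    omega

theorem Resources.tape_eq_blank (h : Resources M R S w) {γ : M.Config} (hγ : Reach w γ) (j : Fin u)
    {p : ℕ} (hp : S ≤ p) : γ.tape (Sum.inr j) p = M.blank := by
  induction hγ with
  | refl => simp [init, inscription]
  | tail h1 h2 ih =>
    have := h.pos_lt h1 j
    rw [tape_eq_of_mem_next h2 _ (by omega), ih]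

variable (M) in
/-- A type for the state, the internal memory and the symbols read on the external tapes, if the
space is bounded by `S`. -/
abbrev Core (S : ℕ) : Type :=
  M.State × (Fin u → Fin (S + 1)) × (Fin u → Fin (S + 1) → M.Sym) × (Fin t → M.Sym)

instance (S : ℕ) : Finite (M.Core S) := by
  have := M.finite_state
  have := M.finite_sym
  infer_instance

/-- The state, the internal memory and the symbols read on the external tapes. -/
def core (S : ℕ) (γ : M.Config) : M.Core S :=
  (γ.state, fun j => Fin.ofNat _ (γ.pos (Sum.inr j)), fun j p => γ.tape (Sum.inr j) p,
    fun i => γ.tape (Sum.inl i) (extPos γ i))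

/-- Internal heads stay below `S` and cells from `S` on are blank, so the reduction modulo `S + 1`
and the truncation of the tapes lose nothing. -/
theorem Resources.core_inj {w' : List Letter} (h : Resources M R S w) (h' : Resources M R S w')
    {γ γ' : M.Config} (hγ : Reach w γ)
    (hγ' : Reach w' γ') (heq : core S γ = core S γ') :
    γ.state = γ'.state ∧ (∀ j, γ.pos (Sum.inr j) = γ'.pos (Sum.inr j)) ∧
      (∀ j, γ.tape (Sum.inr j) = γ'.tape (Sum.inr j)) ∧
      ∀ i, γ.tape (Sum.inl i) (extPos γ i) = γ'.tape (Sum.inl i) (extPos γ' i) := by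
  simp only [core, Prod.mk.injEq] at heq
  obtain ⟨h1, h2, h3, h4⟩ := heq
  refine ⟨h1, fun j => ?_, fun j => ?_, congrFun h4⟩
  · have h5 := congrArg Fin.val (congrFun h2 j)
    have h6 := h.pos_lt hγ j
    have h7 := h'.pos_lt hγ' j
    rwa [Fin.val_ofNat, Fin.val_ofNat, Nat.mod_eq_of_lt (by omega),
      Nat.mod_eq_of_lt (by omega)] at h5
  · funext p
    rcases lt_or_ge p S with hp | hp
    · exact congrFun (congrFun h3 j) ⟨p, by omega⟩
    · rw [h.tape_eq_blank hγ j hp, h'.tape_eq_blank hγ' j hp]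

/-! ### Phases -/

namespace Aug

variable {b : Book t}

theorem Step.phase {A A' : M.Aug} (h : A.Step b A') :
    ((A'.book b).phase = (A.book b).phase ∧ (A'.book b).dir = (A.book b).dir ∧
      ∀ i, DirLE ((A.book b).dir i) (extPos A.conf i) (extPos A'.conf i)) ∨
    (A'.book b).phase = (A.book b).phase + 1 := by
  obtain ⟨γ, hγ, rfl⟩ := h
  by_cases he : (A.book b).Event (extPos A.conf) (extPos γ)
  · rw [step_of_event he, book_mk_cons]
    by_cases ht : (A.book b).Turned (extPos A.conf) (extPos γ)
    · right
      change (Book.adv (A.book b) _ _).phase = _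
      simp [Book.adv, ht]
    · left
      refine ⟨?_, funext fun i => Book.dir_adv_of_not_turned ht i,
        Book.dirLE_of_not_turned ht⟩
      change (Book.adv (A.book b) _ _).phase = _
      simp [Book.adv, ht]
  · rw [step_of_not_event he]
    simp only [Book.Event, not_or, not_exists, not_not] at he
    exact Or.inl ⟨rfl, rfl, Book.dirLE_of_not_turned he.1⟩

/-- A new phase costs at least one turn; simultaneous turns of several heads start only one phase.
-/
theorem phase_le_of_step {A A' : M.Aug} (h : A.Step b A') : (A'.book b).phase ≤
    (A.book b).phase + ∑ i, (if (A'.book b).dir i ≠ (A.book b).dir i then 1 else 0) ∧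
    ∀ i, (A'.book b).dir i = newDir ((A.book b).dir i) (extPos A.conf i) (extPos A'.conf i) := by
  obtain ⟨γ, hγ, rfl⟩ := h
  by_cases he : (A.book b).Event (extPos A.conf) (extPos γ)
  · rw [step_of_event he, book_mk_cons]
    refine ⟨?_, fun i => rfl⟩
    by_cases ht : (A.book b).Turned (extPos A.conf) (extPos γ)
    · have h1 : ((b.ofLog (moves A.log)).adv (extPos A.conf) (extPos γ)).phase =
          (A.book b).phase + 1 := by
        change (Book.adv (A.book b) _ _).phase = _
        simp [Book.adv, ht]
      rw [h1]
      obtain ⟨i, hi⟩ := ht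
      refine Nat.add_le_add_left ?_ _
      refine le_trans ?_ (Finset.single_le_sum (f := fun i => if
        ((b.ofLog (moves A.log)).adv (extPos A.conf) (extPos γ)).dir i ≠ (A.book b).dir i then 1
          else 0) (fun _ _ => Nat.zero_le _) (Finset.mem_univ i))
      rw [if_pos]
      exact hi
    · have h1 : ((b.ofLog (moves A.log)).adv (extPos A.conf) (extPos γ)).phase =
          (A.book b).phase := by
        change (Book.adv (A.book b) _ _).phase = _
        simp [Book.adv, ht]
      omega
  · rw [step_of_not_event he]
    simp only [Book.Event, not_or, not_exists, not_not] at he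
    exact ⟨Nat.le_add_right _ _, fun i => (Book.dir_adv_of_not_turned he.1 i).symm⟩

theorem phase_le_flips {A F : M.Aug} (h : Relation.ReflTransGen (Step b) A F) :
    ∃ ρ : List M.Config, (A.conf :: ρ).IsChain (fun γ γ' => γ' ∈ M.next γ) ∧
      (A.conf :: ρ).getLast? = some F.conf ∧ (F.book b).phase ≤ (A.book b).phase +
        ∑ i, flips ((A.book b).dir i) ((A.conf :: ρ).map fun γ => γ.pos (Sum.inl i)) := by
  induction h using Relation.ReflTransGen.head_induction_on with
  | refl => exact ⟨[], by simp, rfl, Nat.le_add_right _ _⟩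
  | @head A A₁ h1 _ ih =>
    obtain ⟨ρ, h2, h3, h4⟩ := ih
    obtain ⟨h5, h6⟩ := phase_le_of_step h1
    obtain ⟨γ, hγ, h7⟩ := h1
    have hc : A₁.conf = γ := by rw [h7, conf_step]
    refine ⟨A₁.conf :: ρ, List.isChain_cons_cons.2 ⟨by rwa [hc], h2⟩,
      by rw [List.getLast?_cons_cons, h3], h4.trans ?_⟩
    have h8 : ∀ i, flips ((A.book b).dir i)
        ((A.conf :: A₁.conf :: ρ).map fun γ => γ.pos (Sum.inl i)) =
        (if (A₁.book b).dir i ≠ (A.book b).dir i then 1 else 0) +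
        flips ((A₁.book b).dir i) ((A₁.conf :: ρ).map fun γ => γ.pos (Sum.inl i)) := by
      intro i
      rw [h6 i]
      rfl
    simp only [h8, Finset.sum_add_distrib]
    omega

theorem reach_of_reflTransGen {A : M.Aug} (h : Relation.ReflTransGen (Step b) (init M w) A) :
    Reach w A.conf := by
  induction h with
  | refl => exact Relation.ReflTransGen.refl
  | tail _ h ih =>
    obtain ⟨γ, hγ, rfl⟩ := h
    rw [conf_step]
    exact ih.tail hγ

theorem phase_mono {A F : M.Aug} (h : Relation.ReflTransGen (Step b) A F) :
    (A.book b).phase ≤ (F.book b).phase := by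
  induction h with
  | refl => exact le_rfl
  | tail _ h ih =>
    rcases h.phase with h | h <;> omega

/-- The path is prolonged to a complete run, whose phases are at most its turns; the `1 +` in the
resource bound makes the inequality strict. -/
theorem phase_lt (hM : Resources M R S w) {l c : ℕ} {A : M.Aug}
    (h : Relation.ReflTransGen (Step (Book.initial t l c)) (init M w) A) :
    (A.book (Book.initial t l c)).phase < R := by
  obtain ⟨F, h1, h2⟩ : ∃ F, Relation.ReflTransGen (Step (Book.initial t l c)) A F ∧
      M.next F.conf = ∅ := by
    by_contra! hne
    refine hM.finite (exists_infiniteRun (reach_of_reflTransGen h)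
      (fun γ => ∃ F, Relation.ReflTransGen (Step (Book.initial t l c)) A F ∧ F.conf = γ)
      ⟨A, Relation.ReflTransGen.refl, rfl⟩ ?_)
    rintro _ ⟨F, hF, rfl⟩
    obtain ⟨γ', h3⟩ := hne F hF
    exact ⟨γ', h3, _, hF.tail ⟨γ', h3, rfl⟩, conf_step _ _⟩
  obtain ⟨ρ, h3, h4, h5⟩ := phase_le_flips (h.trans h1)
  have h6 : M.IsRun w ((init M w).conf :: ρ) := by
    refine ⟨rfl, h3, ?_⟩
    rw [h4]
    rintro _ ⟨⟩
    exact h2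
  have h7 := hM.rev_le _ h6
  have h8 : ∀ i, flips (((init M w).book (Book.initial t l c)).dir i)
      (((init M w).conf :: ρ).map fun γ => γ.pos (Sum.inl i)) =
      M.rev ((init M w).conf :: ρ) (Sum.inl i) := fun i => flips_eq_turns _
  have h9 : ((init M w).book (Book.initial t l c)).phase = 0 := rfl
  simp only [h8, h9] at h5
  have := phase_mono h1
  omega

end Aug

end NTM

end ExtMem

namespace ExtMem

namespace NTM

variable {t u : ℕ} {M : NTM t u} {R S : ℕ} {w : List Letter}

/-! ### Bounding the running time -/

/-- A step in which the external heads in `I` do not move to the left and the other external heads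
do not move at all. -/
def WStep (I : Set (Fin t)) (γ γ' : M.Config) : Prop :=
  γ' ∈ M.next γ ∧ (∀ i ∈ I, extPos γ i ≤ extPos γ' i) ∧ ∀ i ∉ I, extPos γ' i = extPos γ i

/-- The configurations cannot be distinguished by steps of the kind `WStep I`. -/
structure Sim (I : Set (Fin t)) (γ δ : M.Config) : Prop where
  state : δ.state = γ.state
  pos : ∀ j, δ.pos (Sum.inr j) = γ.pos (Sum.inr j)
  mem : ∀ j, δ.tape (Sum.inr j) = γ.tape (Sum.inr j)
  sym : ∀ i, δ.tape (Sum.inl i) (extPos δ i) = γ.tape (Sum.inl i) (extPos γ i)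
  blank : ∀ i ∈ I, ∀ p, extPos γ i < p → γ.tape (Sum.inl i) p = M.blank
  blank' : ∀ i ∈ I, ∀ p, extPos δ i < p → δ.tape (Sum.inl i) p = M.blank

/-- The same transition applies to both. Afterwards an external head that did not move reads the
symbol just written, and a head that moved is in `I` and reads a blank. -/
theorem Sim.step {I : Set (Fin t)} {γ γ' δ : M.Config} (h : Sim I γ δ) (hs : WStep I γ γ') :
    ∃ δ', WStep I δ δ' ∧ Sim I γ' δ' := by
  obtain ⟨hn, h1, h2⟩ := hs
  rw [next_eq] at hn
  obtain ⟨τ, ⟨t1, t2, t3, t4⟩, rfl⟩ := hn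
  beta_reduce at h1 h2 ⊢
  have hmv : ∀ i, 0 ≤ (τ.2.2.2.2 (Sum.inl i) : ℤ) ∧ (i ∉ I → (τ.2.2.2.2 (Sum.inl i) : ℤ) = 0) := by
    intro i
    have h3 := h1 i
    have h4 := h2 i
    have h5 := t4 (Sum.inl i)
    simp only [extPos, move] at h3 h4
    by_cases hi : i ∈ I
    · exact ⟨by have := h3 hi; omega, fun h => absurd hi h⟩
    · have := h4 hi
      exact ⟨by omega, fun _ => by omega⟩
  have happ : τ ∈ app δ := by
    refine ⟨t1, t2.trans h.state.symm, ?_, ?_⟩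
    · rintro (i | j)
      · rw [t3]; exact (h.sym i).symm
      · rw [t3, h.mem, h.pos]
    · rintro (i | j)
      · have := (hmv i).1
        positivity
      · rw [h.pos]; exact t4 _
  have hpos : ∀ (η : M.Config) i,
      (extPos (move τ η) i : ℤ) = extPos η i + τ.2.2.2.2 (Sum.inl i) := by
    intro η i
    have := (hmv i).1
    simp only [extPos, move]
    omega
  have hle : ∀ (η : M.Config) i, extPos η i ≤ extPos (move τ η) i := fun η i => by
    have := hpos η i
    have := (hmv i).1
    omega
  have hbl : ∀ (η : M.Config) i p, (∀ p, extPos η i < p → η.tape (Sum.inl i) p = M.blank) →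
      extPos η i < p → (move τ η).tape (Sum.inl i) p = M.blank := by
    intro η i p hb hp
    simp only [move]
    rw [Function.update_of_ne (by simp only [extPos] at hp; omega)]
    exact hb p hp
  refine ⟨move τ δ, ⟨?_, fun i _ => hle δ i, fun i hi => ?_⟩, ?_⟩
  · rw [next_eq]; exact ⟨τ, happ, rfl⟩
  · have := hpos δ i
    have := (hmv i).2 hi
    omega
  · refine ⟨rfl, ?_, ?_, ?_, ?_, ?_⟩
    · intro j; simp only [move, h.pos]
    · intro j; simp only [move, h.pos, h.mem]
    · intro i
      by_cases h0 : (τ.2.2.2.2 (Sum.inl i) : ℤ) = 0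
      · have e1 : extPos (move τ δ) i = δ.pos (Sum.inl i) := by
          have := hpos δ i
          simp only [extPos] at this ⊢
          omega
        have e2 : extPos (move τ γ) i = γ.pos (Sum.inl i) := by
          have := hpos γ i
          simp only [extPos] at this ⊢
          omega
        rw [e1, e2]
        simp only [move, Function.update_self]
      · have hi : i ∈ I := by
          by_contra hi
          exact h0 ((hmv i).2 hi)
        have := (hmv i).1
        rw [hbl δ i _ (h.blank' i hi) (by have := hpos δ i; omega),
          hbl γ i _ (h.blank i hi) (by have := hpos γ i; omega)]
    · intro i hi p hp
      exact hbl γ i p (h.blank i hi) ((hle γ i).trans_lt hp)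
    · intro i hi p hp
      exact hbl δ i p (h.blank' i hi) ((hle δ i).trans_lt hp)

/-- If `γ` leads to an indistinguishable `δ`, the first step of the path can be repeated at `δ`. The
property passes on to the successor of `γ`, and so on forever. -/
theorem Resources.not_sim (hM : Resources M R S w) {I : Set (Fin t)} {γ δ : M.Config}
    (hγ : Reach w γ) (h : Relation.TransGen (WStep I) γ δ) : ¬ Sim I γ δ := by
  intro hs
  refine hM.finite (exists_infiniteRun hγ
    (fun γ => ∃ δ, Relation.TransGen (WStep I) γ δ ∧ Sim I γ δ) ⟨δ, h, hs⟩ ?_)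
  rintro γ ⟨δ, h1, h2⟩
  obtain ⟨γ', h3, h4⟩ := Relation.TransGen.head'_iff.1 h1
  obtain ⟨δ', h5, h6⟩ := h2.step h3
  exact ⟨γ', h3.1, δ', Relation.TransGen.tail' h4 h5, h6⟩

/-- A bound for the running time up to the end of the given phase. -/
def timeBound (t N K : ℕ) : ℕ → ℕ
  | 0 => (t * (N + 1) + 1) * K
  | h + 1 => timeBound t N K h + (t * (N + timeBound t N K h + 1) + 1) * K

/-- With `N + 1` added, one phase multiplies the bound by at most `1 + (t + 1) * K`. -/
theorem timeBound_le (t N K h : ℕ) :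
    timeBound t N K h + N + 1 ≤ (N + 1) * (1 + (t + 1) * K) ^ (h + 1) := by
  induction h with
  | zero => rw [timeBound, zero_add, pow_one]; nlinarith [Nat.zero_le (N * K), Nat.zero_le K]
  | succ h ih =>
    rw [pow_succ, ← mul_assoc]
    refine le_trans ?_ (Nat.mul_le_mul_right _ ih)
    rw [timeBound]
    generalize timeBound t N K h = x
    nlinarith [Nat.zero_le (N * K), Nat.zero_le (x * K)]

theorem timeBound_mono (t N K : ℕ) : Monotone (timeBound t N K) :=
  monotone_nat_of_le_succ fun h => by rw [timeBound]; exact Nat.le_add_right _ _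

namespace Aug

variable {b : Book t}

/-- `g 0, …, g n` is a path of augmented configurations that starts with the initial one. -/
structure IsPath (b : Book t) (w : List Letter) (g : ℕ → M.Aug) (n : ℕ) : Prop where
  zero : g 0 = init M w
  step : ∀ i < n, (g i).Step b (g (i + 1))

theorem IsPath.reach {g : ℕ → M.Aug} {n i : ℕ} (h : IsPath b w g n) (hi : i ≤ n) :
    Relation.ReflTransGen (Step b) (init M w) (g i) := by
  induction i with
  | zero => rw [h.zero]
  | succ i ih => exact (ih (by omega)).tail (h.step i (by omega))

theorem IsPath.next {g : ℕ → M.Aug} {n i : ℕ} (h : IsPath b w g n) (hi : i < n) :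
    (g (i + 1)).conf ∈ M.next (g i).conf := by
  obtain ⟨γ, hγ, h1⟩ := h.step i hi
  rwa [h1, conf_step]

theorem IsPath.pos_le {g : ℕ → M.Aug} {n i : ℕ} (h : IsPath b w g n) (hi : i ≤ n) (k : Tape t u) :
    (g i).conf.pos k ≤ i := by
  induction i with
  | zero => rw [h.zero]; exact le_rfl
  | succ i ih =>
    have := ih (by omega)
    have := pos_le_of_mem_next (h.next (i := i) (by omega)) k
    omega

theorem IsPath.blank {g : ℕ → M.Aug} {n i : ℕ} (h : IsPath b w g n) (hi : i ≤ n) (k : Fin t)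
    {p : ℕ} (hp : w.length + i ≤ p) : (g i).conf.tape (Sum.inl k) p = M.blank := by
  induction i with
  | zero =>
    rw [h.zero]
    simp only [init, NTM.init, Sum.elim_inl, inscription]
    split_ifs
    · rw [List.getElem?_eq_none (by omega)]; rfl
    · simp
  | succ i ih =>
    have := h.pos_le (i := i) (by omega) (Sum.inl k)
    rw [tape_eq_of_mem_next (h.next (i := i) (by omega)) _ (by omega)]
    exact ih (by omega) (by omega)

theorem exists_isPath {A : M.Aug} (h : Relation.ReflTransGen (Step b) (init M w) A) :
    ∃ g n, IsPath b w g n ∧ g n = A := by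
  induction h with
  | refl => exact ⟨fun _ => init M w, 0, ⟨rfl, fun i hi => absurd hi (Nat.not_lt_zero i)⟩, rfl⟩
  | @tail A A' _ h1 ih =>
    obtain ⟨g, n, h2, rfl⟩ := ih
    refine ⟨Function.update g (n + 1) A', n + 1, ⟨?_, fun i hi => ?_⟩, Function.update_self ..⟩
    · rw [Function.update_of_ne (by omega), h2.zero]
    · rw [Function.update_of_ne (by omega : i ≠ n + 1)]
      rcases Nat.lt_succ_iff_lt_or_eq.1 hi with hi | rfl
      · rw [Function.update_of_ne (by omega)]
        exact h2.step i hi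
      · rwa [Function.update_self]

/-- Measure each external head by its progress, truncated at `ℓ`. In a phase the total progress is
nondecreasing and at most `t * ℓ`, so a long phase contains two times with equal progress and equal
core. In between, heads move only to the right in fresh blank cells, and `Resources.not_sim` forbids
that. -/
theorem IsPath.lt_of_phase_eq (hM : Resources M R S w) {g : ℕ → M.Aug} {n a c : ℕ}
    (h : IsPath b w g n) (hac : a ≤ c) (hc : c ≤ n)
    (hph : ∀ i, a ≤ i → i ≤ c → ((g i).book b).phase = ((g a).book b).phase) :
    c < a + (t * (w.length + a + 1) + 1) * Nat.card (M.Core S) := by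
  classical
  by_contra! hlt
  set ℓ := w.length + a + 1 with hℓ
  set dir := ((g a).book b).dir with hdir
  have hstep : ∀ i, a ≤ i → i < c → ((g (i + 1)).book b).dir = ((g i).book b).dir ∧
      ∀ j, DirLE (((g i).book b).dir j) (extPos (g i).conf j) (extPos (g (i + 1)).conf j) := by
    intro i h1 h2
    rcases (h.step i (by omega)).phase with h3 | h3
    · exact h3.2
    · rw [hph i h1 h2.le, hph (i + 1) (by omega) h2] at h3
      omega
  have hd : ∀ i, a ≤ i → i ≤ c → ((g i).book b).dir = dir := by
    intro i h1
    induction i, h1 using Nat.le_induction with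
    | base => exact fun _ => rfl
    | succ i h1 ih => exact fun h2 => (hstep i h1 (by omega)).1.trans (ih (by omega))
  have hle : ∀ i, a ≤ i → i < c →
      ∀ j, DirLE (dir j) (extPos (g i).conf j) (extPos (g (i + 1)).conf j) := fun i h1 h2 j => by
    rw [← hd i h1 h2.le]; exact (hstep i h1 h2).2 j
  have hmono : ∀ i i', a ≤ i → i ≤ i' → i' ≤ c →
      ∀ j, DirLE (dir j) (extPos (g i).conf j) (extPos (g i').conf j) := by
    intro i i' h1 h2
    induction i', h2 using Nat.le_induction with
    | base => exact fun _ j => DirLE.refl _ _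
    | succ i' h2 ih =>
      exact fun h3 j => (ih (by omega) j).trans (hle i' (by omega) (by omega) j)
  have hposa : ∀ j, extPos (g a).conf j < ℓ := fun j => by
    have := h.pos_le (i := a) (by omega) (Sum.inl j)
    simp only [extPos]
    omega
  have hblank : ∀ i, a ≤ i → i ≤ c → ∀ j, dir j = true → ∀ p, ℓ ≤ p → extPos (g i).conf j < p →
      (g i).conf.tape (Sum.inl j) p = M.blank := by
    intro i h1
    induction i, h1 using Nat.le_induction with
    | base => exact fun _ j _ p hp _ => h.blank (by omega) j (by omega)
    | succ i h1 ih =>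
      intro h2 j hj p hp hpp
      have h3 := hle i h1 h2 j
      rw [hj] at h3
      simp only [DirLE, if_true] at h3
      have h4 : p ≠ (g i).conf.pos (Sum.inl j) := by
        simp only [extPos] at h3 hpp
        omega
      rw [tape_eq_of_mem_next (h.next (by omega)) _ h4]
      exact ih (by omega) j hj p hp (h3.trans_lt hpp)
  -- Heads going left start below `ℓ`, so `ℓ - pos` is exact for them; heads going right may pass
  -- `ℓ`, and truncation bounds their progress.
  let o : ℕ → Fin t → ℕ := fun i j =>
    if dir j then min (extPos (g i).conf j) ℓ else ℓ - extPos (g i).conf j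
  have ho : ∀ i i', a ≤ i → i ≤ i' → i' ≤ c → ∀ j, o i j ≤ o i' j := by
    intro i i' h1 h2 h3 j
    have h4 := hmono i i' h1 h2 h3 j
    simp only [o]
    cases hj : dir j <;> simp only [hj, DirLE, Bool.false_eq_true, if_false, if_true] at h4 ⊢ <;>
      omega
  have hoℓ : ∀ i j, o i j ≤ ℓ := by
    intro i j
    simp only [o]
    split_ifs <;> omega
  have : Fintype (M.Core S) := Fintype.ofFinite _
  obtain ⟨i, hi, i', hi', hne, heq⟩ := Finset.exists_ne_map_eq_of_card_lt_of_maps_to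
    (s := Finset.Icc a c) (t := Finset.range (t * ℓ + 1) ×ˢ (Finset.univ : Finset (M.Core S)))
    (f := fun i => (∑ j, o i j, core S (g i).conf))
    (by
      rw [Finset.card_product, Finset.card_range, Finset.card_univ, ← Nat.card_eq_fintype_card,
        Nat.card_Icc]
      omega)
    (fun i _ => by
      rw [Finset.coe_product]
      refine ⟨?_, Finset.mem_coe.2 (Finset.mem_univ _)⟩
      rw [Finset.mem_coe, Finset.mem_range, Nat.lt_succ_iff]
      change ∑ j, o i j ≤ t * ℓ
      refine (Finset.sum_le_card_nsmul _ _ ℓ fun j _ => hoℓ i j).trans ?_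
      simp)
  wlog hlt' : i < i' generalizing i i'
  · exact this i' hi' i hi hne.symm heq.symm (by omega)
  rw [Finset.mem_Icc] at hi hi'
  simp only [Prod.mk.injEq] at heq
  have hoeq : ∀ j, o i j = o i' j := by
    have := (Finset.sum_eq_sum_iff_of_le fun j (_ : j ∈ Finset.univ) =>
      ho i i' hi.1 hlt'.le hi'.2 j).1 heq.1
    exact fun j => this j (Finset.mem_univ j)
  have hoeq' : ∀ k, i ≤ k → k ≤ i' → ∀ j, o k j = o i j := fun k h1 h2 j =>
    le_antisymm ((ho k i' (by omega) h2 hi'.2 j).trans (hoeq j).ge) (ho i k hi.1 h1 (by omega) j)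
  -- Constant progress determines the position of every head outside `I`, so only heads in `I` can
  -- move.
  let I : Set (Fin t) := {j | dir j = true ∧ ℓ ≤ extPos (g i).conf j}
  have hW : ∀ k, i ≤ k → k < i' → WStep I (g k).conf (g (k + 1)).conf := by
    intro k h1 h2
    refine ⟨h.next (by omega), fun j hj => ?_, fun j hj => ?_⟩
    · have := hle k (by omega) (by omega) j
      rw [hj.1] at this
      exact this
    · have h3 := hoeq' k h1 h2.le j
      have h4 := hoeq' (k + 1) (by omega) h2 j
      have h5 := hmono a k le_rfl (by omega) (by omega) j
      have h6 := hmono a (k + 1) le_rfl (by omega) (by omega) j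
      have h7 := hposa j
      have h8 := hmono a i le_rfl (by omega) (by omega) j
      simp only [o] at h3 h4
      cases hj' : dir j
      · simp only [hj', DirLE, Bool.false_eq_true, if_false] at h3 h4 h5 h6 h8
        omega
      · have h9 : extPos (g i).conf j < ℓ := by
          by_contra h9
          exact hj ⟨hj', by omega⟩
        simp only [hj', if_true] at h3 h4
        omega
  have hT : ∀ k, i < k → k ≤ i' → Relation.TransGen (WStep I) (g i).conf (g k).conf := by
    intro k h1
    induction k, h1 using Nat.le_induction with
    | base => exact fun h2 => Relation.TransGen.single (hW i le_rfl h2)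
    | succ k h1 ih =>
      exact fun h2 => (ih (by omega)).tail (hW k (by omega) (by omega))
  have hr : ∀ k, k ≤ n → Reach w (g k).conf := fun k hk => reach_of_reflTransGen (h.reach hk)
  obtain ⟨e1, e2, e3, e4⟩ := hM.core_inj hM (hr i (by omega)) (hr i' (by omega)) heq.2
  refine hM.not_sim (hr i (by omega)) (hT i' hlt' le_rfl)
    ⟨e1.symm, fun j => (e2 j).symm, fun j => (e3 j).symm, fun j => (e4 j).symm, ?_, ?_⟩
  · exact fun j hj p hp => hblank i hi.1 (by omega) j hj.1 p (by have := hj.2; omega) hp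
  · intro j hj p hp
    have h1 := hmono i i' hi.1 hlt'.le hi'.2 j
    rw [hj.1] at h1
    simp only [DirLE, if_true] at h1
    exact hblank i' (by omega) hi'.2 j hj.1 p (by have := hj.2; omega) hp

theorem IsPath.lt_timeBound (hM : Resources M R S w) {g : ℕ → M.Aug} {n : ℕ}
    (h : IsPath b w g n) (h0 : b.phase = 0) :
    ∀ i ≤ n, i < timeBound t w.length (Nat.card (M.Core S)) ((g i).book b).phase := by
  classical
  intro i
  induction i using Nat.strong_induction_on with
  | _ i ih =>
    intro hi
    -- The least such `a` is the beginning of the phase; the step before belongs to the preceding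
    -- phase and is bounded by induction.
    have hex : ∃ a, a ≤ i ∧ ((g a).book b).phase = ((g i).book b).phase := ⟨i, le_rfl, rfl⟩
    obtain ⟨ha1, ha2⟩ := Nat.find_spec hex
    set a := Nat.find hex with ha
    clear_value a
    have hmono : ∀ k k', k ≤ k' → k' ≤ n → ((g k).book b).phase ≤ ((g k').book b).phase := by
      intro k k' h1
      induction k', h1 using Nat.le_induction with
      | base => exact fun _ => le_rfl
      | succ k' h1 ih =>
        intro h2
        refine (ih (by omega)).trans ?_
        rcases (h.step k' (by omega)).phase with h | h <;> omega
    have key := h.lt_of_phase_eq hM ha1 hi fun k h1 h2 =>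
      le_antisymm ((hmono k i h2 hi).trans ha2.ge) (hmono a k h1 (by omega))
    rcases Nat.eq_zero_or_pos a with h1 | h1
    · rw [h1] at ha2 key
      have : ((g 0).book b).phase = 0 := by rw [h.zero]; exact h0
      rw [← ha2, this]
      simpa [timeBound] using key
    · obtain ⟨a', rfl⟩ : ∃ a', a = a' + 1 := ⟨a - 1, by omega⟩
      have h2 : ((g a').book b).phase ≠ ((g i).book b).phase := fun h =>
        Nat.find_min hex (by omega : a' < Nat.find hex) ⟨by omega, h⟩
      have h3 := hmono a' i (by omega) hi
      have h4 : ((g (a' + 1)).book b).phase = ((g a').book b).phase + 1 := by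
        rcases (h.step a' (by omega)).phase with h | h <;> omega
      rw [← ha2, h4, timeBound]
      have h5 := ih a' (by omega) (by omega)
      generalize timeBound t w.length (Nat.card (M.Core S)) ((g a').book b).phase = T at *
      have h6 : (t * (w.length + (a' + 1) + 1) + 1) * Nat.card (M.Core S) ≤
          (t * (w.length + T + 1) + 1) * Nat.card (M.Core S) :=
        Nat.mul_le_mul_right _ (Nat.add_le_add_right (Nat.mul_le_mul_left _ (by omega)) _)
      omega

variable (M) in
/-- A bound for the running time. -/
noncomputable def runBound (R S N : ℕ) : ℕ :=
  (N + 1) * (1 + (t + 1) * Nat.card (M.Core S)) ^ R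

theorem IsPath.lt_runBound (hM : Resources M R S w) {g : ℕ → M.Aug} {n l c : ℕ}
    (h : IsPath (Book.initial t l c) w g n) : n < runBound M R S w.length := by
  have h1 := h.lt_timeBound hM rfl n le_rfl
  have h2 := phase_lt hM (h.reach le_rfl)
  have h3 : timeBound t w.length (Nat.card (M.Core S)) ((g n).book (Book.initial t l c)).phase ≤
    timeBound t w.length (Nat.card (M.Core S)) (R - 1) := timeBound_mono _ _ _ (by omega)
  have h4 := timeBound_le t w.length (Nat.card (M.Core S)) (R - 1)
  rw [show R - 1 + 1 = R by omega] at h4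
  rw [runBound]
  omega

theorem extPos_lt_runBound (hM : Resources M R S w) {A : M.Aug} {l c : ℕ}
    (h : Relation.ReflTransGen (Step (Book.initial t l c)) (init M w) A) (k : Tape t u) :
    A.conf.pos k < runBound M R S w.length := by
  obtain ⟨g, n, h1, rfl⟩ := exists_isPath h
  exact (h1.pos_le le_rfl k).trans_lt (h1.lt_runBound hM)

theorem exists_isPath_of_isChain {A : M.Aug} {ρ : List M.Config} {g : ℕ → M.Aug} {n : ℕ}
    (hg : IsPath b w g n) (hA : g n = A)
    (h : (A.conf :: ρ).IsChain fun γ γ' => γ' ∈ M.next γ) :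
    ∃ g' : ℕ → M.Aug, IsPath b w g' (n + ρ.length) := by
  induction ρ generalizing A g n with
  | nil => exact ⟨g, hg⟩
  | cons γ ρ ih =>
    obtain ⟨h1, h2⟩ := List.isChain_cons_cons.1 h
    have hp : IsPath b w (Function.update g (n + 1) (A.step b γ)) (n + 1) := by
      refine ⟨?_, fun i hi => ?_⟩
      · rw [Function.update_of_ne (by omega), hg.zero]
      · rw [Function.update_of_ne (by omega : i ≠ n + 1)]
        rcases Nat.lt_succ_iff_lt_or_eq.1 hi with hi | rfl
        · rw [Function.update_of_ne (by omega)]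
          exact hg.step i hi
        · rw [Function.update_self, hA]
          exact ⟨γ, h1, rfl⟩
    obtain ⟨g', hg'⟩ := ih hp (Function.update_self ..) (by rwa [conf_step])
    exact ⟨g', by rwa [List.length_cons, ← add_assoc, add_right_comm]⟩

theorem length_le_runBound (hM : Resources M R S w) {ρ : List M.Config} (h : M.IsRun w ρ) :
    ρ.length ≤ runBound M R S w.length := by
  obtain ⟨h1, h2, -⟩ := h
  cases ρ with
  | nil => exact Nat.zero_le _
  | cons γ ρ =>
    obtain rfl : γ = M.init w := by simpa using h1
    -- Labels play no role for the running time, so trivial initial labels will do.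
    obtain ⟨g, hg⟩ := exists_isPath_of_isChain (b := Book.initial t 0 0) (w := w)
      (g := fun _ => init M w) (n := 0) ⟨rfl, fun i hi => absurd hi (Nat.not_lt_zero i)⟩ rfl h2
    have := hg.lt_runBound hM
    simp only [List.length_cons]
    omega

end Aug

end NTM

end ExtMem

namespace ExtMem

namespace NTM

variable {t u : ℕ} {M : NTM t u}

/-! ### Fixing the random choices -/

/-- `ρ` is an accepting run that starts in `γ` and has at most `n` configurations. -/
def AccFrom (γ : M.Config) (n : ℕ) (ρ : List M.Config) : Prop :=
  (ρ.head? = some γ ∧ ρ.IsChain (fun γ γ' => γ' ∈ M.next γ) ∧ ∀ γ' ∈ ρ.getLast?, M.next γ' = ∅) ∧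
    (∃ γ' ∈ ρ.getLast?, γ'.state ∈ M.accept) ∧ ρ.length ≤ n

theorem runProb_cons_cons (γ γ' : M.Config) (ρ : List M.Config) :
    M.runProb (γ :: γ' :: ρ) = ((M.next γ).ncard : ℝ≥0∞)⁻¹ * M.runProb (γ' :: ρ) := by
  simp [runProb, List.dropLast]

theorem accFrom_cons {γ γ' : M.Config} {n : ℕ} {ρ : List M.Config} :
    AccFrom γ (n + 1) (γ :: γ' :: ρ) ↔ γ' ∈ M.next γ ∧ AccFrom γ' n (γ' :: ρ) := by
  simp only [AccFrom, List.head?_cons, List.isChain_cons_cons, List.getLast?_cons_cons,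
    List.length_cons, true_and]
  constructor
  · rintro ⟨⟨⟨h1, h2⟩, h3⟩, h4, h5⟩
    exact ⟨h1, ⟨h2, h3⟩, h4, by omega⟩
  · rintro ⟨h1, ⟨h2, h3⟩, h4, h5⟩
    exact ⟨⟨⟨h1, h2⟩, h3⟩, h4, by omega⟩

/-- Split off the first step: as `γ` has a successor, a complete run from `γ` continues with a run
from one. -/
theorem tsum_accFrom_le (γ : M.Config) (n : ℕ) (h : (M.next γ).Nonempty) :
    ∑' ρ : {ρ // AccFrom γ (n + 1) ρ}, M.runProb ρ.1 ≤ ((M.next γ).ncard : ℝ≥0∞)⁻¹ *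
      ∑ᶠ γ' ∈ M.next γ, ∑' ρ : {ρ // AccFrom γ' n ρ}, M.runProb ρ.1 := by
  have : Fintype (M.next γ) := (finite_next γ).fintype
  let φ : (Σ γ' : M.next γ, {ρ // AccFrom γ'.1 n ρ}) → {ρ // AccFrom γ (n + 1) ρ} := fun x =>
    ⟨γ :: x.2.1, by
      obtain ⟨⟨γ', h1⟩, ⟨ρ, h2⟩⟩ := x
      obtain ⟨γ'', ρ, rfl⟩ : ∃ γ'' ρ', ρ = γ'' :: ρ' := by
        cases ρ with
        | nil => cases h2.1.1
        | cons a l => exact ⟨a, l, rfl⟩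
      obtain rfl : γ'' = γ' := by simpa using h2.1.1
      exact accFrom_cons.2 ⟨h1, h2⟩⟩
  have hφ : Function.Surjective φ := by
    rintro ⟨ρ, hρ⟩
    cases ρ with
    | nil => cases hρ.1.1
    | cons a ρ =>
      obtain rfl : a = γ := by simpa using hρ.1.1
      cases ρ with
      | nil =>
        have := hρ.1.2.2 a (by simp)
        exact absurd this h.ne_empty
      | cons γ' ρ =>
        obtain ⟨h1, h2⟩ := accFrom_cons.1 hρ
        exact ⟨⟨⟨γ', h1⟩, ⟨_, h2⟩⟩, rfl⟩
  refine (ENNReal.tsum_le_tsum_comp_of_surjective hφ fun ρ => M.runProb ρ.1).trans ?_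
  have h1 : ∀ x, M.runProb (φ x).1 = ((M.next γ).ncard : ℝ≥0∞)⁻¹ * M.runProb x.2.1 := by
    rintro ⟨⟨γ', h1⟩, ⟨ρ, h2⟩⟩
    cases ρ with
    | nil => cases h2.1.1
    | cons a l => exact runProb_cons_cons γ a l
  simp only [h1]
  rw [ENNReal.tsum_mul_left, ENNReal.tsum_sigma', tsum_fintype, ← finsum_set_coe_eq_finsum_mem,
    finsum_eq_sum_of_fintype]

/-- Extends a choice function that is defined for blocks and steps with numbers below `a`. -/
noncomputable def extend {a : ℕ} (f : Fin a × Fin a → Fin M.choices) (k c : ℕ) : Fin M.choices :=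
  if h : k < a ∧ c < a then f (⟨k, h.1⟩, ⟨c, h.2⟩) else 0

/-- Resampling one coordinate preserves the uniform distribution: exchanging the value `f x` with
the fresh value `c` is an involution. -/
theorem sum_sum_update {X Y : Type} [Fintype X] [DecidableEq X] [Fintype Y]
    (x : X) (I : (X → Y) → ℝ≥0∞) :
    ∑ c : Y, ∑ f : X → Y, I (Function.update f x c) = Fintype.card Y * ∑ f, I f := by
  let e : (X → Y) × Y → (X → Y) × Y := fun p => (Function.update p.1 x p.2, p.1 x)
  have he : Function.Involutive e := by
    rintro ⟨f, c⟩
    simp [e]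
  rw [Finset.sum_comm, ← Fintype.sum_prod_type' (f := fun f c => I (Function.update f x c))]
  have h1 := Equiv.sum_comp (Function.Involutive.toPerm e he) fun p : (X → Y) × Y => I p.1
  have h2 : ∀ p : (X → Y) × Y, I ((Function.Involutive.toPerm e he) p).1 = I (Function.update p.1 x p.2) := fun p => rfl
  simp only [h2] at h1
  rw [h1, Fintype.sum_prod_type]
  simp only [Finset.sum_const, Finset.card_univ, nsmul_eq_mul]
  rw [Finset.mul_sum]

namespace Aug

variable {b : Book t}

/-- A choice whose index lies in the past is never consulted again. -/
theorem Acc.congr {f g : ℕ → ℕ → Fin M.choices} {k c : ℕ}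
    (hfg : ∀ k' c', (k', c') ≠ (k, c) → f k' c' = g k' c') {A : M.Aug}
    (hA : k < A.log.length ∨ k = A.log.length ∧ c < A.clock) (h : Acc b f A) : Acc b g A := by
  obtain ⟨F, h1, h2, h3⟩ := h
  refine ⟨F, ?_, h2, h3⟩
  induction h1 using Relation.ReflTransGen.head_induction_on with
  | refl => exact Relation.ReflTransGen.refl
  | @head A A₁ h4 _ ih =>
    have h5 : A.DStep b g A₁ := by
      refine ⟨h4.1, ?_⟩
      rw [← hfg A.log.length A.clock]
      · exact h4.2
      · simp only [ne_eq, Prod.mk.injEq]; omega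
    refine Relation.ReflTransGen.head h5 (ih ?_)
    rcases h5.step.log with h6 | ⟨⟨e, h6⟩, h7⟩
    · rw [h6.1, h6.2]; omega
    · rw [h6, List.length_cons]; omega

theorem acc_iff_of_nonempty {f : ℕ → ℕ → Fin M.choices} {A : M.Aug}
    (h : (app A.conf).Nonempty) : Acc b f A ↔
      Acc b f (A.step b (move (pick (app A.conf) (f A.log.length A.clock)) A.conf)) := by
  constructor
  · rintro ⟨F, h1, h2, h3⟩
    rcases Relation.ReflTransGen.cases_head h1 with rfl | ⟨A₁, h4, h5⟩
    · exact absurd h2 h.ne_empty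
    · exact ⟨F, h4.2 ▸ h5, h2, h3⟩
  · rintro ⟨F, h1, h2, h3⟩
    exact ⟨F, Relation.ReflTransGen.head ⟨h, rfl⟩ h1, h2, h3⟩

theorem acc_update_iff {a : ℕ} (f : Fin a × Fin a → Fin M.choices) (c : Fin M.choices) {A : M.Aug}
    (hk : A.log.length < a) (hc : A.clock < a) (h : (app A.conf).Nonempty) :
    Acc b (extend (Function.update f (⟨_, hk⟩, ⟨_, hc⟩) c)) A ↔
      Acc b (extend f) (A.step b (move (pick (app A.conf) c) A.conf)) := by
  have h1 : extend (Function.update f (⟨_, hk⟩, ⟨_, hc⟩) c) A.log.length A.clock = c := by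
    rw [extend, dif_pos ⟨hk, hc⟩, Function.update_self]
  rw [acc_iff_of_nonempty h, h1]
  have h2 : ∀ k' c', (k', c') ≠ (A.log.length, A.clock) →
      extend (Function.update f (⟨_, hk⟩, ⟨_, hc⟩) c) k' c' = extend f k' c' := by
    intro k' c' hne
    simp only [extend]
    split_ifs with hh
    · rw [Function.update_of_ne]
      intro heq
      simp only [Prod.mk.injEq, Fin.mk.injEq] at heq
      exact hne (Prod.ext heq.1 heq.2)
    · rfl
  have h3 : A.Step b (A.step b (move (pick (app A.conf) c) A.conf)) :=
    ⟨_, by rw [next_eq]; exact Set.mem_image_of_mem _ (pick_mem h c), rfl⟩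
  have h4 : A.log.length < (A.step b (move (pick (app A.conf) c) A.conf)).log.length ∨
      A.log.length = (A.step b (move (pick (app A.conf) c) A.conf)).log.length ∧
      A.clock < (A.step b (move (pick (app A.conf) c) A.conf)).clock := by
    rcases h3.log with h | ⟨⟨e, h⟩, -⟩
    · rw [h.1, h.2]; omega
    · rw [h, List.length_cons]; omega
  exact ⟨fun h => h.congr h2 h4, fun h => h.congr (fun k' c' hne => (h2 k' c' hne).symm) h4⟩

open scoped Classical in
/-- The number of choice functions that lead to acceptance. -/
noncomputable def accCount (b : Book t) (a : ℕ) (A : M.Aug) : ℝ≥0∞ :=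
  ∑ f : Fin a × Fin a → Fin M.choices, if Acc b (extend f) A then 1 else 0

/-- Resample the choice for the present step. It selects a uniform successor and is independent of
everything that happens later. -/
theorem accCount_eq {a : ℕ} {A : M.Aug} (hk : A.log.length < a) (hc : A.clock < a)
    (h : (app A.conf).Nonempty) : ((M.next A.conf).ncard : ℝ≥0∞) * accCount b a A =
      ∑ᶠ γ ∈ M.next A.conf, accCount b a (A.step b γ) := by
  classical
  have h1 := sum_sum_update ((⟨_, hk⟩, ⟨_, hc⟩) : Fin a × Fin a)
    fun f : Fin a × Fin a → Fin M.choices => if Acc b (extend f) A then (1 : ℝ≥0∞) else 0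
  simp only [acc_update_iff _ _ hk hc h] at h1
  have h2 := sum_pick h fun τ => accCount b a (A.step b (move τ A.conf))
  have h3 : ∑ c, accCount b a (A.step b (move (pick (app A.conf) c) A.conf)) =
      M.choices * accCount b a A := by
    rw [Fintype.card_fin] at h1
    exact h1
  rw [h3] at h2
  have h4 : ∑ᶠ γ ∈ M.next A.conf, accCount b a (A.step b γ) =
      ∑ᶠ τ ∈ app A.conf, accCount b a (A.step b (move τ A.conf)) := by
    rw [next_eq, finsum_mem_image (move_injOn _)]
  rw [h4, ncard_next]
  rw [mul_left_comm] at h2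
  exact (ENNReal.mul_right_inj (by exact_mod_cast M.choices_pos.ne')
    (ENNReal.natCast_ne_top _)).1 h2

/-- Both sides obey the same recursion over the first step. The bounds on block number and clock
keep the next `n` steps inside the table of choices. -/
theorem tsum_mul_card_le {a : ℕ} (n : ℕ) (A : M.Aug) (hk : A.log.length + n ≤ a)
    (hc : A.clock + n ≤ a) :
    (∑' ρ : {ρ // AccFrom A.conf n ρ}, M.runProb ρ.1) *
      Fintype.card (Fin a × Fin a → Fin M.choices) ≤ accCount b a A := by
  classical
  induction n generalizing A with
  | zero =>
    have : IsEmpty {ρ // AccFrom A.conf 0 ρ} := by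
      refine ⟨fun ρ => ?_⟩
      obtain ⟨ρ, ⟨h, -⟩, -, h'⟩ := ρ
      obtain rfl := List.length_eq_zero_iff.1 (Nat.le_zero.1 h')
      cases h
    rw [tsum_empty, zero_mul]
    exact zero_le
  | succ n ih =>
    rcases Set.eq_empty_or_nonempty (app A.conf) with he | hne
    · have h1 : ∀ ρ, AccFrom A.conf (n + 1) ρ → ρ = [A.conf] ∧ A.conf.state ∈ M.accept := by
        rintro ρ hρ
        have hne := (next_eq_empty_iff A.conf).2 he
        cases ρ with
        | nil => cases hρ.1.1
        | cons γ ρ =>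
          obtain rfl : γ = A.conf := by simpa using hρ.1.1
          cases ρ with
          | nil =>
            obtain ⟨γ', h2, h3⟩ := hρ.2.1
            obtain rfl : A.conf = γ' := by simpa using h2
            exact ⟨rfl, h3⟩
          | cons γ' ρ =>
            have := (accFrom_cons.1 hρ).1
            rw [hne] at this
            exact absurd this (Set.notMem_empty _)
      by_cases hacc : A.conf.state ∈ M.accept
      · have hsub : Subsingleton {ρ // AccFrom A.conf (n + 1) ρ} :=
          ⟨fun x y => Subtype.ext ((h1 _ x.2).1.trans (h1 _ y.2).1.symm)⟩
        have hle : ∑' ρ : {ρ // AccFrom A.conf (n + 1) ρ}, M.runProb ρ.1 ≤ 1 := by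
          rcases isEmpty_or_nonempty {ρ // AccFrom A.conf (n + 1) ρ} with hem | ⟨⟨ρ⟩⟩
          · rw [tsum_empty]; exact zero_le
          · rw [tsum_eq_single ρ fun ρ' hne => absurd (Subsingleton.elim ρ' ρ) hne,
              (h1 _ ρ.2).1]
            simp [runProb]
        have hall : ∀ f : Fin a × Fin a → Fin M.choices, Acc b (extend f) A := fun f =>
          ⟨A, Relation.ReflTransGen.refl, he, hacc⟩
        simp only [accCount, hall, if_true, Finset.sum_const, Finset.card_univ, nsmul_eq_mul,
          mul_one]
        exact mul_le_of_le_one_left' hle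
      · have : IsEmpty {ρ // AccFrom A.conf (n + 1) ρ} := ⟨fun ρ => hacc (h1 _ ρ.2).2⟩
        rw [tsum_empty, zero_mul]
        exact zero_le
    · have hnx : (M.next A.conf).Nonempty := by
        rw [next_eq]; exact hne.image _
      have hpos : (M.next A.conf).ncard ≠ 0 := ((Set.ncard_pos (finite_next _)).2 hnx).ne'
      refine (mul_le_mul_left (tsum_accFrom_le A.conf n hnx) _).trans ?_
      have h1 : (∑ᶠ γ' ∈ M.next A.conf, ∑' ρ : {ρ // AccFrom γ' n ρ}, M.runProb ρ.1) *
          Fintype.card (Fin a × Fin a → Fin M.choices) ≤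
          ∑ᶠ γ' ∈ M.next A.conf, accCount b a (A.step b γ') := by
        rw [finsum_mem_eq_finite_toFinset_sum _ (finite_next _),
          finsum_mem_eq_finite_toFinset_sum _ (finite_next _), Finset.sum_mul]
        refine Finset.sum_le_sum fun γ hγ => ?_
        rw [Set.Finite.mem_toFinset] at hγ
        have h2 : A.Step b (A.step b γ) := ⟨γ, hγ, rfl⟩
        have h3 := ih (A.step b γ) (by
          rcases h2.log with h | ⟨⟨e, h⟩, -⟩
          · rw [h.1]; omega
          · rw [h, List.length_cons]; omega) (by
          rcases h2.log with h | ⟨-, h⟩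
          · rw [h.2]; omega
          · rw [h]; omega)
        rwa [conf_step] at h3
      rw [← accCount_eq (by omega) (by omega) hne] at h1
      rw [mul_assoc]
      calc _ ≤ ((M.next A.conf).ncard : ℝ≥0∞)⁻¹ * ((M.next A.conf).ncard * accCount b a A) :=
            mul_le_mul_right h1 _
        _ = accCount b a A := by
          rw [← mul_assoc, ENNReal.inv_mul_cancel (by exact_mod_cast hpos)
            (ENNReal.natCast_ne_top _), one_mul]

theorem acceptProb_mul_card_le {w : List Letter} {a : ℕ}
    (h : ∀ ρ, M.IsRun w ρ → ρ.length ≤ a) :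
    M.acceptProb w * Fintype.card (Fin a × Fin a → Fin M.choices) ≤ accCount b a (init M w) := by
  refine le_trans (mul_le_mul_left ?_ _)
    (tsum_mul_card_le a (init M w) (by simp [init]) (by simp [init]))
  have hφ : Function.Injective fun ρ : {ρ // M.IsAcceptingRun w ρ} =>
      (⟨ρ.1, ρ.2.1, ρ.2.2, h _ ρ.2.1⟩ : {ρ // AccFrom (init M w).conf a ρ}) := by
    intro x y hxy
    exact Subtype.ext (Subtype.mk.inj hxy)
  exact ENNReal.tsum_comp_le_tsum_of_injective hφ fun ρ => M.runProb ρ.1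

open scoped Classical in
/-- If every input of a finite family is accepted with probability at least one half, then for some
choice function at least half of them are accepted. -/
theorem exists_choices {ι : Type} [Fintype ι] {w : ι → List Letter} {a : ℕ}
    (h : ∀ i ρ, M.IsRun (w i) ρ → ρ.length ≤ a) (hp : ∀ i, 2⁻¹ ≤ M.acceptProb (w i)) :
    ∃ f : ℕ → ℕ → Fin M.choices,
      Fintype.card ι ≤ 2 * (Finset.univ.filter fun i => Acc b f (init M (w i))).card := by
  by_contra! hlt
  let F := Fin a × Fin a → Fin M.choices
  have h1 : (Fintype.card ι : ℝ≥0∞) * (2⁻¹ * Fintype.card F) ≤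
      ∑ i, accCount b a (init M (w i)) := by
    rw [← nsmul_eq_mul, ← Finset.card_univ (α := ι)]
    refine Finset.card_nsmul_le_sum _ _ _ fun i _ => ?_
    exact (mul_le_mul_left (hp i) _).trans (acceptProb_mul_card_le (h i))
  have h2 : ∑ i, accCount b a (init M (w i)) =
      ((∑ f : F, (Finset.univ.filter fun i => Acc b (extend f) (init M (w i))).card : ℕ) :
        ℝ≥0∞) := by
    simp only [accCount]
    rw [Finset.sum_comm, Nat.cast_sum]
    refine Finset.sum_congr rfl fun f _ => ?_
    rw [Finset.card_filter]
    push_cast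
    rfl
  have hF : 0 < Fintype.card F := by
    have : Nonempty F := ⟨fun _ => 0⟩
    exact Fintype.card_pos
  have h3 : 2 * ∑ f : F, (Finset.univ.filter fun i => Acc b (extend f) (init M (w i))).card <
      Fintype.card ι * Fintype.card F := by
    rw [Finset.mul_sum, mul_comm (Fintype.card ι), ← smul_eq_mul, ← Finset.card_univ (α := F)]
    rw [← Finset.sum_const]
    refine Finset.sum_lt_sum_of_nonempty ?_ fun f _ => hlt (extend f)
    exact Finset.card_pos.1 hF
  have h4 : Fintype.card ι * Fintype.card F ≤
      2 * ∑ f : F, (Finset.univ.filter fun i => Acc b (extend f) (init M (w i))).card := by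
    rw [h2] at h1
    have h5 := mul_le_mul_right h1 2
    rw [mul_left_comm, ← mul_assoc 2, ENNReal.mul_inv_cancel (by norm_num) (by norm_num),
      one_mul] at h5
    exact_mod_cast h5
  omega

theorem Acc.acceptProb_ne_zero {w : List Letter} {f : ℕ → ℕ → Fin M.choices}
    (h : Acc b f (init M w)) : M.acceptProb w ≠ 0 := by
  obtain ⟨F, h1, h2, h3⟩ := h
  have h4 : Relation.ReflTransGen (fun γ γ' => γ' ∈ M.next γ) (M.init w) F.conf :=
    reach_of_reflTransGen (reflTransGen_step h1)
  obtain ⟨ρ, h5, h6⟩ := isChain_of_reflTransGen h4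
  have h7 : M.IsAcceptingRun w (M.init w :: ρ) := by
    refine ⟨⟨rfl, h5, ?_⟩, ?_⟩
    · rw [h6]
      rintro _ ⟨⟩
      exact (next_eq_empty_iff _).2 h2
    · rw [h6]
      exact ⟨_, rfl, h3⟩
  refine (lt_of_lt_of_le ?_ (ENNReal.le_tsum ⟨_, h7⟩)).ne'
  rw [pos_iff_ne_zero, runProb, ne_eq, List.prod_eq_zero_iff]
  simp only [List.mem_map, not_exists, not_and]
  intro γ _
  exact ENNReal.inv_ne_zero.2 (ENNReal.natCast_ne_top _)

end Aug

end NTM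

end ExtMem

namespace ExtMem

/-! ### The hard inputs -/

theorem getElem?_encode_congr {d : ℕ} {v v' : List (List Bool)} (hl : v.length = v'.length)
    (hv : ∀ x ∈ v, x.length = d) (hv' : ∀ x ∈ v', x.length = d) {p : ℕ}
    (h : v[p / (d + 1)]? = v'[p / (d + 1)]?) : (encode v)[p]? = (encode v')[p]? := by
  induction v generalizing v' p with
  | nil =>
    obtain rfl : v' = [] := List.length_eq_zero_iff.1 hl.symm
    rfl
  | cons x v ih =>
    cases v' with
    | nil => cases hl
    | cons x' v' =>
      have hx : (x.map some ++ [none]).length = d + 1 := by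
        simp [hv x List.mem_cons_self]
      have hx' : (x'.map some ++ [none]).length = d + 1 := by
        simp [hv' x' List.mem_cons_self]
      simp only [encode, List.flatMap_cons] at ih ⊢
      rcases lt_or_ge p (d + 1) with hp | hp
      · rw [Nat.div_eq_of_lt hp] at h
        obtain rfl : x = x' := by simpa using h
        have hp' : p < (x.map some ++ [none]).length := by rwa [hx]
        exact (List.getElem?_append_left hp').trans (List.getElem?_append_left hp').symm
      · rw [List.getElem?_append_right (hx.symm ▸ hp), List.getElem?_append_right (hx'.symm ▸ hp),
          hx, hx']
        refine ih (by simpa using hl) (fun y hy => hv y (List.mem_cons_of_mem _ hy))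
          (fun y hy => hv' y (List.mem_cons_of_mem _ hy)) ?_
        obtain ⟨q, rfl⟩ := Nat.exists_eq_add_of_le hp
        have h1 : (d + 1 + q) / (d + 1) = q / (d + 1) + 1 := by
          rw [Nat.add_div_left _ (Nat.succ_pos d)]
        rw [h1, List.getElem?_cons_succ, List.getElem?_cons_succ] at h
        rwa [Nat.add_sub_cancel_left]

theorem length_encode {d : ℕ} {v : List (List Bool)} (hv : ∀ x ∈ v, x.length = d) :
    (encode v).length = v.length * (d + 1) := by
  induction v with
  | nil => simp [encode]
  | cons x v ih =>
    have h1 := ih fun y hy => hv y (List.mem_cons_of_mem _ hy)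
    have h2 := hv x List.mem_cons_self
    simp only [encode, List.flatMap_cons, List.length_append, List.length_map, List.length_cons,
      List.length_nil] at h1 ⊢
    rw [h1, h2]
    ring

theorem map_some_append_none_inj {x x' : List Bool} {l l' : List Letter}
    (h : x.map some ++ [none] ++ l = x'.map some ++ [none] ++ l') : x = x' ∧ l = l' := by
  induction x generalizing x' with
  | nil =>
    cases x' with
    | nil => simpa using h
    | cons a x' => simp at h
  | cons a x ih =>
    cases x' with
    | nil => simp at h
    | cons a' x' =>
      simp only [List.map_cons, List.cons_append, List.cons.injEq, Option.some.injEq] at h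
      obtain ⟨h1, h2⟩ := ih h.2
      exact ⟨by rw [h.1, h1], h2⟩

theorem encode_injective : Function.Injective encode := by
  intro v
  induction v with
  | nil =>
    intro v' h
    cases v' with
    | nil => rfl
    | cons x v' => simp [encode] at h
  | cons x v ih =>
    intro v' h
    cases v' with
    | nil => simp [encode] at h
    | cons x' v' =>
      simp only [encode, List.flatMap_cons] at h
      obtain ⟨h1, h2⟩ := map_some_append_none_inj h
      rw [h1, ih h2]

/-- A string of length `m` for a number below `m`, increasing with that number. -/
def prefixCode (m j : ℕ) : List Bool := List.replicate (m - j) false ++ List.replicate j true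

theorem length_prefixCode {m j : ℕ} (h : j ≤ m) : (prefixCode m j).length = m := by
  simp [prefixCode, h]

theorem append_lt_append_left' (l : List Bool) {s s' : List Bool} (h : s < s') :
    l ++ s < l ++ s' := by
  induction l with
  | nil => exact h
  | cons a l ih => exact List.Lex.cons ih

/-- After `m - j'` common letters the smaller string has `false` and the larger one `true`. -/
theorem prefixCode_append_lt {m j j' : ℕ} (h : j < j') (h' : j' ≤ m) (s s' : List Bool) :
    prefixCode m j ++ s < prefixCode m j' ++ s' := by
  obtain ⟨e, rfl⟩ := Nat.exists_eq_add_of_lt h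
  obtain ⟨c, rfl⟩ := Nat.exists_eq_add_of_le h'
  have h1 : j + e + 1 + c - j = c + (1 + e) := by omega
  have h2 : j + e + 1 + c - (j + e + 1) = c := by omega
  simp only [prefixCode, h1, h2]
  rw [List.replicate_add c, List.append_assoc, List.append_assoc, List.append_assoc]
  refine append_lt_append_left' _ ?_
  rw [List.replicate_add 1 e, List.replicate_succ (n := j + e)]
  exact List.Lex.rel (by decide)

theorem prefixCode_append_inj {m j j' : ℕ} (hj : j < m) (hj' : j' < m) {s s' : List Bool}
    (h : prefixCode m j ++ s = prefixCode m j' ++ s') : j = j' ∧ s = s' := by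
  have h1 : j = j' := by
    rcases lt_trichotomy j j' with hlt | heq | hlt
    · exact absurd (prefixCode_append_lt hlt hj'.le s s') (by rw [h]; exact lt_irrefl _)
    · exact heq
    · exact absurd (prefixCode_append_lt hlt hj.le s' s) (by rw [h]; exact lt_irrefl _)
  subst h1
  exact ⟨rfl, List.append_cancel_left h⟩

/-- The transposition of a `k × k` grid, whose cells are numbered row by row. -/
def transpose (k x : ℕ) : ℕ := x % k * k + x / k

theorem transpose_div {k x : ℕ} (h : x < k * k) : transpose k x / k = x % k := by
  have hk : 0 < k := Nat.pos_of_ne_zero (by rintro rfl; simp at h)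
  have h1 : x / k < k := Nat.div_lt_of_lt_mul h
  rw [transpose, mul_comm, Nat.mul_add_div hk, Nat.div_eq_of_lt h1, add_zero]

theorem transpose_mod {k x : ℕ} (h : x < k * k) : transpose k x % k = x / k := by
  have h1 : x / k < k := Nat.div_lt_of_lt_mul h
  rw [transpose, mul_comm, Nat.mul_add_mod, Nat.mod_eq_of_lt h1]

theorem transpose_lt {k x : ℕ} (h : x < k * k) : transpose k x < k * k := by
  have hk : 0 < k := Nat.pos_of_ne_zero (by rintro rfl; simp at h)
  have h1 : x / k < k := Nat.div_lt_of_lt_mul h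
  have h2 : x % k + 1 ≤ k := Nat.mod_lt _ hk
  have h3 := Nat.mul_le_mul_right k h2
  rw [transpose]
  rw [Nat.add_mul, one_mul] at h3
  omega

theorem transpose_transpose {k x : ℕ} (h : x < k * k) : transpose k (transpose k x) = x := by
  rw [transpose, transpose_mod h, transpose_div h, mul_comm]
  exact Nat.div_add_mod x k

/-- The transposition as a permutation. -/
def transposePerm (k : ℕ) : Equiv.Perm (Fin (k * k)) where
  toFun x := ⟨transpose k x, transpose_lt x.2⟩
  invFun x := ⟨transpose k x, transpose_lt x.2⟩
  left_inv x := Fin.ext (transpose_transpose x.2)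
  right_inv x := Fin.ext (transpose_transpose x.2)

/-- The transposition is far from being monotone or antitone. -/
theorem card_le_of_monotoneOn_transpose {k c : ℕ} {T : Finset ℕ}
    (hT : T ⊆ Finset.range (k * k))
    (h : MonotoneOn (fun x => c + transpose k x) (T : Set ℕ) ∨
      AntitoneOn (fun x => c + transpose k x) (T : Set ℕ)) : T.card ≤ 2 * k := by
  have hlt : ∀ x ∈ T, x < k * k := fun x hx => Finset.mem_range.1 (hT hx)
  rcases h with h | h
  · rw [← Finset.card_range (2 * k)]
    -- Along a monotone set neither row nor column decreases, so their sum identifies the cell.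
    refine Finset.card_le_card_of_injOn (fun x => x / k + x % k) (fun x hx => ?_) ?_
    · have h1 := hlt x hx
      have hk : 0 < k := Nat.pos_of_ne_zero (by rintro rfl; simp at h1)
      have h2 : x / k < k := Nat.div_lt_of_lt_mul h1
      have h3 := Nat.mod_lt x hk
      simp only [Finset.coe_range, Set.mem_Iio]
      omega
    · have key : ∀ x ∈ T, ∀ x' ∈ T, x ≤ x' → x / k + x % k = x' / k + x' % k → x = x' := by
        intro x hx x' hx' hle heq
        have h1 : x / k ≤ x' / k := Nat.div_le_div_right hle
        have h2 : transpose k x ≤ transpose k x' := Nat.le_of_add_le_add_left (h hx hx' hle)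
        have h3 := Nat.div_le_div_right (c := k) h2
        rw [transpose_div (hlt x hx), transpose_div (hlt x' hx')] at h3
        rw [← Nat.div_add_mod x k, ← Nat.div_add_mod x' k, show x / k = x' / k by omega,
          show x % k = x' % k by omega]
      intro x hx x' hx' heq
      rcases le_total x x' with hle | hle
      · exact key x hx x' hx' hle heq
      · exact (key x' hx' x hx hle heq.symm).symm
  · refine le_trans ?_ (by omega : k ≤ 2 * k)
    rw [← Finset.card_range k]
    -- In the antitone case columns do not increase, while within a row the numbering increases with
    -- the column; so each row is met at most once.
    refine Finset.card_le_card_of_injOn (fun x => x / k) (fun x hx => ?_) ?_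
    · simp only [Finset.coe_range, Set.mem_Iio]
      exact Nat.div_lt_of_lt_mul (hlt x hx)
    · have key : ∀ x ∈ T, ∀ x' ∈ T, x ≤ x' → x / k = x' / k → x = x' := by
        intro x hx x' hx' hle heq
        have h2 : transpose k x' ≤ transpose k x := Nat.le_of_add_le_add_left (h hx hx' hle)
        have h3 := Nat.div_le_div_right (c := k) h2
        rw [transpose_div (hlt x hx), transpose_div (hlt x' hx')] at h3
        have h4 := Nat.div_add_mod x k
        have h5 := Nat.div_add_mod x' k
        rw [heq] at h4
        omega
      intro x hx x' hx' heq
      rcases le_total x x' with hle | hle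
      · exact key x hx x' hx' hle heq
      · exact (key x' hx' x hx hle heq.symm).symm

section Word

variable {k n : ℕ}

/-- The strings of the first half of an input. -/
def firstHalf (a : Fin (k * k) → Fin n → Bool) : List (List Bool) :=
  List.ofFn fun i => prefixCode (k * k) (transposePerm k i) ++ List.ofFn (a i)

/-- The strings of the second half of an input. -/
def secondHalf (a : Fin (k * k) → Fin n → Bool) : List (List Bool) :=
  List.ofFn fun j => prefixCode (k * k) j ++ List.ofFn (a ((transposePerm k).symm j))

theorem length_firstHalf (a : Fin (k * k) → Fin n → Bool) : (firstHalf a).length = k * k := by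
  simp [firstHalf]

theorem length_secondHalf (a : Fin (k * k) → Fin n → Bool) : (secondHalf a).length = k * k := by
  simp [secondHalf]

/-- The input whose halves are given by `a` and `b`. -/
def word (a b : Fin (k * k) → Fin n → Bool) : List Letter := encode (firstHalf a ++ secondHalf b)

theorem length_of_mem {a b : Fin (k * k) → Fin n → Bool} {x : List Bool}
    (h : x ∈ firstHalf a ++ secondHalf b) : x.length = k * k + n := by
  rcases List.mem_append.1 h with h | h
  · obtain ⟨i, rfl⟩ := List.mem_ofFn.1 h
    rw [List.length_append, length_prefixCode (transposePerm k i).2.le, List.length_ofFn]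
  · obtain ⟨i, rfl⟩ := List.mem_ofFn.1 h
    rw [List.length_append, length_prefixCode i.2.le, List.length_ofFn]

theorem length_word (a b : Fin (k * k) → Fin n → Bool) :
    (word a b).length = (k * k + k * k) * (k * k + n + 1) := by
  rw [word, length_encode fun _ => length_of_mem, List.length_append, length_firstHalf,
    length_secondHalf]

theorem secondHalf_perm (a : Fin (k * k) → Fin n → Bool) :
    (secondHalf a).Perm (firstHalf a) := by
  have : secondHalf a = List.ofFn ((fun i => prefixCode (k * k) (transposePerm k i) ++
      List.ofFn (a i)) ∘ (transposePerm k).symm) := by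
    simp [secondHalf, Function.comp_def]
  rw [this]
  exact Equiv.Perm.ofFn_comp_perm _ _

theorem secondHalf_pairwise (a : Fin (k * k) → Fin n → Bool) :
    (secondHalf a).Pairwise (· ≤ ·) := by
  rw [secondHalf, List.pairwise_ofFn]
  intro i j hij
  exact (prefixCode_append_lt hij j.2.le _ _).le

/-- The prefix leaves only one candidate in the second half, and its suffix is wrong. -/
theorem exists_mem_firstHalf {a b : Fin (k * k) → Fin n → Bool} {x : Fin (k * k)}
    (h : a x ≠ b x) : ∃ y ∈ firstHalf a, y ∉ secondHalf b := by
  refine ⟨_, List.mem_ofFn.2 ⟨x, rfl⟩, fun hmem => ?_⟩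
  obtain ⟨j, hj⟩ := List.mem_ofFn.1 hmem
  obtain ⟨h1, h2⟩ := prefixCode_append_inj j.2 (transposePerm k x).2 hj
  obtain rfl : j = transposePerm k x := Fin.ext h1
  rw [Equiv.symm_apply_apply] at h2
  exact h (List.ofFn_injective h2).symm

/-- Prefix numbers are below `k * k`, so every prefix begins with `false`. This yields the common
first letter required for crossing. -/
theorem head?_word (hk : 0 < k) (a b : Fin (k * k) → Fin n → Bool) :
    (word a b).head? = some (some false) := by
  have hm : 0 < k * k := Nat.mul_pos hk hk
  obtain ⟨m, hm'⟩ : ∃ m, k * k = m + 1 := ⟨k * k - 1, by omega⟩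
  have h1 : firstHalf a ++ secondHalf b = (firstHalf a ++ secondHalf b).head (by
      simp [firstHalf, hm.ne']) :: (firstHalf a ++ secondHalf b).tail :=
    (List.cons_head_tail _).symm
  have h2 : (firstHalf a)[0]? = some (prefixCode (k * k) (transposePerm k ⟨0, hm⟩) ++
      List.ofFn (a ⟨0, hm⟩)) := by
    rw [firstHalf, List.getElem?_ofFn, dif_pos hm]
  have h3 : ∃ l l', firstHalf a ++ secondHalf b = (false :: l) :: l' := by
    cases hf : firstHalf a with
    | nil => rw [hf] at h2; cases h2
    | cons y l' =>
      rw [hf] at h2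
      simp only [List.getElem?_cons_zero, Option.some.injEq] at h2
      have h4 : k * k - (transposePerm k ⟨0, hm⟩ : ℕ) =
          (k * k - (transposePerm k ⟨0, hm⟩ : ℕ) - 1) + 1 := by
        have := (transposePerm k ⟨0, hm⟩).2
        omega
      rw [prefixCode, h4, List.replicate_succ] at h2
      exact ⟨_, _, by rw [h2]; rfl⟩
  obtain ⟨l, l', h4⟩ := h3
  rw [word, h4]
  rfl

theorem getElem?_word_of_first {a a' b : Fin (k * k) → Fin n → Bool} {x : Fin (k * k)}
    (h : ∀ i ≠ x, a' i = a i) {p : ℕ} (hp : min (p / (k * k + n + 1)) (k * k + k * k) ≠ x) :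
    (word a' b)[p]? = (word a b)[p]? := by
  refine getElem?_encode_congr (d := k * k + n)
    (by rw [List.length_append, List.length_append, length_firstHalf, length_firstHalf])
    (fun _ => length_of_mem) (fun _ => length_of_mem) ?_
  generalize p / (k * k + n + 1) = q at hp
  rcases lt_or_ge q (k * k) with hq | hq
  · rw [List.getElem?_append_left (by rwa [length_firstHalf]),
      List.getElem?_append_left (by rwa [length_firstHalf])]
    simp only [firstHalf, List.getElem?_ofFn, dif_pos hq]
    rw [h ⟨q, hq⟩ fun hh => hp (by rw [← hh]; simp only; omega)]
  · rw [List.getElem?_append_right (by rwa [length_firstHalf]),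
      List.getElem?_append_right (by rwa [length_firstHalf]), length_firstHalf, length_firstHalf]

theorem getElem?_word_of_second {a b b' : Fin (k * k) → Fin n → Bool} {x : Fin (k * k)}
    (h : ∀ i ≠ x, b' i = b i) {p : ℕ}
    (hp : min (p / (k * k + n + 1)) (k * k + k * k) ≠ k * k + transpose k x) :
    (word a b')[p]? = (word a b)[p]? := by
  refine getElem?_encode_congr (d := k * k + n)
    (by rw [List.length_append, List.length_append, length_secondHalf, length_secondHalf])
    (fun _ => length_of_mem) (fun _ => length_of_mem) ?_
  generalize p / (k * k + n + 1) = q at hp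
  rcases lt_or_ge q (k * k) with hq | hq
  · rw [List.getElem?_append_left (by rwa [length_firstHalf]),
      List.getElem?_append_left (by rwa [length_firstHalf])]
  · rw [List.getElem?_append_right (by rwa [length_firstHalf]),
      List.getElem?_append_right (by rwa [length_firstHalf]), length_firstHalf]
    simp only [secondHalf, List.getElem?_ofFn]
    split_ifs with hq'
    · rw [h]
      intro hh
      apply hp
      have h1 : (⟨q - k * k, hq'⟩ : Fin (k * k)) = transposePerm k x := by
        rw [← hh, Equiv.apply_symm_apply]
      have h2 : q - k * k = transpose k x := congrArg Fin.val h1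
      omega
    · rfl

theorem word_mem_yes {P : List (List Bool) → List (List Bool) → Prop}
    (hP : ∀ v v', v'.Perm v → v'.Pairwise (· ≤ ·) → P v v') (a : Fin (k * k) → Fin n → Bool) :
    word a a ∈ (pairProblem P).yes :=
  ⟨_, _, by rw [length_firstHalf, length_secondHalf], rfl,
    hP _ _ (secondHalf_perm a) (secondHalf_pairwise a)⟩

theorem word_mem_inst (P : List (List Bool) → List (List Bool) → Prop)
    (a b : Fin (k * k) → Fin n → Bool) : word a b ∈ (pairProblem P).inst :=
  ⟨_, _, by rw [length_firstHalf, length_secondHalf], rfl⟩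

theorem word_notMem_yes {P : List (List Bool) → List (List Bool) → Prop}
    (hP : ∀ v v', P v v' → ∀ x ∈ v, x ∈ v') {a b : Fin (k * k) → Fin n → Bool} {x : Fin (k * k)}
    (h : a x ≠ b x) : word a b ∉ (pairProblem P).yes := by
  rintro ⟨v, v', h1, h2, h3⟩
  have h4 := encode_injective h2
  have h5 : (firstHalf a).length = v.length := by
    have := congrArg List.length h4
    simp only [List.length_append, length_firstHalf, length_secondHalf] at this ⊢
    omega
  obtain ⟨rfl, rfl⟩ := List.append_inj h4 h5
  obtain ⟨y, h6, h7⟩ := exists_mem_firstHalf h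
  exact h7 (hP _ _ h3 y h6)

end Word

end ExtMem

namespace ExtMem

namespace NTM

variable {t u : ℕ} {M : NTM t u} {R S : ℕ}

/-! ### Counting logs -/

variable (M) in
/-- A type for the records of a run if the head positions are at most `L` and the space is bounded
by `S`. -/
abbrev SnapCode (L S : ℕ) : Type :=
  (Fin t → Fin (L + 1)) × M.State × (Tape t u → Fin (L + 1)) × (Fin u → Fin (S + 1) → M.Sym) ×
    (Fin t → M.Sym)

instance (L S : ℕ) : Finite (M.SnapCode L S) := by
  have := M.finite_state
  have := M.finite_sym
  infer_instance

/-- The code of a record. -/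
def snapCode (L S : ℕ) (e : M.Snap) : M.SnapCode L S :=
  (fun i => Fin.ofNat _ (e.en i), e.state, fun i => Fin.ofNat _ (e.pos i),
    fun j p => e.mem j p, e.sym)

/-- The record respects the bounds. -/
structure SmallSnap (L S : ℕ) (e : M.Snap) : Prop where
  en : ∀ i, e.en i ≤ L
  pos : ∀ i, e.pos i ≤ L
  mem : ∀ j p, S ≤ p → e.mem j p = M.blank

theorem snapCode_injOn (L S : ℕ) : Set.InjOn (snapCode L S) {e : M.Snap | SmallSnap L S e} := by
  rintro ⟨en, q, pos, mem, sym⟩ h ⟨en', q', pos', mem', sym'⟩ h' heq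
  simp only [snapCode, Prod.mk.injEq] at heq
  obtain ⟨h1, h2, h3, h4, h5⟩ := heq
  have key : ∀ {x y : ℕ}, x ≤ L → y ≤ L → Fin.ofNat (L + 1) x = Fin.ofNat (L + 1) y → x = y := by
    intro x y hx hy hxy
    have := congrArg Fin.val hxy
    rwa [Fin.val_ofNat, Fin.val_ofNat, Nat.mod_eq_of_lt (by omega),
      Nat.mod_eq_of_lt (by omega)] at this
  rw [Snap.mk.injEq]
  refine ⟨funext fun i => key (h.en i) (h'.en i) (congrFun h1 i), h2,
    funext fun i => key (h.pos i) (h'.pos i) (congrFun h3 i), funext fun j => funext fun p => ?_, h5⟩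
  rcases lt_or_ge p S with hp | hp
  · exact congrFun (congrFun h4 j) ⟨p, by omega⟩
  · exact (h.mem j p hp).trans (h'.mem j p hp).symm

/-- The code of a log with at most `l` records. -/
def logCode (L S l : ℕ) (log : List M.Snap) (i : Fin l) : Option (M.SnapCode L S) :=
  log[i.val]?.map (snapCode L S)

theorem logCode_inj {L S l : ℕ} {log log' : List M.Snap} (h : log.length ≤ l)
    (h' : log'.length ≤ l) (hs : ∀ e ∈ log, SmallSnap L S e) (hs' : ∀ e ∈ log', SmallSnap L S e)
    (heq : logCode L S l log = logCode L S l log') : log = log' := by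
  refine List.ext_getElem? fun i => ?_
  rcases lt_or_ge i l with hi | hi
  · have h1 : log[i]?.map (snapCode L S) = log'[i]?.map (snapCode L S) := congrFun heq ⟨i, hi⟩
    cases h2 : log[i]? with
    | none =>
      rw [h2] at h1
      cases h3 : log'[i]? with
      | none => rfl
      | some e => rw [h3] at h1; cases h1
    | some e =>
      rw [h2] at h1
      cases h3 : log'[i]? with
      | none => rw [h3] at h1; cases h1
      | some e' =>
        rw [h3] at h1
        simp only [Option.map_some, Option.some.injEq] at h1
        rw [snapCode_injOn L S (hs e (List.mem_of_getElem? h2)) (hs' e' (List.mem_of_getElem? h3))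
          h1]
  · rw [List.getElem?_eq_none (by omega), List.getElem?_eq_none (by omega)]

namespace Aug

theorem smallSnap_of_mem_log {w : List Letter} (hM : Resources M R S w) {l c : ℕ} {A : M.Aug}
    (h : Relation.ReflTransGen (Step (Book.initial t l c)) (init M w) A) :
    ∀ e ∈ A.log, SmallSnap (runBound M R S w.length) S e := by
  induction h with
  | refl => intro e he; cases he
  | @tail A A' h1 h2 ih =>
    have h3 := h1.tail h2
    obtain ⟨γ, hγ, rfl⟩ := h2
    have h4 := reach_of_reflTransGen h3
    have h5 := extPos_lt_runBound hM h1
    have h6 := extPos_lt_runBound hM h3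
    rw [conf_step] at h4 h6
    by_cases he : (A.book (Book.initial t l c)).Event (extPos A.conf) (extPos γ)
    · rw [step_of_event he]
      intro e he
      rcases List.mem_cons.1 he with rfl | he
      · exact ⟨fun i => (h5 _).le, fun i => (h6 i).le, fun j p hp => hM.tape_eq_blank h4 j hp⟩
      · exact ih e he
    · rw [step_of_not_event he]
      exact ih

end Aug

open Aug in
/-- A machine with small resources does not solve the problem. -/
theorem not_solvesOneSided {P : List (List Bool) → List (List Bool) → Prop}
    (hP : ∀ v v', v'.Perm v → v'.Pairwise (· ≤ ·) → P v v')
    (hP' : ∀ v v', P v v' → ∀ x ∈ v, x ∈ v') {k n N Λ : ℕ}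
    (hN : N = (k * k + k * k) * (k * k + n + 1))
    (hM : ∀ w : List Letter, w.length = N → Resources M R S w)
    (hΛ : R * ((2 * t + 1) ^ R * (t * (k * k + k * k) + 1)) ≤ Λ)
    (hbad : R * Book.pairBound t (2 * k) R < k * k)
    (hQ : 2 * (Nat.card (M.SnapCode (runBound M R S N) S) + 1) ^ Λ < 2 ^ n) :
    ¬ SolvesOneSided M (pairProblem P) := by
  classical
  intro hsol
  set L := runBound M R S N with hL
  set b := Book.initial t (k * k + n + 1) (k * k + k * k) with hb
  have hk : 0 < k := Nat.pos_of_ne_zero (by rintro rfl; simp at hbad)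
  have hm : 0 < k * k := Nat.mul_pos hk hk
  have hlen : ∀ a a' : Fin (k * k) → Fin n → Bool, (word a a').length = N := fun a a' => by
    rw [length_word, hN]
  have hres : ∀ a a' : Fin (k * k) → Fin n → Bool, Resources M R S (word a a') := fun a a' =>
    hM _ (hlen a a')
  obtain ⟨f, hf⟩ := exists_choices (b := b) (a := L)
    (w := fun a : Fin (k * k) → Fin n → Bool => word a a)
    (fun a ρ hρ => by
      have := length_le_runBound (hres a a) hρ
      rwa [hlen] at this)
    (fun a => (hsol _ (word_mem_inst P a a)).1 (word_mem_yes hP a))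
  set U := Finset.univ.filter fun a : Fin (k * k) → Fin n → Bool =>
    Acc b f (Aug.init M (word a a)) with hU
  have hacc : ∀ a : {a // a ∈ U}, ∃ F, Relation.ReflTransGen (DStep b f)
      (Aug.init M (word a.1 a.1)) F ∧ app F.conf = ∅ ∧ F.conf.state ∈ M.accept :=
    fun a => (Finset.mem_filter.1 a.2).2
  choose F hF1 hF2 hF3 using hacc
  have hreach : ∀ a, Relation.ReflTransGen (Step b) (Aug.init M (word a.1 a.1)) (F a) :=
    fun a => reflTransGen_step (hF1 a)
  have hlegit : ∀ a, b.LegitLog (moves (F a).log) := fun a =>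
    ((wf_init _ _ _).reflTransGen (hreach a)).legit
  have hphase : ∀ a, ((F a).book b).phase < R := fun a => phase_lt (hres a.1 a.1) (hreach a)
  have hloglen : ∀ a, (F a).log.length ≤ Λ := fun a => by
    have h1 := Book.length_le_of_legitLog (hlegit a) rfl
    have h2 : (((F a).book b).phase + 1) * ((2 * t + 1) ^ ((F a).book b).phase *
        (t * (k * k + k * k) + 1)) ≤ R * ((2 * t + 1) ^ R * (t * (k * k + k * k) + 1)) :=
      Nat.mul_le_mul (hphase a) (Nat.mul_le_mul_right _
        (Nat.pow_le_pow_right (by omega) (hphase a).le))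
    have h3 : (moves (F a).log).length = (F a).log.length := List.length_map _
    rw [h3] at h1
    have h4 := h1.trans h2
    omega
  have hsmall : ∀ a, ∀ e ∈ (F a).log, SmallSnap L S e := fun a => by
    have := smallSnap_of_mem_log (hres a.1 a.1) (hreach a)
    rwa [hlen] at this
  have : Fintype (M.SnapCode L S) := Fintype.ofFinite _
  -- many accepted inputs with the same log
  obtain ⟨σ, -, hσ⟩ := Finset.exists_lt_card_fiber_of_mul_lt_card_of_maps_to
    (s := U.attach) (t := (Finset.univ : Finset (Fin Λ → Option (M.SnapCode L S))))
    -- This is the number of ways to fill all suffixes but one. A larger class contains two inputs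
    -- that agree off any prescribed string.
    (f := fun a => logCode L S Λ (F a).log) (n := (2 ^ n) ^ (k * k - 1))
    (fun _ _ => Finset.mem_univ _) (by
      rw [Finset.card_attach, Finset.card_univ, Fintype.card_fun, Fintype.card_option,
        Fintype.card_fin, ← Nat.card_eq_fintype_card]
      have h1 : Fintype.card (Fin (k * k) → Fin n → Bool) = 2 ^ n * (2 ^ n) ^ (k * k - 1) := by
        rw [Fintype.card_fun, Fintype.card_fun, Fintype.card_bool, Fintype.card_fin,
          Fintype.card_fin, ← pow_succ', Nat.sub_add_cancel hm]
      rw [h1] at hf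
      have h2 : 0 < (2 ^ n) ^ (k * k - 1) := by positivity
      have h3 := Nat.mul_lt_mul_of_pos_right hQ h2
      rw [mul_assoc] at h3
      omega)
  set Z := U.attach.filter fun a => logCode L S Λ (F a).log = σ with hZ
  have hlog : ∀ a ∈ Z, ∀ a' ∈ Z, (F a').log = (F a).log := fun a ha a' ha' =>
    logCode_inj (hloglen a') (hloglen a) (hsmall a') (hsmall a)
      ((Finset.mem_filter.1 ha').2.trans (Finset.mem_filter.1 ha).2.symm)
  -- The bookkeeping is a function of the log, so a position found for `a₀` works for all of `Z`.
  obtain ⟨a₀, ha₀⟩ : Z.Nonempty := Finset.card_pos.1 (by omega)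
  -- a position whose strings are never involved in the same block
  obtain ⟨B, hB1, hB2⟩ := Book.exists_card_le_of_legitLog (m := k * k) (Y := 2 * k)
    (y := fun x => k * k + transpose k x)
    (fun T hT h => card_le_of_monotoneOn_transpose hT h) (hlegit a₀)
  obtain ⟨x, hx, hxB⟩ : ∃ x ∈ Finset.range (k * k), x ∉ B := by
    refine Finset.exists_mem_notMem_of_card_lt_card ?_
    rw [Finset.card_range]
    refine lt_of_le_of_lt (hB1.trans ?_) hbad
    exact Nat.mul_le_mul (hphase a₀) (Book.pairBound_mono _ _ (hphase a₀).le)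
  rw [Finset.mem_range] at hx
  -- two accepted inputs that differ only there
  obtain ⟨a, ha, a', ha', hne, heq⟩ := Finset.exists_ne_map_eq_of_card_lt_of_maps_to
    (s := Z) (t := (Finset.univ : Finset ({i : Fin (k * k) // i ≠ ⟨x, hx⟩} → Fin n → Bool)))
    (f := fun a i => a.1 i.1) (by
      rw [Finset.card_univ, Fintype.card_fun, Fintype.card_fun, Fintype.card_bool,
        Fintype.card_fin, Fintype.card_subtype_compl, Fintype.card_fin, Fintype.card_subtype_eq]
      exact hσ) (fun _ _ => Finset.mem_univ _)
  have hoff : ∀ i ≠ (⟨x, hx⟩ : Fin (k * k)), a'.1 i = a.1 i := fun i hi =>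
    (congrFun heq ⟨i, hi⟩).symm
  have hon : a'.1 ⟨x, hx⟩ ≠ a.1 ⟨x, hx⟩ := by
    intro h
    refine hne (Subtype.ext (funext fun i => ?_))
    by_cases hi : i = ⟨x, hx⟩
    · rw [hi, h]
    · exact (hoff i hi).symm
  -- The mixed word differs from `word a a` only in string `x` and from `word a' a'` only in its
  -- partner in the second half.
  have hC : Acc b f (Aug.init M (word a'.1 a.1)) := by
    refine acc_of_cross (wA := word a.1 a.1) (wB := word a'.1 a'.1) (x := x)
      (x' := k * k + transpose k x) ?_ ?_ ?_ ?_ ?_ (hF1 a) (hF1 a') (hF2 a) (hF2 a')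
      (hlog a ha a' ha') (hF3 a) (hF3 a') ?_
    · rw [head?_word hk, head?_word hk]
      exact fun _ h => h
    · rw [head?_word hk, head?_word hk]
      exact fun _ h => h
    · intro h
      have := head?_word hk a.1 a.1
      rw [h] at this
      cases this
    · exact fun p hp => getElem?_word_of_first hoff hp
    · exact fun p hp => getElem?_word_of_second (x := ⟨x, hx⟩) (fun i hi => (hoff i hi).symm) hp
    · intro l hl
      rw [hlog a₀ ha₀ a ha] at hl
      by_contra! hcon
      exact hxB (hB2 _ (hl.map _) x hx hcon.1 hcon.2)
  exact hC.acceptProb_ne_zero ((hsol _ (word_mem_inst P a'.1 a.1)).2 (word_notMem_yes hP' hon))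

end NTM

end ExtMem

/-! ### Estimates for the number of logs, and the asymptotics -/

namespace ExtMem

namespace NTM

variable {t u : ℕ} {M : NTM t u}

theorem card_core_le (M : NTM t u) (S : ℕ) : Nat.card (M.Core S) ≤
    2 ^ ((Nat.card M.State + u + Nat.card M.Sym * u + Nat.card M.Sym * t) * (S + 1)) := by
  have := M.finite_state
  have := M.finite_sym
  set q := Nat.card M.State
  set g := Nat.card M.Sym
  have hg : g ≤ 2 ^ g := Nat.lt_two_pow_self.le
  have hcard : Nat.card (M.Core S) = q * ((S + 1) ^ u * ((g ^ (S + 1)) ^ u * g ^ t)) := by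
    simp [Core, Nat.card_prod, Nat.card_fun, q, g]
  calc Nat.card (M.Core S) = q * ((S + 1) ^ u * ((g ^ (S + 1)) ^ u * g ^ t)) := hcard
    _ ≤ 2 ^ q * ((2 ^ (S + 1)) ^ u * (((2 ^ g) ^ (S + 1)) ^ u * (2 ^ g) ^ t)) := by
        gcongr
        · exact Nat.lt_two_pow_self.le
        · exact Nat.lt_two_pow_self.le
    _ = 2 ^ (q + ((S + 1) * u + (g * (S + 1) * u + g * t))) := by
        simp only [← pow_mul, ← pow_add]
    _ ≤ _ := Nat.pow_le_pow_right two_pos (by nlinarith [Nat.zero_le (q * S), Nat.zero_le (g * t * S)])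

/-- A core takes `O(S + 1)` bits and enters with exponent `R`. This is where the product of space
and reversals matters: a head position takes `O(k²)` bits. -/
theorem runBound_succ_le (M : NTM t u) {R S N k : ℕ} (hk : 0 < k) (hN : N + 1 ≤ k ^ 9)
    (hS : (S + 1) * R ≤ 3 * (k * k)) : Aug.runBound M R S N + 1 ≤
    2 ^ ((10 + 3 * (t + 2 + (Nat.card M.State + u + Nat.card M.Sym * u + Nat.card M.Sym * t))) *
      (k * k)) := by
  set c := Nat.card M.State + u + Nat.card M.Sym * u + Nat.card M.Sym * t
  have h1 : 1 + (t + 1) * Nat.card (M.Core S) ≤ 2 ^ ((t + 2 + c) * (S + 1)) := by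
    have h2 := card_core_le M S
    have h3 : 1 ≤ 2 ^ (c * (S + 1)) := Nat.one_le_two_pow
    calc 1 + (t + 1) * Nat.card (M.Core S) ≤ (t + 2) * 2 ^ (c * (S + 1)) := by nlinarith
      _ ≤ 2 ^ ((t + 2) * (S + 1)) * 2 ^ (c * (S + 1)) := by
          gcongr
          exact Nat.lt_two_pow_self.le.trans
            (Nat.pow_le_pow_right two_pos (Nat.le_mul_of_pos_right _ S.succ_pos))
      _ = _ := by rw [← pow_add]; ring_nf
  have h4 : N + 1 ≤ 2 ^ (9 * (k * k)) := by
    calc N + 1 ≤ k ^ 9 := hN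
      _ ≤ (2 ^ (k * k)) ^ 9 := by
          gcongr
          exact (Nat.le_mul_of_pos_right _ hk).trans Nat.lt_two_pow_self.le
      _ = _ := by rw [← pow_mul]; ring_nf
  have h5 : Aug.runBound M R S N ≤ 2 ^ ((9 + 3 * (t + 2 + c)) * (k * k)) := by
    calc Aug.runBound M R S N = (N + 1) * (1 + (t + 1) * Nat.card (M.Core S)) ^ R := rfl
      _ ≤ 2 ^ (9 * (k * k)) * (2 ^ ((t + 2 + c) * (S + 1))) ^ R := by gcongr
      _ = 2 ^ (9 * (k * k) + (t + 2 + c) * ((S + 1) * R)) := by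
          rw [← pow_mul, ← pow_add, mul_assoc (t + 2 + c)]
      _ ≤ _ := Nat.pow_le_pow_right two_pos (by nlinarith)
  have h6 : 1 ≤ 2 ^ ((9 + 3 * (t + 2 + c)) * (k * k)) := Nat.one_le_two_pow
  calc Aug.runBound M R S N + 1 ≤ 2 ^ 1 * 2 ^ ((9 + 3 * (t + 2 + c)) * (k * k)) := by omega
    _ = 2 ^ (1 + (9 + 3 * (t + 2 + c)) * (k * k)) := by rw [← pow_add]
    _ ≤ _ := Nat.pow_le_pow_right two_pos (by nlinarith [Nat.mul_pos hk hk])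

theorem card_snapCode_succ_le (M : NTM t u) {L S c k : ℕ} (hk : 0 < k)
    (hL : L + 1 ≤ 2 ^ (c * (k * k))) (hS : S + 1 ≤ 3 * (k * k)) :
    Nat.card (M.SnapCode L S) + 1 ≤ 2 ^ ((c * t + Nat.card M.State + c * (t + u) +
      Nat.card M.Sym * 3 * u + Nat.card M.Sym * t + 1) * (k * k)) := by
  have := M.finite_state
  have := M.finite_sym
  set q := Nat.card M.State
  set g := Nat.card M.Sym
  have hkk : 1 ≤ k * k := Nat.mul_pos hk hk
  have hg : g ≤ 2 ^ g := Nat.lt_two_pow_self.le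
  have hcard : Nat.card (M.SnapCode L S) =
      (L + 1) ^ t * (q * ((L + 1) ^ (t + u) * ((g ^ (S + 1)) ^ u * g ^ t))) := by
    simp [SnapCode, Nat.card_prod, Nat.card_fun, q, g]
  set d := c * t + q + c * (t + u) + g * 3 * u + g * t with hd
  have h1 : Nat.card (M.SnapCode L S) ≤ 2 ^ (d * (k * k)) := by
    calc Nat.card (M.SnapCode L S)
        = (L + 1) ^ t * (q * ((L + 1) ^ (t + u) * ((g ^ (S + 1)) ^ u * g ^ t))) := hcard
      _ ≤ (2 ^ (c * (k * k))) ^ t * (2 ^ q * ((2 ^ (c * (k * k))) ^ (t + u) *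
          (((2 ^ g) ^ (S + 1)) ^ u * (2 ^ g) ^ t))) := by
          gcongr
          exact Nat.lt_two_pow_self.le
      _ = 2 ^ (c * (k * k) * t + (q + (c * (k * k) * (t + u) + (g * (S + 1) * u + g * t)))) := by
          simp only [← pow_mul, ← pow_add]
      _ ≤ _ := by
          refine Nat.pow_le_pow_right two_pos ?_
          have e1 : q ≤ q * (k * k) := Nat.le_mul_of_pos_right _ hkk
          have e2 : g * t ≤ g * t * (k * k) := Nat.le_mul_of_pos_right _ hkk
          have e3 : g * (S + 1) * u ≤ g * (3 * (k * k)) * u := by gcongr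
          rw [hd]
          nlinarith
  have h2 : 1 ≤ 2 ^ (d * (k * k)) := Nat.one_le_two_pow
  calc Nat.card (M.SnapCode L S) + 1 ≤ 2 ^ 1 * 2 ^ (d * (k * k)) := by omega
    _ = 2 ^ (1 + d * (k * k)) := by rw [← pow_add]
    _ ≤ _ := Nat.pow_le_pow_right two_pos (by nlinarith)

/-- In the base, `4` absorbs the factor `2 * R`, and `(t + 1) ^ 4` the square of the number of
relations. -/
theorem mul_pairBound_lt {R k : ℕ} (hR : 1 ≤ R) (hD : (4 * (t + 1) ^ 4) ^ R < k) :
    R * Book.pairBound t (2 * k) R < k * k := by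
  have h1 : 2 * R ≤ 4 ^ R := by
    have h2 : R < 2 ^ R := Nat.lt_two_pow_self
    have h3 : 2 ^ 1 ≤ 2 ^ R := Nat.pow_le_pow_right two_pos hR
    calc 2 * R ≤ 2 ^ R * 2 ^ R := by nlinarith
      _ = 4 ^ R := (mul_pow 2 2 R).symm
  have h4 : t * (t + 1) ^ R ≤ (t + 1) ^ R * (t + 1) ^ R := by
    gcongr
    exact t.le_succ.trans (Nat.le_self_pow (by omega) _)
  calc R * Book.pairBound t (2 * k) R = 2 * R * (t * (t + 1) ^ R) ^ 2 * k := by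
        rw [Book.pairBound]; ring
    _ ≤ 4 ^ R * ((t + 1) ^ R * (t + 1) ^ R) ^ 2 * k := by gcongr
    _ = (4 * (t + 1) ^ 4) ^ R * k := by rw [mul_pow 4, ← pow_mul (t + 1) 4 R]; ring
    _ < k * k := Nat.mul_lt_mul_of_pos_right hD (by omega)

theorem mul_pow_le {R k : ℕ} (hk : 0 < k) (hD : (4 * (t + 1) ^ 4) ^ R < k) :
    R * ((2 * t + 1) ^ R * (t * (k * k + k * k) + 1)) ≤ (2 * t + 1) * (k * k * k) := by
  have hkk : 1 ≤ k * k := Nat.mul_pos hk hk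
  have h1 : R * (2 * t + 1) ^ R ≤ k := by
    calc R * (2 * t + 1) ^ R ≤ 2 ^ R * (2 * t + 1) ^ R := by
          gcongr
          exact Nat.lt_two_pow_self.le
      _ = (2 * (2 * t + 1)) ^ R := by rw [mul_pow]
      _ ≤ (4 * (t + 1) ^ 4) ^ R := by
          refine Nat.pow_le_pow_left ?_ R
          calc 2 * (2 * t + 1) ≤ 4 * (t + 1) := by omega
            _ ≤ 4 * (t + 1) ^ 4 := by gcongr; exact Nat.le_self_pow (by omega) _
      _ ≤ k := hD.le
  calc R * ((2 * t + 1) ^ R * (t * (k * k + k * k) + 1))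
      = R * (2 * t + 1) ^ R * (t * (k * k + k * k) + 1) := by ring
    _ ≤ k * ((2 * t + 1) * (k * k)) := by gcongr; nlinarith
    _ = _ := by ring

/-- `O(k³)` records of `O(k²)` bits each give `O(k ^ 5)` bits, fewer than the `k ^ 6` bits of one
suffix. -/
theorem exists_snapCode_pow_lt (M : NTM t u) : ∃ k₀, ∀ k ≥ k₀, ∀ R S N, N + 1 ≤ k ^ 9 →
    1 ≤ R → (S + 1) * R ≤ 3 * (k * k) →
    2 * (Nat.card (M.SnapCode (Aug.runBound M R S N) S) + 1) ^ ((2 * t + 1) * (k * k * k)) <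
      2 ^ k ^ 6 := by
  set c := 10 + 3 * (t + 2 + (Nat.card M.State + u + Nat.card M.Sym * u + Nat.card M.Sym * t))
    with hc
  set d := c * t + Nat.card M.State + c * (t + u) + Nat.card M.Sym * 3 * u + Nat.card M.Sym * t + 1
    with hd
  refine ⟨d * (2 * t + 1) + 2, fun k hk R S N hN hR hS => ?_⟩
  have hk0 : 0 < k := by omega
  have h1 := card_snapCode_succ_le M hk0 (runBound_succ_le M hk0 hN hS)
    ((Nat.le_mul_of_pos_right _ hR).trans hS)
  rw [← hc, ← hd] at h1
  calc 2 * (Nat.card (M.SnapCode (Aug.runBound M R S N) S) + 1) ^ ((2 * t + 1) * (k * k * k))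
      ≤ 2 ^ 1 * (2 ^ (d * (k * k))) ^ ((2 * t + 1) * (k * k * k)) := by gcongr; simp
    _ = 2 ^ (1 + d * (2 * t + 1) * k ^ 5) := by
        rw [← pow_mul, ← pow_add]; congr 1; ring
    _ < 2 ^ k ^ 6 := by
        refine Nat.pow_lt_pow_right (by norm_num) ?_
        have h2 : (d * (2 * t + 1) + 2) * k ^ 5 ≤ k * k ^ 5 := by gcongr
        have h3 : 0 < k ^ 5 := by positivity
        nlinarith

theorem exists_not_solvesOneSided (M : NTM t u) {P : List (List Bool) → List (List Bool) → Prop}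
    (hP : ∀ v v', v'.Perm v → v'.Pairwise (· ≤ ·) → P v v')
    (hP' : ∀ v v', P v v' → ∀ x ∈ v, x ∈ v') : ∃ k₀, ∀ k ≥ k₀, ∀ R S N,
    N = (k * k + k * k) * (k * k + k ^ 6 + 1) → N + 1 ≤ k ^ 9 →
    (∀ w : List Letter, w.length = N → Resources M R S w) → 1 ≤ R →
    (4 * (t + 1) ^ 4) ^ R < k → (S + 1) * R ≤ 3 * (k * k) →
    ¬ SolvesOneSided M (pairProblem P) := by
  obtain ⟨k₀, h⟩ := exists_snapCode_pow_lt M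
  exact ⟨k₀, fun k hk R S N hN hN' hM hR hD hS => not_solvesOneSided hP hP' hN hM
    (mul_pow_le (by omega) hD) (mul_pairBound_lt hR hD) (h k hk R S N hN' hR hS)⟩

theorem IsBounded.resources {r s : ℕ → ℕ} (h : M.IsBounded r s) (w : List Letter) :
    Resources M (r w.length) (s w.length) w where
  finite := (h w).1
  rev_le ρ hρ := ((h w).2 ρ hρ).1
  space_le ρ hρ := ((h w).2 ρ hρ).2

theorem IsBounded.one_le {r s : ℕ → ℕ} (h : M.IsBounded r s) (N : ℕ) : 1 ≤ r N := by
  have h1 := Aug.phase_lt (h.resources (List.replicate N none)) (l := 0) (c := 0)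
    Relation.ReflTransGen.refl
  rw [List.length_replicate] at h1
  omega

end NTM

/-- The length of an input with `2 k²` words of length `k² + k⁶` each. -/
def hardLength (k : ℕ) : ℕ := (k * k + k * k) * (k * k + k ^ 6 + 1)

theorem le_hardLength (k : ℕ) : k ≤ hardLength k := by
  rw [hardLength]
  nlinarith [Nat.le_mul_self k, Nat.zero_le ((k * k + k * k) * (k * k + k ^ 6))]

theorem tendsto_hardLength : Tendsto hardLength atTop atTop :=
  tendsto_atTop_mono le_hardLength tendsto_id

theorem hardLength_le {k : ℕ} (hk : 1 ≤ k) : hardLength k ≤ 6 * k ^ 8 := by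
  have h1 : k ^ 2 ≤ k ^ 8 := Nat.pow_le_pow_right hk (by norm_num)
  have h2 : k ^ 4 ≤ k ^ 8 := Nat.pow_le_pow_right hk (by norm_num)
  rw [hardLength]
  calc _ = 2 * k ^ 4 + 2 * k ^ 8 + 2 * k ^ 2 := by ring
    _ ≤ _ := by omega

theorem hardLength_succ_le {k : ℕ} (hk : 7 ≤ k) : hardLength k + 1 ≤ k ^ 9 := by
  have h1 := hardLength_le (k := k) (by omega)
  have h2 : 0 < k ^ 8 := by positivity
  calc hardLength k + 1 ≤ 7 * k ^ 8 := by omega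
    _ ≤ k * k ^ 8 := by gcongr
    _ = k ^ 9 := by ring

theorem eventually_pow_lt {r : ℕ → ℕ}
    (hr : (fun N : ℕ => (r N : ℝ)) =o[atTop] fun N : ℕ => Real.log (N : ℝ)) {D : ℕ} (hD : 2 ≤ D) :
    ∀ᶠ k in atTop, D ^ r (hardLength k) < k := by
  have hlogD : 0 < Real.log D := Real.log_pos (by exact_mod_cast hD)
  -- Since `log (hardLength k) ≤ 9 * log k`, any denominator above 9 works; 10 makes the power at
  -- most `k ^ (9 / 10)`.
  have h1 := tendsto_hardLength.eventually (hr.def (c := 1 / (10 * Real.log D)) (by positivity))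
  filter_upwards [h1, eventually_ge_atTop 7] with k hk hk7
  have hk0 : (1 : ℝ) < k := by exact_mod_cast (by omega : 1 < k)
  have hN1 : (1 : ℝ) ≤ hardLength k := by
    exact_mod_cast (by have := le_hardLength k; omega : 1 ≤ hardLength k)
  rw [Real.norm_of_nonneg (Nat.cast_nonneg _), Real.norm_of_nonneg (Real.log_nonneg hN1)] at hk
  have h2 : Real.log (hardLength k) ≤ 9 * Real.log k := by
    have h3 : (hardLength k : ℝ) ≤ (k : ℝ) ^ 9 := by
      exact_mod_cast (Nat.le_succ _).trans (hardLength_succ_le hk7)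
    have h4 := Real.log_le_log (by linarith) h3
    rwa [Real.log_pow] at h4
  have h5 : r (hardLength k) * Real.log D ≤ 1 / 10 * (9 * Real.log k) := by
    calc r (hardLength k) * Real.log D
        ≤ 1 / (10 * Real.log D) * Real.log (hardLength k) * Real.log D := by gcongr
      _ = 1 / 10 * Real.log (hardLength k) := by field_simp
      _ ≤ _ := by gcongr
  have h6 : Real.log ((D : ℝ) ^ r (hardLength k)) < Real.log k := by
    rw [Real.log_pow]
    have := Real.log_pos hk0
    linarith
  have h7 := (Real.log_lt_log_iff (by positivity) (by positivity)).1 h6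
  exact_mod_cast h7

/-- The fourth root fits because `hardLength k ≤ 6 * k ^ 8 ≤ (2 * k²) ^ 4`. -/
theorem eventually_mul_le {r s : ℕ → ℕ} (hr : ∀ N, 1 ≤ r N)
    (hs : (fun N : ℕ => (s N : ℝ)) =o[atTop] fun N : ℕ => (N : ℝ) ^ (1 / 4 : ℝ) / (r N : ℝ)) :
    ∀ᶠ k in atTop, s (hardLength k) * r (hardLength k) ≤ 2 * (k * k) := by
  have h1 := tendsto_hardLength.eventually (hs.def (c := 1) one_pos)
  filter_upwards [h1, eventually_ge_atTop 1] with k hk hk1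
  have hr0 : (0 : ℝ) < r (hardLength k) := by exact_mod_cast hr (hardLength k)
  rw [Real.norm_of_nonneg (Nat.cast_nonneg _), Real.norm_of_nonneg (by positivity), one_mul,
    le_div_iff₀ hr0] at hk
  have h2 : ((hardLength k : ℕ) : ℝ) ^ (1 / 4 : ℝ) ≤ 2 * (k * k) := by
    have h3 : ((hardLength k : ℕ) : ℝ) ≤ (2 * (k * k) : ℝ) ^ (4 : ℝ) := by
      rw [show (4 : ℝ) = ((4 : ℕ) : ℝ) by norm_num, Real.rpow_natCast]
      calc ((hardLength k : ℕ) : ℝ) ≤ 6 * (k : ℝ) ^ 8 := by exact_mod_cast hardLength_le hk1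
        _ ≤ 16 * (k : ℝ) ^ 8 := by gcongr; norm_num
        _ = _ := by ring
    calc ((hardLength k : ℕ) : ℝ) ^ (1 / 4 : ℝ) ≤ ((2 * (k * k) : ℝ) ^ (4 : ℝ)) ^ (1 / 4 : ℝ) := by
          gcongr
      _ = 2 * (k * k) := by
          rw [← Real.rpow_mul (by positivity)]
          norm_num
  exact_mod_cast hk.trans h2

/-- Problems between `CheckSort` and the inclusion of sets are not in `RST(r, s, O(1))`. -/
theorem pairProblem_notMem_RSTConst {P : List (List Bool) → List (List Bool) → Prop}
    (hP : ∀ v v', v'.Perm v → v'.Pairwise (· ≤ ·) → P v v')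
    (hP' : ∀ v v', P v v' → ∀ x ∈ v, x ∈ v') {r s : ℕ → ℕ}
    (hr : (fun N : ℕ => (r N : ℝ)) =o[atTop] fun N : ℕ => Real.log (N : ℝ))
    (hs : (fun N : ℕ => (s N : ℝ)) =o[atTop] fun N : ℕ => (N : ℝ) ^ (1 / 4 : ℝ) / (r N : ℝ)) :
    pairProblem P ∉ RSTConst r s := by
  intro hmem
  obtain ⟨t, u, M, hM, hsol⟩ := Set.mem_iUnion.1 hmem
  obtain ⟨k₀, h⟩ := M.exists_not_solvesOneSided hP hP'
  have hD : 2 ≤ 4 * (t + 1) ^ 4 := by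
    have : 0 < (t + 1) ^ 4 := by positivity
    omega
  obtain ⟨k, h1, h2, h3, h4⟩ := ((eventually_pow_lt hr hD).and ((eventually_mul_le hM.one_le hs).and
    ((eventually_ge_atTop k₀).and (eventually_ge_atTop 7)))).exists
  -- Together with `s * r ≤ 2 * k²` this yields the required `(s + 1) * r ≤ 3 * k²`.
  have h5 : r (hardLength k) ≤ k * k := by
    calc r (hardLength k) ≤ (4 * (t + 1) ^ 4) ^ r (hardLength k) := (Nat.lt_pow_self hD).le
      _ ≤ k := h1.le
      _ ≤ k * k := Nat.le_mul_self k
  exact h k h3 (r (hardLength k)) (s (hardLength k)) (hardLength k) rfl (hardLength_succ_le h4)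
    (fun w hw => hw ▸ hM.resources w) (hM.one_le _) h1 (by rw [add_one_mul]; omega) hsol

end ExtMem

theorem theorem6 (r s : ℕ → ℕ)
    (hr : (fun N : ℕ => (r N : ℝ)) =o[atTop] fun N : ℕ => Real.log (N : ℝ))
    (hs : (fun N : ℕ => (s N : ℝ)) =o[atTop] fun N : ℕ => (N : ℝ) ^ (1 / 4 : ℝ) / (r N : ℝ)) :
    ExtMem.checkSort ∉ ExtMem.RSTConst r s ∧
    ExtMem.setEquality ∉ ExtMem.RSTConst r s ∧
    ExtMem.multisetEquality ∉ ExtMem.RSTConst r s := by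
  refine ⟨ExtMem.pairProblem_notMem_RSTConst (fun v v' h h' => ⟨h, h'⟩)
      (fun v v' h x hx => h.1.mem_iff.2 hx) hr hs,
    ExtMem.pairProblem_notMem_RSTConst (fun v v' h _ => Set.ext fun x => h.symm.mem_iff)
      (fun v v' h x hx => h.subset hx) hr hs,
    ExtMem.pairProblem_notMem_RSTConst (fun v v' h _ => Multiset.coe_eq_coe.2 h.symm)
      (fun v v' h x hx => (Multiset.coe_eq_coe.1 h).mem_iff.1 hx) hr hs⟩
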